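/- Let $X$ be a compact complex manifold of dimension $n$, let $\omega_0$ be a Kähler form and $B_0$ a closed real $(1,1)$-form on $X$, and put $\omega_0^{\mathbb C}=B_0+i\omega_0$. Let $\gamma=|\gamma|e^{-i\hat\vartheta}\in\mathbb C$ with $\hat\vartheta\in\mathbb R$ and $\gamma\int_X(\omega_0^{\mathbb C})^n\in\mathbb R$. For $\varphi\in C^\infty(X,\mathbb C)$ write $\omega^{\mathbb C}_\varphi=\omega_0^{\mathbb C}+i\partial\bar\partial\varphi=B_\varphi+i\omega_\varphi$, so that $B_\varphi=B_0+i\partial\bar\partial\,\mathrm{Re}\,\varphi$ and $\omega_\varphi=\omega_0+i\partial\bar\partial\,\mathrm{Im}\,\varphi$. For a Kähler form $\omega=i\sum g_{a\bar b}dz^a\wedge d\bar z^b$, let $s(\omega)=-g^{a\bar b}\partial_a\partial_{\bar b}\log\det g$ be its scalar curvature, $\|\partial f\|^2_\omega=g^{a\bar b}\partial_af\,\partial_{\bar b}f$ for $f$ real, and $\mathcal D_\omega f=\bar\partial(\nabla^{1,0}f)$, where $(\nabla^{1,0}f)^a=g^{a\bar b}\partial_{\bar b}f$; $L^2(\omega)$-norms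 are taken with respect to the volume form $\omega^n$. Let $c_\gamma\in\mathbb R$ be defined by $\int_Xs(\omega_0)\,\omega_0^n=c_\gamma\int_X\omega_0^n+\gamma\int_X(\omega_0^{\mathbb C})^n$. The complexified K-energy $\tilde{\mathcal M}$ is the functional on $\{\varphi\in C^\infty(X,\mathbb C):\omega_\varphi>0\}$ with first variation $$(\mathrm d\tilde{\mathcal M})_{\varphi}(\psi)=\sigma_{\omega^{\mathbb C}_\varphi}(\psi)=\int_X\mathrm{Im}\left[\psi\left(\gamma(\omega^{\mathbb C}_\varphi)^n-(s(\omega_\varphi)-c_\gamma)\omega_\varphi^n\right)\right],$$ normalised by $\tilde{\mathcal M}(0)=0$; that is, $\tilde{\mathcal M}(\varphi)=\int_0^1\sigma_{\omega^{\mathbb C}_{s\varphi}}(\varphi)\,ds$. A function $\varphi\in C^\infty(X,\mathbb C)$ is an almost calibrated potential if $\omega_\varphi>0$ and $\mathrm{Re}\left(e^{-i\hat\vartheta}(\omega^{\mathbb C}_\varphi)^n\right)>0$. Let $T\subseteq\mathbb R$ be an interval and let $\varphi_t$, $t\in T$, be a smooth path (smooth in $(t,x)\in T\times X$, with one-sided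 $t$-derivatives at end points) of almost calibrated potentials satisfying on $T\times X$ the coupled geodesic equations $$\mathrm{Im}(\ddot\varphi)-\|\partial\,\mathrm{Im}(\dot\varphi)\|^2_{\omega_{\varphi_t}}=0,\qquad \mathrm{Re}\left[e^{-i\hat\vartheta}\left(\ddot\varphi\,(\omega^{\mathbb C}_{\varphi_t})^n-n\,i\partial\dot\varphi\wedge\bar\partial\dot\varphi\wedge(\omega^{\mathbb C}_{\varphi_t})^{n-1}\right)\right]=0 .$$ Then $t\mapsto\tilde{\mathcal M}(\varphi_t)$ is convex on $T$. Moreover, it is twice differentiable in the interior of $T$, and there, with $u=\mathrm{Re}\,\varphi_t$, $v=\mathrm{Im}\,\varphi_t$, $\omega=\omega_{\varphi_t}$, $B=B_{\varphi_t}$, $$\frac{d^2}{dt^2}\tilde{\mathcal M}(\varphi_t)=\|\mathcal D_{\omega}\dot v\|^2_{L^2(\omega)}+\int_X\frac{|\gamma|\,r}{\cos\eta}\sum_{a=1}^n\frac{|(\partial\dot u)_a-\lambda_a(\partial\dot v)_a|^2}{1+\lambda_a^2}\;\omega^n .$$ Here, at each point, $\lambda_1,\dots,\lambda_n$ are the eigenvalues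 of $\omega^{-1}B$, subscripts $a$ denote components in a coframe $\zeta^1,\dots,\zeta^n$ of type $(1,0)$ in which $\omega=i\sum_a\zeta^a\wedge\bar\zeta^a$ and $B=i\sum_a\lambda_a\zeta^a\wedge\bar\zeta^a$, $r=\prod_a(1+\lambda_a^2)^{1/2}$, and $\eta=\sum_a\mathrm{arccot}(\lambda_a)-\hat\vartheta$ with $\mathrm{arccot}$ valued in $(0,\pi)$. -/

import Mathlib

open scoped Manifold ContDiff ComplexOrder

noncomputable section

namespace ComplexifiedKahler

/-! ### Calculus on `ℂⁿ` -/

/-- The Wirtinger derivative `∂f/∂zᵃ = (∂f/∂xᵃ - i ∂f/∂yᵃ) / 2`. -/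
def dz {n : ℕ} (a : Fin n) (f : (Fin n → ℂ) → ℂ) (z : Fin n → ℂ) : ℂ :=
  (fderiv ℝ f z (Pi.single a 1) - Complex.I * fderiv ℝ f z (Pi.single a Complex.I)) / 2

/-- The Wirtinger derivative `∂f/∂z̄ᵃ = (∂f/∂xᵃ + i ∂f/∂yᵃ) / 2`. -/
def dzbar {n : ℕ} (a : Fin n) (f : (Fin n → ℂ) → ℂ) (z : Fin n → ℂ) : ℂ :=
  (fderiv ℝ f z (Pi.single a 1) + Complex.I * fderiv ℝ f z (Pi.single a Complex.I)) / 2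

/-- The coefficients `∂²f/∂zᵃ∂z̄ᵇ` of the form
`i∂∂̄f = i ∑ (∂²f/∂zᵃ∂z̄ᵇ) dzᵃ ∧ dz̄ᵇ`. -/
def ddbar {n : ℕ} (f : (Fin n → ℂ) → ℂ) (z : Fin n → ℂ) : Matrix (Fin n) (Fin n) ℂ :=
  Matrix.of fun a b => dz a (dzbar b f) z

/-- The coefficients of the form `i∂f ∧ ∂̄f`. -/
def dfdbarf {n : ℕ} (f : (Fin n → ℂ) → ℂ) (z : Fin n → ℂ) : Matrix (Fin n) (Fin n) ℂ :=
  Matrix.of fun a b => dz a f z * dzbar b f z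

/-- The coefficient of `∏ₐ (i dzᵃ ∧ dz̄ᵃ)` in the wedge product `χ₁ ∧ ⋯ ∧ χₙ` of the
`(1,1)`-forms `χₖ = i ∑ (h k)_{a b̄} dzᵃ ∧ dz̄ᵇ`: expanding the product, each choice of indices
`a = σ k`, `b = τ k` in the `k`-th factor contributes `sign σ * sign τ`. -/
def wedgeTop {n : ℕ} (h : Fin n → Matrix (Fin n) (Fin n) ℂ) : ℂ :=
  ∑ σ : Equiv.Perm (Fin n), ∑ τ : Equiv.Perm (Fin n),
    ((Equiv.Perm.sign σ : ℤ) : ℂ) * ((Equiv.Perm.sign τ : ℤ) : ℂ) * ∏ k, h k (σ k) (τ k)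

/-- The coefficient of `χⁿ`. -/
def powTop {n : ℕ} (h : Matrix (Fin n) (Fin n) ℂ) : ℂ :=
  wedgeTop fun _ => h

/-- The coefficient of `ξ ∧ χⁿ⁻¹` (used for `n ≥ 1` only). -/
def wedgePowTop {n : ℕ} (ξ h : Matrix (Fin n) (Fin n) ℂ) : ℂ :=
  wedgeTop fun k => if k.val = 0 then ξ else h

/-- The scalar curvature `s = ∑ g^{a b̄} R_{a b̄}` of the metric with coefficients `g_{a b̄}`, where
`R_{a b̄} = -∂ₐ∂_b̄ log det g` are the coefficients of the Ricci form. -/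
def scalarCurv {n : ℕ} (g : (Fin n → ℂ) → Matrix (Fin n) (Fin n) ℂ) (z : Fin n → ℂ) : ℂ :=
  ∑ a, ∑ b, (g z)⁻¹ b a *
    (-(ddbar (fun w => ((Real.log (g w).det.re : ℝ) : ℂ)) z a b))

/-- The squared norm `‖∂f‖² = ∑ g^{a b̄} ∂ₐf ∂_b̄f` of a real function `f`. -/
def gradNormSq {n : ℕ} (g : Matrix (Fin n) (Fin n) ℂ) (f : (Fin n → ℂ) → ℂ)
    (z : Fin n → ℂ) : ℂ :=
  ∑ a, ∑ b, g⁻¹ b a * dz a f z * dzbar b f z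

/-- The coefficients `∂_c̄ (g^{a b̄} ∂_b̄ f)` (row `a`, column `c`) of the operator
`𝒟 f = ∂̄ (∇^{1,0} f)`. -/
def lich {n : ℕ} (g : (Fin n → ℂ) → Matrix (Fin n) (Fin n) ℂ) (f : (Fin n → ℂ) → ℂ)
    (z : Fin n → ℂ) : Matrix (Fin n) (Fin n) ℂ :=
  Matrix.of fun a c => dzbar c (fun w => ∑ b, (g w)⁻¹ b a * dzbar b f w) z

/-- The pointwise squared norm `‖𝒟 f‖²`. -/
def lichNormSq {n : ℕ} (g : (Fin n → ℂ) → Matrix (Fin n) (Fin n) ℂ) (f : (Fin n → ℂ) → ℂ)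
    (z : Fin n → ℂ) : ℂ :=
  ∑ a, ∑ d, ∑ c, ∑ e, g z a d * (g z)⁻¹ c e * lich g f z a c * star (lich g f z d e)

/-! ### Adapted frames -/

/-- The frame `eₖ = ∑ₐ P a k ∂/∂zᵃ` is adapted to `ω = i ∑ g_{a b̄} dzᵃ ∧ dz̄ᵇ` and
`B = i ∑ b_{a b̄} dzᵃ ∧ dz̄ᵇ`: in the dual coframe `ζ¹, …, ζⁿ` one has `ω = i ∑ ζᵏ ∧ ζ̄ᵏ` and
`B = i ∑ lₖ ζᵏ ∧ ζ̄ᵏ`. So `l₁, …, lₙ` are the eigenvalues of `ω⁻¹B`. -/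
def IsAdaptedFrame {n : ℕ} (g b : Matrix (Fin n) (Fin n) ℂ)
    (p : Matrix (Fin n) (Fin n) ℂ × (Fin n → ℝ)) : Prop :=
  p.1.transpose * g * p.1.map star = 1 ∧
    p.1.transpose * b * p.1.map star = Matrix.diagonal fun k => (p.2 k : ℂ)

/-- Some adapted frame, with the eigenvalues of `ω⁻¹B`. (One exists when `g` is positive definite and
`b` Hermitian.) -/
def adaptedFrame {n : ℕ} (g b : Matrix (Fin n) (Fin n) ℂ) :
    Matrix (Fin n) (Fin n) ℂ × (Fin n → ℝ) :=
  Classical.epsilon (IsAdaptedFrame g b)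

/-- The inverse cotangent with values in `(0, π)`. -/
def arccot (x : ℝ) : ℝ := Real.pi / 2 - Real.arctan x

/-- The Lagrangian phase `Θ(B + iω) = ∑ₖ arccot λₖ`. -/
def lagrangianPhase {n : ℕ} (g b : Matrix (Fin n) (Fin n) ℂ) : ℝ :=
  ∑ k, arccot ((adaptedFrame g b).2 k)

/-- The Lagrangian radius `r(B + iω) = ∏ₖ (1 + λₖ²)^{1/2}`. -/
def lagrangianRadius {n : ℕ} (g b : Matrix (Fin n) (Fin n) ℂ) : ℝ :=
  ∏ k, Real.sqrt (1 + (adaptedFrame g b).2 k ^ 2)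

/-- `∑ₖ |uₖ - λₖ vₖ|² / (1 + λₖ²)`, where `uₖ`, `vₖ` are the components in an adapted coframe of
the `(1,0)`-covectors with coordinate components `u`, `v`. -/
def sumSquares {n : ℕ} (g b : Matrix (Fin n) (Fin n) ℂ) (u v : Fin n → ℂ) : ℝ :=
  ∑ k, ‖((adaptedFrame g b).1.transpose.mulVec u) k -
      ((adaptedFrame g b).2 k : ℂ) * ((adaptedFrame g b).1.transpose.mulVec v) k‖ ^ 2 /
    (1 + (adaptedFrame g b).2 k ^ 2)

/-! ### Forms on a complex manifold -/

section Manifold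

variable {n : ℕ} {X : Type*} [TopologicalSpace X]

/-- A `(1,1)`-form given by its coefficients in the charts: in the chart `e`, it is
`i ∑ h e z a b dzᵃ ∧ dz̄ᵇ` at the point with coordinates `z ∈ e.target`. -/
abbrev Coeff (n : ℕ) (X : Type*) [TopologicalSpace X] :=
  OpenPartialHomeomorph X (Fin n → ℂ) → (Fin n → ℂ) → Matrix (Fin n) (Fin n) ℂ

/-- The matrix `∂wᵃ/∂zᵇ` of the change of coordinates from the chart `e` (coordinates `z`) to the
chart `e'` (coordinates `w`). -/
def jacobian (e e' : OpenPartialHomeomorph X (Fin n → ℂ)) (z : Fin n → ℂ) :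
    Matrix (Fin n) (Fin n) ℂ :=
  Matrix.of fun a b => fderiv ℂ (fun w => e' (e.symm w)) z (Pi.single b 1) a

/-- The coefficients define a smooth, real, closed `(1,1)`-form on `X`. -/
structure IsClosedRealForm [ChartedSpace (Fin n → ℂ) X] (h : Coeff n X) : Prop where
  smooth : ∀ e ∈ atlas (Fin n → ℂ) X, ∀ a b, ContDiffOn ℝ ∞ (fun z => h e z a b) e.target
  transform : ∀ e ∈ atlas (Fin n → ℂ) X, ∀ e' ∈ atlas (Fin n → ℂ) X,
    ∀ x ∈ e.source ∩ e'.source,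
      h e (e x) = (jacobian e e' (e x)).transpose * h e' (e' x) * (jacobian e e' (e x)).map star
  real : ∀ e ∈ atlas (Fin n → ℂ) X, ∀ z ∈ e.target, (h e z).IsHermitian
  closed : ∀ e ∈ atlas (Fin n → ℂ) X, ∀ z ∈ e.target, ∀ a b c,
    dz c (fun w => h e w a b) z = dz a (fun w => h e w c b) z

/-- A Kähler form: a closed real positive `(1,1)`-form. -/
structure IsKahlerForm [ChartedSpace (Fin n → ℂ) X] (h : Coeff n X) : Prop
    extends IsClosedRealForm h where
  pos : ∀ e ∈ atlas (Fin n → ℂ) X, ∀ z ∈ e.target, (h e z).PosDef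

/-- The form `h + i∂∂̄f`. -/
def addPotential (h : Coeff n X) (f : X → ℂ) : Coeff n X :=
  fun e z => h e z + ddbar (fun w => f (e.symm w)) z

/-- The form `B + iω`. -/
def complexify (b g : Coeff n X) : Coeff n X :=
  fun e z => b e z + Complex.I • g e z

/-- The real function `Re φ`, with values in `ℂ`. -/
def rePart (f : X → ℂ) : X → ℂ := fun x => ((f x).re : ℂ)

/-- The real function `Im φ`, with values in `ℂ`. -/
def imPart (f : X → ℂ) : X → ℂ := fun x => ((f x).im : ℂ)

/-! ### Integration -/

/-- A complex manifold is a smooth real manifold. -/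
theorem isManifold_real [ChartedSpace (Fin n → ℂ) X] [IsManifold 𝓘(ℂ, Fin n → ℂ) ω X] :
    IsManifold 𝓘(ℝ, Fin n → ℂ) ∞ X := by
  apply isManifold_of_contDiffOn
  intro e e' he he'
  have h := (contDiffGroupoid ω 𝓘(ℂ, Fin n → ℂ)).compatible he he'
  rw [contDiffGroupoid, mem_groupoid_of_pregroupoid] at h
  exact (h.1.restrict_scalars ℝ).of_le le_top

variable [ChartedSpace (Fin n → ℂ) X] [IsManifold 𝓘(ℂ, Fin n → ℂ) ω X] [CompactSpace X] [T2Space X]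

variable (n X) in
/-- A smooth partition of unity on `X` subordinate to the cover by the preferred charts. -/
def chartPartition : SmoothPartitionOfUnity X 𝓘(ℝ, Fin n → ℂ) X Set.univ :=
  haveI : IsManifold 𝓘(ℝ, Fin n → ℂ) ∞ X := isManifold_real
  (SmoothPartitionOfUnity.exists_isSubordinate_chartAt_source 𝓘(ℝ, Fin n → ℂ) X).choose

/-- The integral over `X` of the `(n,n)`-form that is `D e z * ∏ₐ (i dzᵃ ∧ dz̄ᵃ)` in the chart `e`,
through a partition of unity. Here `∏ₐ (i dzᵃ ∧ dz̄ᵃ)` is `2ⁿ` times the Lebesgue measure. -/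
def integralTop (D : OpenPartialHomeomorph X (Fin n → ℂ) → (Fin n → ℂ) → ℂ) : ℂ :=
  ∑ᶠ x : X, ∫ z in (chartAt (Fin n → ℂ) x).target,
    ((chartPartition n X x ((chartAt (Fin n → ℂ) x).symm z) : ℝ) : ℂ) *
      D (chartAt (Fin n → ℂ) x) z * 2 ^ n

/-! ### The complexified K-energy -/

/-- The real constant `c_γ`, obtained by integrating the equation
`s(ω) ωⁿ = c ωⁿ + γ (B + iω)ⁿ` over `X`. -/
def constC (γ : ℂ) (b g : Coeff n X) : ℝ :=
  ((integralTop (fun e z => scalarCurv (g e) z * powTop (g e z)) -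
      γ * integralTop (fun e z => powTop (complexify b g e z))) /
    integralTop (fun e z => powTop (g e z))).re

/-- The 1-form `σ_{B + iω}(ψ) = ∫ Im [ψ (γ (B + iω)ⁿ - (s(ω) - c) ωⁿ)]`. -/
def firstVariation (γ : ℂ) (c : ℝ) (b g : Coeff n X) (ψ : X → ℂ) : ℝ :=
  (integralTop (fun e z => ψ (e.symm z) *
    (γ * powTop (complexify b g e z) - (scalarCurv (g e) z - c) * powTop (g e z)))).im

/-- The complexified K-energy `φ ↦ M(φ)` of the class of `B₀ + iω₀`, as a functional of the potential
`φ` of `B₀ + iω₀ + i∂∂̄φ`: the primitive of the closed 1-form `σ`, normalised by `M(0) = 0`, that is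
the integral of `σ` along the segment from `0` to `φ`. -/
def complexifiedKEnergy (γ : ℂ) (b₀ g₀ : Coeff n X) (φ : X → ℂ) : ℝ :=
  ∫ s in (0 : ℝ)..1,
    firstVariation γ (constC γ b₀ g₀)
      (addPotential b₀ (rePart fun x => (s : ℂ) * φ x))
      (addPotential g₀ (imPart fun x => (s : ℂ) * φ x)) φ

/-- The almost calibrated potentials: smooth `φ` such that `ω₀ + i∂∂̄ Im φ` is a Kähler form and
`Re [e^{-iθ} (B₀ + iω₀ + i∂∂̄φ)ⁿ] > 0`. -/
def almostCalibrated (θ : ℝ) (b₀ g₀ : Coeff n X) : Set (X → ℂ) :=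
  {φ | ContMDiff 𝓘(ℝ, Fin n → ℂ) 𝓘(ℝ, ℂ) ∞ φ ∧
    ∀ e ∈ atlas (Fin n → ℂ) X, ∀ z ∈ e.target,
      (addPotential g₀ (imPart φ) e z).PosDef ∧
      0 < (Complex.exp (-(θ * Complex.I)) *
        powTop (addPotential (complexify b₀ g₀) φ e z)).re}

/-- The velocity of a path of functions defined on the interval `T` (one-sided at the end points). -/
def velocity (T : Set ℝ) (φ : ℝ → X → ℂ) : ℝ → X → ℂ :=
  fun t x => derivWithin (fun s => φ s x) T t

/-- The coupled geodesic equations, in every chart and at every time `t ∈ T`. -/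
def IsGeodesic (θ : ℝ) (b₀ g₀ : Coeff n X) (T : Set ℝ) (φ : ℝ → X → ℂ) : Prop :=
  ∀ t ∈ T, ∀ e ∈ atlas (Fin n → ℂ) X, ∀ z ∈ e.target,
    ((velocity T (velocity T φ) t (e.symm z)).im : ℂ) -
        gradNormSq (addPotential g₀ (imPart (φ t)) e z)
          (fun w => imPart (velocity T φ t) (e.symm w)) z = 0 ∧
    (Complex.exp (-(θ * Complex.I)) *
      (velocity T (velocity T φ) t (e.symm z) *
          powTop (addPotential (complexify b₀ g₀) (φ t) e z) -
        n * wedgePowTop (dfdbarf (fun w => velocity T φ t (e.symm w)) z)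
          (addPotential (complexify b₀ g₀) (φ t) e z))).re = 0

/-- The expression `‖𝒟 Im ψ‖²_{L²(ω)} +
∫ |γ| r (cos η)⁻¹ ∑ₖ |(∂ Re ψ)ₖ - λₖ (∂ Im ψ)ₖ|² / (1 + λₖ²) ωⁿ`, with `η = Θ(B + iω) - θ`. -/
def secondVariation (γ : ℂ) (θ : ℝ) (b g : Coeff n X) (ψ : X → ℂ) : ℝ :=
  (integralTop (fun e z =>
      lichNormSq (g e) (fun w => imPart ψ (e.symm w)) z * powTop (g e z))).re +
  (integralTop (fun e z =>
      ((‖γ‖ * (lagrangianRadius (g e z) (b e z) / Real.cos (lagrangianPhase (g e z) (b e z) - θ)) *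
        sumSquares (g e z) (b e z)
          (fun a => dz a (fun w => rePart ψ (e.symm w)) z)
          (fun a => dz a (fun w => imPart ψ (e.symm w)) z) : ℝ) : ℂ) * powTop (g e z))).re

end Manifold

end ComplexifiedKahler

end

/-!
The complexified K-energy is convex along the coupled geodesics because its second derivative is a
sum of two integrals of nonnegative functions.

*The energy is a primitive of `σ`.* The energy is defined by integrating the 1-form `σ` along the
segment from `0` to `φ`, and such segments stay in the convex set of Kähler potentials. Its
derivative along a path is the value of `σ` on the velocity (`hasDerivAt_complexifiedKEnergy`) once
`σ` is closed, that is, once the second variation `(χ, ψ) ↦ ∫ Im (χ · D_ψ density)` is symmetric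
(`im_integralTop_mul_energyDensityVar_comm`). The variation of the density is a sum of terms
`A ∧ i∂∂̄ψ` for closed `(n-1,n-1)`-forms `A`, and of `ωⁿ⁻¹ ∧ i∂∂̄Δv` from the variation of the Ricci
form. The operators `ψ ↦ A ∧ i∂∂̄ψ` are symmetric by Stokes' theorem
(`integralTop_mul_trace_ddbar_comm`, `integralTop_div_eq_zero`).

All forms are given by their matrices of coefficients in the charts. Wedge products with powers of
a `(1,1)`-form `h` are traces against the adjugate of `h`, or against its polarisation `mixedCof`;
closedness of these `(n-1,n-1)`-forms says that the matrices are divergence free. That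
integration by parts in the charts gives identities on `X` rests on the transformation laws
`IsScalar`, `IsClosedForm` and `IsClosedCoform`.

*The second derivative.* Differentiating once more, the derivative along a geodesic splits in two
(`second_variation_eq`).

* The part which depends on `ω` only is `∫ Im φ̈ · (-s + c) ωⁿ` plus the variation in the direction
  `v = Im φ̇`. Since `Im φ̈ = ‖∂v‖²`, two integrations by parts and the Bochner formula
  `integralTop_lap_sq` turn it into `‖𝒟v‖²` (`integralTop_lichNormSq`); the multiples of `c` cancel
  because `∫ ‖∂v‖² ωⁿ = -∫ v Δv ωⁿ`.
* The part with `γ` is, after one integration by parts, the integral of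
  `Im (γ (φ̈ (ω^ℂ)ⁿ - n i∂φ̇ ∧ ∂̄φ̇ ∧ (ω^ℂ)ⁿ⁻¹))`. At a point, a frame adapted to `ω` and `B`
  (`exists_isAdaptedFrame`) gives `(ω^ℂ)ⁿ = ∏ (λₐ + i) ωⁿ = r e^{iΘ} ωⁿ`, so that the integrand is
  `|γ| r Im (e^{iη} w)` with `w = φ̈ - ∑ (∂φ̇)ₐ (∂̄φ̇)ₐ / (λₐ + i)` and `η = Θ - ϑ`. The second
  geodesic equation is `Re (e^{iη} w) = 0`, whence `Im (e^{iη} w) = Im w / cos η`, and the first one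
  makes `Im w` the sum of squares of the theorem (`im_mul_sub_pairing`). Almost calibrated potentials are
  those with `cos η > 0`.

Convexity follows from the sign of the second derivative in the interior and from the continuity
of the energy up to the end points (`continuousOn_complexifiedKEnergy`).
-/

noncomputable section

namespace ComplexifiedKahler

open Set Filter Topology MeasureTheory

set_option linter.unusedSectionVars false

/-! ### Wirtinger calculus -/

/-- The first order operator `f ↦ (∂f/∂xᵃ + c ∂f/∂yᵃ) / 2`. It is `∂/∂zᵃ` for `c = -i` and `∂/∂z̄ᵃ`
for `c = i`, so that both operators are handled together. -/
def wd {n : ℕ} (c : ℂ) (a : Fin n) (f : (Fin n → ℂ) → ℂ) (z : Fin n → ℂ) : ℂ :=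
  (fderiv ℝ f z (Pi.single a 1) + c * fderiv ℝ f z (Pi.single a Complex.I)) / 2

section Wirtinger

variable {n : ℕ} {c d : ℂ} {a b : Fin n} {f g : (Fin n → ℂ) → ℂ} {z : Fin n → ℂ}

theorem dz_eq_wd : dz (n := n) = wd (-Complex.I) := by
  funext a f z; simp only [dz, wd]; ring

theorem dzbar_eq_wd : dzbar (n := n) = wd Complex.I := by
  funext a f z; simp only [dzbar, wd]

theorem wd_eq_of_hasFDerivAt {f' : (Fin n → ℂ) →L[ℝ] ℂ} (hf : HasFDerivAt f f' z) :
    wd c a f z = (f' (Pi.single a 1) + c * f' (Pi.single a Complex.I)) / 2 := by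
  rw [wd, hf.fderiv]

theorem wd_congr (h : f =ᶠ[𝓝 z] g) : wd c a f z = wd c a g z := by
  rw [wd, wd, h.fderiv_eq]

theorem wd_const (k : ℂ) : wd c a (fun _ => k) z = 0 := by simp [wd]

theorem wd_add (hf : DifferentiableAt ℝ f z) (hg : DifferentiableAt ℝ g z) :
    wd c a (fun w => f w + g w) z = wd c a f z + wd c a g z := by
  rw [wd_eq_of_hasFDerivAt (hf.hasFDerivAt.fun_add hg.hasFDerivAt)]; simp [wd]; ring

theorem wd_sub (hf : DifferentiableAt ℝ f z) (hg : DifferentiableAt ℝ g z) :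
    wd c a (fun w => f w - g w) z = wd c a f z - wd c a g z := by
  rw [wd_eq_of_hasFDerivAt (hf.hasFDerivAt.fun_sub hg.hasFDerivAt)]; simp [wd]; ring

theorem wd_mul (hf : DifferentiableAt ℝ f z) (hg : DifferentiableAt ℝ g z) :
    wd c a (fun w => f w * g w) z = wd c a f z * g z + f z * wd c a g z := by
  rw [wd_eq_of_hasFDerivAt (hf.hasFDerivAt.fun_mul hg.hasFDerivAt)]; simp [wd]; ring

theorem wd_const_mul (k : ℂ) (hf : DifferentiableAt ℝ f z) :
    wd c a (fun w => k * f w) z = k * wd c a f z := by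
  rw [wd_mul (differentiableAt_const _) hf, wd_const]; ring

theorem wd_sum {ι : Type*} (s : Finset ι) {F : ι → (Fin n → ℂ) → ℂ}
    (hF : ∀ i ∈ s, DifferentiableAt ℝ (F i) z) :
    wd c a (fun w => ∑ i ∈ s, F i w) z = ∑ i ∈ s, wd c a (F i) z := by
  rw [wd_eq_of_hasFDerivAt (HasFDerivAt.fun_sum fun i hi => (hF i hi).hasFDerivAt)]
  simp only [wd, sum_apply, Finset.mul_sum, ← Finset.sum_add_distrib,
    Finset.sum_div]

theorem wd_star (hf : DifferentiableAt ℝ f z) :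
    wd c a (fun w => star (f w)) z = star (wd (star c) a f z) := by
  have h : HasFDerivAt (fun w => star (f w))
      (Complex.conjCLE.toContinuousLinearMap.comp (fderiv ℝ f z)) z :=
    Complex.conjCLE.toContinuousLinearMap.hasFDerivAt.comp z hf.hasFDerivAt
  rw [wd_eq_of_hasFDerivAt h]
  simp [wd]

/-- Smoothness of `wd` in a parameter. The parameter set need not be open: it may contain the end
points of an interval. -/
theorem contDiffOn_wd_param {P : Type*} [NormedAddCommGroup P] [NormedSpace ℝ P]
    {S : Set P} {U : Set (Fin n → ℂ)} (hU : IsOpen U) {F : P → (Fin n → ℂ) → ℂ}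
    (hF : ContDiffOn ℝ ∞ (fun q : P × (Fin n → ℂ) => F q.1 q.2) (S ×ˢ U)) :
    ContDiffOn ℝ ∞ (fun q : P × (Fin n → ℂ) => wd c a (F q.1) q.2) (S ×ˢ U) := by
  have key : ∀ v : Fin n → ℂ,
      ContDiffOn ℝ ∞ (fun q : P × (Fin n → ℂ) => fderiv ℝ (F q.1) q.2 v) (S ×ˢ U) := by
    intro v
    have : ContDiffOn ℝ ∞ (fun q : P × (Fin n → ℂ) => fderivWithin ℝ (F q.1) U q.2 v)
        (S ×ˢ U) := by
      intro q hq
      refine ContDiffWithinAt.fderivWithin_apply (f := fun q : P × (Fin n → ℂ) => F q.1)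
        (n := ∞) (k := fun _ => v) (t := U)
        ?_ contDiffWithinAt_snd contDiffWithinAt_const hU.uniqueDiffOn le_rfl hq
        (fun q hq => hq.2)
      have h1 := hF q hq
      refine ContDiffWithinAt.comp (t := S ×ˢ U)
        (g := fun q : P × (Fin n → ℂ) => F q.1 q.2)
        (f := fun r : (P × (Fin n → ℂ)) × (Fin n → ℂ) => (r.1.1, r.2)) (q, q.2) h1 ?_ ?_
      · exact (contDiff_fst.fst.prodMk contDiff_snd).contDiffWithinAt
      · rintro ⟨r1, r2⟩ ⟨h1, h2⟩
        exact ⟨h1.1, h2⟩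
    refine this.congr fun q hq => ?_
    rw [fderivWithin_of_isOpen hU hq.2]
  exact ((key _).add (contDiffOn_const.mul (key _))).div_const _

theorem contDiffOn_wd {U : Set (Fin n → ℂ)} (hU : IsOpen U) (hf : ContDiffOn ℝ ∞ f U) :
    ContDiffOn ℝ ∞ (wd c a f) U := by
  have h1 := hf.fderiv_of_isOpen (m := ∞) hU le_rfl
  exact ((h1.clm_apply contDiffOn_const).add
    (contDiffOn_const.mul (h1.clm_apply contDiffOn_const))).div_const _

theorem wd_comm {U : Set (Fin n → ℂ)} (hU : IsOpen U) (hf : ContDiffOn ℝ ∞ f U) (hz : z ∈ U) :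
    wd c a (wd d b f) z = wd d b (wd c a f) z := by
  have hfz : ContDiffAt ℝ ∞ f z := hf.contDiffAt (hU.mem_nhds hz)
  have hd : DifferentiableAt ℝ (fderiv ℝ f) z :=
    (hfz.fderiv_right (m := ∞) le_rfl).differentiableAt (by simp)
  have hsym : IsSymmSndFDerivAt ℝ f z :=
    hfz.isSymmSndFDerivAt (by simpa using (WithTop.coe_le_coe.2 (le_top (a := (2 : ℕ∞)))))
  have key : ∀ (c : ℂ) (a : Fin n) (v : Fin n → ℂ),
      fderiv ℝ (wd c a f) z v = (fderiv ℝ (fderiv ℝ f) z v (Pi.single a 1) +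
        c * fderiv ℝ (fderiv ℝ f) z v (Pi.single a Complex.I)) / 2 := by
    intro c a v
    have h1 : ∀ u : Fin n → ℂ, HasFDerivAt (fun w => fderiv ℝ f w u)
        ((fderiv ℝ (fderiv ℝ f) z).flip u) z := by
      intro u
      have := (hd.hasFDerivAt).clm_apply (hasFDerivAt_const u z)
      simpa using this
    have h2 : HasFDerivAt (wd c a f) _ z :=
      ((h1 (Pi.single a 1)).add ((h1 (Pi.single a Complex.I)).const_mul c)).mul_const (2⁻¹ : ℂ)
    rw [h2.fderiv]
    simp
    ring
  rw [wd, wd, key, key, key, key, hsym (Pi.single a 1) (Pi.single b 1),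
    hsym (Pi.single a 1) (Pi.single b Complex.I), hsym (Pi.single a Complex.I) (Pi.single b 1),
    hsym (Pi.single a Complex.I) (Pi.single b Complex.I)]
  ring

/-- The operators `wd` commute with the derivative in a parameter. -/
theorem hasDerivAt_wd_param {I : Set ℝ} (hI : IsOpen I) {U : Set (Fin n → ℂ)} (hU : IsOpen U)
    {F F' : ℝ → (Fin n → ℂ) → ℂ}
    (hF : ContDiffOn ℝ ∞ (fun q : ℝ × (Fin n → ℂ) => F q.1 q.2) (I ×ˢ U))
    (hF' : ∀ t ∈ I, ∀ w ∈ U, HasDerivAt (fun s => F s w) (F' t w) t)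
    {t : ℝ} (ht : t ∈ I) (hz : z ∈ U) :
    HasDerivAt (fun s => wd c a (F s) z) (wd c a (F' t) z) t := by
  set H : ℝ × (Fin n → ℂ) → ℂ := fun q => F q.1 q.2 with hH
  have hO : IsOpen (I ×ˢ U) := hI.prod hU
  have hsm : ∀ s ∈ I, ∀ w ∈ U, ContDiffAt ℝ ∞ H (s, w) := fun s hs w hw =>
    hF.contDiffAt (hO.mem_nhds ⟨hs, hw⟩)
  have hfd : ∀ s ∈ I, ∀ w ∈ U, HasFDerivAt (F s)
      ((fderiv ℝ H (s, w)).comp (ContinuousLinearMap.inr ℝ ℝ (Fin n → ℂ))) w := by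
    intro s hs w hw
    have h1 := ((hsm s hs w hw).differentiableAt (by simp)).hasFDerivAt
    exact h1.comp (f := fun w => (s, w)) w (hasFDerivAt_prodMk_right s w)
  have htd : ∀ s ∈ I, ∀ w ∈ U, F' s w = fderiv ℝ H (s, w) (1, 0) := by
    intro s hs w hw
    have h1 := ((hsm s hs w hw).differentiableAt (by simp)).hasFDerivAt
    have h2 : HasDerivAt (fun s => F s w) (fderiv ℝ H (s, w) (1, 0)) s := by
      exact h1.comp_hasDerivAt (f := fun s => (s, w)) s
        ((hasDerivAt_id s).prodMk (hasDerivAt_const s w))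
    exact (hF' s hs w hw).unique h2
  have hd : DifferentiableAt ℝ (fderiv ℝ H) (t, z) :=
    ((hsm t ht z hz).fderiv_right (m := ∞) le_rfl).differentiableAt (by simp)
  have hsym : IsSymmSndFDerivAt ℝ H (t, z) := (hsm t ht z hz).isSymmSndFDerivAt
    (by simpa using (WithTop.coe_le_coe.2 (le_top (a := (2 : ℕ∞)))))
  have e1 : ∀ v : Fin n → ℂ,
      HasDerivAt (fun s => fderiv ℝ (F s) z v) (fderiv ℝ (F' t) z v) t := by
    intro v
    have h1 : HasDerivAt (fun s => fderiv ℝ H (s, z) (0, v))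
        (fderiv ℝ (fderiv ℝ H) (t, z) (1, 0) (0, v)) t := by
      have h2 := hd.hasFDerivAt.comp_hasDerivAt (f := fun s => (s, z)) t
        ((hasDerivAt_id t).prodMk (hasDerivAt_const t z))
      have h3 := h2.clm_apply (hasDerivAt_const t ((0 : ℝ), v))
      simpa using h3
    have h4 : fderiv ℝ (F' t) z v = fderiv ℝ (fderiv ℝ H) (t, z) (1, 0) (0, v) := by
      have h5 : F' t =ᶠ[𝓝 z] fun w => fderiv ℝ H (t, w) (1, 0) := by
        filter_upwards [hU.mem_nhds hz] with w hw using htd t ht w hw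
      have h6 : HasFDerivAt (fun w => fderiv ℝ H (t, w) (1, 0)) _ z :=
        (hd.hasFDerivAt.comp (f := fun w => (t, w)) z (hasFDerivAt_prodMk_right t z)).clm_apply
          (hasFDerivAt_const ((1 : ℝ), (0 : Fin n → ℂ)) z)
      rw [h5.fderiv_eq, h6.fderiv, hsym (1, 0) (0, v)]
      simp
    rw [h4]
    refine h1.congr_of_eventuallyEq ?_
    filter_upwards [hI.mem_nhds ht] with s hs
    rw [(hfd s hs z hz).fderiv]
    simp
  exact ((e1 _).add ((e1 _).const_mul c)).div_const 2

theorem contDiff_indicator_of_support {U K : Set (Fin n → ℂ)} (hU : IsOpen U) (hK : IsCompact K)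
    (hf : ContDiffOn ℝ ∞ f U) (hfK : ∀ w ∈ U, w ∉ K → f w = 0) (hKU : K ⊆ U) :
    ContDiff ℝ ∞ (U.indicator f) := by
  rw [contDiff_iff_contDiffAt]
  intro w
  by_cases hw : w ∈ U
  · refine (hf.contDiffAt (hU.mem_nhds hw)).congr_of_eventuallyEq ?_
    filter_upwards [hU.mem_nhds hw] with y hy using indicator_of_mem hy f
  · have : U.indicator f =ᶠ[𝓝 w] fun _ => 0 := by
      filter_upwards [hK.isClosed.isOpen_compl.mem_nhds (fun h => hw (hKU h))] with y hy
      by_cases hyU : y ∈ U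
      · rw [indicator_of_mem hyU, hfK y hyU hy]
      · exact indicator_of_notMem hyU f
    exact contDiffAt_const.congr_of_eventuallyEq this

/-- The divergence theorem for compactly supported functions in a coordinate domain. -/
theorem setIntegral_wd_eq_zero {U K : Set (Fin n → ℂ)} (hU : IsOpen U) (hK : IsCompact K)
    (hf : ContDiffOn ℝ ∞ f U) (hfK : ∀ w ∈ U, w ∉ K → f w = 0) (hKU : K ⊆ U) :
    ∫ w in U, wd c a f w = 0 := by
  set F := U.indicator f with hF
  have hsm : ContDiff ℝ ∞ F := contDiff_indicator_of_support hU hK hf hfK hKU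
  have hsupp : HasCompactSupport F := by
    refine HasCompactSupport.intro hK fun w hw => ?_
    by_cases hwU : w ∈ U
    · rw [hF, indicator_of_mem hwU, hfK w hwU hw]
    · exact indicator_of_notMem hwU f
  have hint : ∀ v : Fin n → ℂ, Integrable (fun w => fderiv ℝ F w v) := fun v =>
    ((hsm.continuous_fderiv (by simp)).clm_apply continuous_const).integrable_of_hasCompactSupport
      (hsupp.fderiv_apply ℝ v)
  have hzero : ∀ v : Fin n → ℂ, ∫ w, fderiv ℝ F w v = 0 := by
    intro v
    have hF1 : Integrable F := hsm.continuous.integrable_of_hasCompactSupport hsupp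
    have h := integral_mul_fderiv_eq_neg_fderiv_mul_of_integrable (μ := volume)
      (f := fun _ : Fin n → ℂ => (1 : ℂ)) (g := F) (v := v) (by simp)
      (by simpa using hint v) (by simpa using hF1) (fun _ _ => differentiableAt_const _)
      (fun x _ => hsm.differentiable (by simp) x)
    simpa using h
  have h1 : ∫ w in U, wd c a f w = ∫ w in U, wd c a F w := by
    refine setIntegral_congr_fun hU.measurableSet fun w hw => ?_
    refine wd_congr ?_
    filter_upwards [hU.mem_nhds hw] with y hy using (indicator_of_mem hy f).symm
  rw [h1, setIntegral_eq_integral_of_forall_compl_eq_zero]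
  · have : (fun w => wd c a F w) = fun w => (2⁻¹ : ℂ) * fderiv ℝ F w (Pi.single a 1) +
        (c / 2) * fderiv ℝ F w (Pi.single a Complex.I) := by
      funext w; rw [wd]; ring
    rw [this, integral_add ((hint _).const_mul _) ((hint _).const_mul _), integral_const_mul,
      integral_const_mul, hzero, hzero]
    simp
  · intro w hw
    have : F =ᶠ[𝓝 w] fun _ => 0 := by
      filter_upwards [hK.isClosed.isOpen_compl.mem_nhds (fun h => hw (hKU h))] with y hy
      by_cases hyU : y ∈ U
      · rw [hF, indicator_of_mem hyU, hfK y hyU hy]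
      · exact indicator_of_notMem hyU f
    rw [wd_congr this, wd_const]

end Wirtinger

/-! ### Differentiating determinants and inverses -/

section MatrixCalculus

variable {n : ℕ}

theorem trace_mul_eq_sum (A B : Matrix (Fin n) (Fin n) ℂ) :
    (A * B).trace = ∑ i, ∑ j, A j i * B i j := by
  simp only [Matrix.trace, Matrix.diag_apply, Matrix.mul_apply]
  exact Finset.sum_comm

section Frechet

variable {E : Type*} [NormedAddCommGroup E] [NormedSpace ℝ E]
  {M : E → Matrix (Fin n) (Fin n) ℂ} {s : Set E} {z : E}

theorem hasFDerivAt_det {M' : Fin n → Fin n → E →L[ℝ] ℂ}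
    (h : ∀ i j, HasFDerivAt (fun w => M w i j) (M' i j) z) :
    HasFDerivAt (fun w => (M w).det) (∑ i, ∑ j, (M z).adjugate j i • M' i j) z := by
  let f : ContinuousMultilinearMap ℂ (fun _ : Fin n => Fin n → ℂ) ℂ :=
    ⟨(Matrix.detRowAlternating (n := Fin n) (R := ℂ)).toMultilinearMap,
      Continuous.matrix_det (A := fun m : Fin n → Fin n → ℂ => Matrix.of m) continuous_id⟩
  have h1 := HasFDerivAt.multilinear_comp (f := f.restrictScalars ℝ)
    (fun i => hasFDerivAt_pi.2 (h i))
  refine h1.congr_fderiv ?_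
  ext v
  simp only [sum_apply, ContinuousLinearMap.comp_apply, smul_apply,
    smul_eq_mul]
  refine Finset.sum_congr rfl fun i _ => ?_
  have h2 : (Matrix.cramer (M z).transpose fun j => M' i j v) i =
      ∑ j, (M z).adjugate j i * M' i j v := by
    rw [Matrix.cramer_eq_adjugate_mulVec, ← Matrix.adjugate_transpose]
    simp [Matrix.mulVec, dotProduct]
  rw [← h2, Matrix.cramer_transpose_apply]
  rfl

theorem contDiffOn_det {k : WithTop ℕ∞} (h : ∀ i j, ContDiffOn ℝ k (fun w => M w i j) s) :
    ContDiffOn ℝ k (fun w => (M w).det) s := by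
  simp only [Matrix.det_apply]
  refine ContDiffOn.sum fun σ _ => ContDiffOn.const_smul _ ?_
  exact contDiffOn_prod fun i _ => h _ _

theorem contDiffOn_adjugate {k : WithTop ℕ∞} (h : ∀ i j, ContDiffOn ℝ k (fun w => M w i j) s)
    (i j : Fin n) : ContDiffOn ℝ k (fun w => (M w).adjugate i j) s := by
  simp only [Matrix.adjugate_apply]
  refine contDiffOn_det fun a b => ?_
  by_cases ha : a = j
  · subst ha; simpa using contDiffOn_const
  · simpa [Matrix.updateRow_ne ha] using h a b

theorem inv_apply_eq (A : Matrix (Fin n) (Fin n) ℂ) (i j : Fin n) :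
    A⁻¹ i j = (A.det)⁻¹ * A.adjugate i j := by
  rw [Matrix.inv_def, Ring.inverse_eq_inv', Matrix.smul_apply, smul_eq_mul]

theorem contDiffOn_matrix_inv {k : WithTop ℕ∞}
    (h : ∀ i j, ContDiffOn ℝ k (fun w => M w i j) s) (h0 : ∀ w ∈ s, (M w).det ≠ 0)
    (i j : Fin n) : ContDiffOn ℝ k (fun w => (M w)⁻¹ i j) s := by
  simp only [inv_apply_eq]
  exact ((contDiffOn_det h).inv h0).mul (contDiffOn_adjugate h i j)

theorem contDiffOn_matrix_mul {k : WithTop ℕ∞} {N : E → Matrix (Fin n) (Fin n) ℂ}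
    (h : ∀ i j, ContDiffOn ℝ k (fun w => M w i j) s)
    (h' : ∀ i j, ContDiffOn ℝ k (fun w => N w i j) s) (i j : Fin n) :
    ContDiffOn ℝ k (fun w => (M w * N w) i j) s := by
  simp only [Matrix.mul_apply]
  exact ContDiffOn.sum fun a _ => (h _ _).mul (h' _ _)

theorem contDiffOn_trace {k : WithTop ℕ∞} (h : ∀ i j, ContDiffOn ℝ k (fun w => M w i j) s) :
    ContDiffOn ℝ k (fun w => (M w).trace) s :=
  ContDiffOn.sum fun a _ => h a a

theorem differentiableAt_det (h : ∀ i j, DifferentiableAt ℝ (fun w => M w i j) z) :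
    DifferentiableAt ℝ (fun w => (M w).det) z :=
  (hasFDerivAt_det fun i j => (h i j).hasFDerivAt).differentiableAt

theorem differentiableAt_matrix_inv (h : ∀ i j, DifferentiableAt ℝ (fun w => M w i j) z)
    (h0 : (M z).det ≠ 0) (i j : Fin n) : DifferentiableAt ℝ (fun w => (M w)⁻¹ i j) z := by
  simp only [inv_apply_eq]
  refine ((differentiableAt_det h).inv h0).mul ?_
  simp only [Matrix.adjugate_apply]
  refine differentiableAt_det fun a b => ?_
  by_cases ha : a = j
  · subst ha; simp
  · simpa [Matrix.updateRow_ne ha] using h a b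

theorem eventually_isUnit_det (h : ∀ i j, DifferentiableAt ℝ (fun w => M w i j) z)
    (h0 : (M z).det ≠ 0) : ∀ᶠ w in 𝓝 z, IsUnit (M w).det := by
  filter_upwards [(differentiableAt_det h).continuousAt.eventually_ne h0] with w hw
  exact isUnit_iff_ne_zero.2 hw

end Frechet

section Parameter

variable {M : ℝ → Matrix (Fin n) (Fin n) ℂ} {M' : Matrix (Fin n) (Fin n) ℂ} {t : ℝ}

theorem hasDerivAt_det (h : ∀ i j, HasDerivAt (fun s => M s i j) (M' i j) t) :
    HasDerivAt (fun s => (M s).det) ((M t).adjugate * M').trace t := by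
  have h1 := (hasFDerivAt_det fun i j => (h i j).hasFDerivAt).hasDerivAt
  refine h1.congr_deriv ?_
  rw [trace_mul_eq_sum]
  simp

theorem hasDerivAt_matrix_inv (h : ∀ i j, HasDerivAt (fun s => M s i j) (M' i j) t)
    (h0 : (M t).det ≠ 0) (i j : Fin n) :
    HasDerivAt (fun s => (M s)⁻¹ i j) ((-((M t)⁻¹ * M' * (M t)⁻¹)) i j) t := by
  have hd : ∀ i j, DifferentiableAt ℝ (fun w => M w i j) t := fun i j => (h i j).differentiableAt
  have hu : IsUnit (M t).det := isUnit_iff_ne_zero.2 h0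
  set N : Matrix (Fin n) (Fin n) ℂ := Matrix.of fun i j => deriv (fun s => (M s)⁻¹ i j) t
  have hN : ∀ i j, HasDerivAt (fun s => (M s)⁻¹ i j) (N i j) t := fun i j =>
    (differentiableAt_matrix_inv hd h0 i j).hasDerivAt
  have key : N * M t + (M t)⁻¹ * M' = 0 := by
    ext a b
    have h1 : HasDerivAt (fun s => ((M s)⁻¹ * M s) a b) ((N * M t + (M t)⁻¹ * M') a b) t := by
      simp only [Matrix.mul_apply, Matrix.add_apply, ← Finset.sum_add_distrib]
      exact HasDerivAt.fun_sum fun k _ => (hN a k).mul (h k b)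
    have h2 : (fun s => ((M s)⁻¹ * M s) a b) =ᶠ[𝓝 t] fun _ =>
        (1 : Matrix (Fin n) (Fin n) ℂ) a b := by
      filter_upwards [eventually_isUnit_det hd h0] with s hs
      rw [Matrix.nonsing_inv_mul _ hs]
    exact (h1.congr_of_eventuallyEq h2.symm).unique (hasDerivAt_const t _)
  have : N = -((M t)⁻¹ * M' * (M t)⁻¹) := by
    have h3 : N * M t = -((M t)⁻¹ * M') := eq_neg_of_add_eq_zero_left key
    calc N = N * M t * (M t)⁻¹ := by rw [Matrix.mul_assoc, Matrix.mul_nonsing_inv _ hu, mul_one]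
      _ = _ := by rw [h3, Matrix.neg_mul]
  rw [← this]
  exact hN i j

end Parameter

section WdMat

variable {c : ℂ} {a : Fin n} {z : Fin n → ℂ} {M N : (Fin n → ℂ) → Matrix (Fin n) (Fin n) ℂ}

/-- The operator `wd c a` applied to every entry of a matrix of functions. -/
def wdMat (c : ℂ) (a : Fin n) (M : (Fin n → ℂ) → Matrix (Fin n) (Fin n) ℂ) (z : Fin n → ℂ) :
    Matrix (Fin n) (Fin n) ℂ :=
  Matrix.of fun i j => wd c a (fun w => M w i j) z

theorem wd_det (h : ∀ i j, DifferentiableAt ℝ (fun w => M w i j) z) :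
    wd c a (fun w => (M w).det) z = ((M z).adjugate * wdMat c a M z).trace := by
  rw [wd_eq_of_hasFDerivAt (hasFDerivAt_det fun i j => (h i j).hasFDerivAt), trace_mul_eq_sum]
  simp only [sum_apply, smul_apply, smul_eq_mul, wdMat, wd, Matrix.of_apply,
    Finset.mul_sum, ← Finset.sum_add_distrib, Finset.sum_div]
  refine Finset.sum_congr rfl fun i _ => Finset.sum_congr rfl fun j _ => ?_
  ring

theorem wdMat_mul (hM : ∀ i j, DifferentiableAt ℝ (fun w => M w i j) z)
    (hN : ∀ i j, DifferentiableAt ℝ (fun w => N w i j) z) :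
    wdMat c a (fun w => M w * N w) z = wdMat c a M z * N z + M z * wdMat c a N z := by
  ext i j
  simp only [wdMat, Matrix.of_apply, Matrix.add_apply, Matrix.mul_apply,
    ← Finset.sum_add_distrib]
  refine (wd_sum _ fun k _ => (hM i k).fun_mul (hN k j)).trans ?_
  exact Finset.sum_congr rfl fun k _ => wd_mul (hM i k) (hN k j)

theorem wdMat_smul {f : (Fin n → ℂ) → ℂ} (hf : DifferentiableAt ℝ f z)
    (hN : ∀ i j, DifferentiableAt ℝ (fun w => N w i j) z) :
    wdMat c a (fun w => f w • N w) z = wd c a f z • N z + f z • wdMat c a N z := by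
  ext i j
  simp only [wdMat, Matrix.of_apply, Matrix.add_apply, Matrix.smul_apply, smul_eq_mul]
  exact wd_mul hf (hN i j)

theorem wdMat_sub (hM : ∀ i j, DifferentiableAt ℝ (fun w => M w i j) z)
    (hN : ∀ i j, DifferentiableAt ℝ (fun w => N w i j) z) :
    wdMat c a (fun w => M w - N w) z = wdMat c a M z - wdMat c a N z := by
  ext i j
  exact wd_sub (hM i j) (hN i j)

theorem wd_trace (hM : ∀ i j, DifferentiableAt ℝ (fun w => M w i j) z) :
    wd c a (fun w => (M w).trace) z = (wdMat c a M z).trace :=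
  wd_sum _ fun i _ => hM i i

theorem wdMat_congr (h : ∀ᶠ w in 𝓝 z, M w = N w) : wdMat c a M z = wdMat c a N z := by
  ext i j
  exact wd_congr (h.mono fun w hw => congrFun (congrFun hw i) j)

theorem wdMat_const (k : Matrix (Fin n) (Fin n) ℂ) : wdMat c a (fun _ => k) z = 0 := by
  ext i j
  exact wd_const _

theorem differentiableAt_matrix_mul (hM : ∀ i j, DifferentiableAt ℝ (fun w => M w i j) z)
    (hN : ∀ i j, DifferentiableAt ℝ (fun w => N w i j) z) (i j : Fin n) :
    DifferentiableAt ℝ (fun w => (M w * N w) i j) z := by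
  simp only [Matrix.mul_apply]
  exact DifferentiableAt.fun_sum fun k _ => (hM i k).mul (hN k j)

theorem wdMat_inv (h : ∀ i j, DifferentiableAt ℝ (fun w => M w i j) z) (h0 : (M z).det ≠ 0) :
    wdMat c a (fun w => (M w)⁻¹) z = -((M z)⁻¹ * wdMat c a M z * (M z)⁻¹) := by
  have hu : IsUnit (M z).det := isUnit_iff_ne_zero.2 h0
  have h1 := wdMat_mul (c := c) (a := a) (differentiableAt_matrix_inv h h0) h
  rw [wdMat_congr (N := fun _ => 1) ((eventually_isUnit_det h h0).mono fun w hw =>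
    Matrix.nonsing_inv_mul _ hw), wdMat_const] at h1
  have h3 : wdMat c a (fun w => (M w)⁻¹) z * M z = -((M z)⁻¹ * wdMat c a M z) :=
    eq_neg_of_add_eq_zero_left h1.symm
  calc wdMat c a (fun w => (M w)⁻¹) z
      = wdMat c a (fun w => (M w)⁻¹) z * M z * (M z)⁻¹ := by
        rw [Matrix.mul_assoc, Matrix.mul_nonsing_inv _ hu, mul_one]
    _ = _ := by rw [h3, Matrix.neg_mul]

theorem adjugate_eq_det_smul_inv {A : Matrix (Fin n) (Fin n) ℂ} (h : A.det ≠ 0) :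
    A.adjugate = A.det • A⁻¹ := by
  ext i j
  rw [Matrix.smul_apply, inv_apply_eq, smul_eq_mul, mul_inv_cancel_left₀ h]

theorem wd_det_eq (h : ∀ i j, DifferentiableAt ℝ (fun w => M w i j) z) (h0 : (M z).det ≠ 0) :
    wd c a (fun w => (M w).det) z = (M z).det * ((M z)⁻¹ * wdMat c a M z).trace := by
  rw [wd_det h, adjugate_eq_det_smul_inv h0, Matrix.smul_mul, Matrix.trace_smul, smul_eq_mul]

/-! ### Closed forms and divergence-free cofactor matrices -/

/-- The derivative of the adjugate at `g` in the direction `r` (for `g` invertible). If `g`, `r` are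
the coefficients of `(1,1)`-forms `χ`, `ρ`, it represents `ρ ∧ χⁿ⁻²` up to a constant. -/
def mixedCof (g r : Matrix (Fin n) (Fin n) ℂ) : Matrix (Fin n) (Fin n) ℂ :=
  g.det • ((g⁻¹ * r).trace • g⁻¹ - g⁻¹ * r * g⁻¹)

theorem mixedCof_transpose (g r : Matrix (Fin n) (Fin n) ℂ) :
    mixedCof g.transpose r.transpose = (mixedCof g r).transpose := by
  simp only [mixedCof, Matrix.transpose_smul, Matrix.transpose_sub, Matrix.transpose_mul,
    Matrix.transpose_nonsing_inv, Matrix.det_transpose, Matrix.mul_assoc]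
  congr 3
  rw [← Matrix.trace_transpose, Matrix.transpose_mul, Matrix.transpose_transpose,
    Matrix.transpose_nonsing_inv, Matrix.transpose_transpose, Matrix.trace_mul_comm]

/-- The contraction identity behind all divergence-free statements: `X k` stands for the derivatives
in the `k`-th direction of the coefficients of a closed form. -/
theorem sum_trace_mul_eq_of_closed {X : Fin n → Matrix (Fin n) (Fin n) ℂ}
    (hX : ∀ k a b, X k a b = X a k b) (P Q : Matrix (Fin n) (Fin n) ℂ) (d : Fin n) :
    ∑ k, (P * X k).trace * Q d k = ∑ k, (Q * X k * P) d k := by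
  have hR : ∀ k, (Q * X k * P) d k = ∑ i, ∑ j, Q d i * X k i j * P j k := by
    intro k
    simp only [Matrix.mul_apply, Finset.sum_mul]
    exact Finset.sum_comm
  simp only [trace_mul_eq_sum, hR, Finset.sum_mul]
  rw [Finset.sum_comm]
  refine Finset.sum_congr rfl fun i _ => Finset.sum_congr rfl fun k _ =>
    Finset.sum_congr rfl fun j _ => ?_
  rw [hX k i j]
  ring

/-- The coefficients of a closed form, differentiated in the first index: the cofactor matrix is
divergence free. -/
theorem sum_wd_adjugate {h : (Fin n → ℂ) → Matrix (Fin n) (Fin n) ℂ}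
    (hd : ∀ i j, DifferentiableAt ℝ (fun w => h w i j) z) (h0 : (h z).det ≠ 0)
    (hcl : ∀ k i j, wd c k (fun w => h w i j) z = wd c i (fun w => h w k j) z) (b : Fin n) :
    ∑ k, wd c k (fun w => (h w).adjugate b k) z = 0 := by
  have hI := differentiableAt_matrix_inv hd h0
  have e1 : ∀ k, wd c k (fun w => (h w).adjugate b k) z =
      (wdMat c k (fun w => (h w).det • (h w)⁻¹) z) b k := by
    intro k
    refine wd_congr ?_
    filter_upwards [eventually_isUnit_det hd h0] with w hw
    rw [adjugate_eq_det_smul_inv hw.ne_zero]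
  simp only [e1, wdMat_smul (differentiableAt_det hd) hI, wd_det_eq hd h0, wdMat_inv hd h0]
  have key := sum_trace_mul_eq_of_closed (X := fun k => wdMat c k h z)
    (fun k a b => hcl k a b) (h z)⁻¹ (h z)⁻¹ b
  simp only [Matrix.add_apply, Matrix.smul_apply, Matrix.neg_apply, smul_eq_mul, mul_neg,
    Finset.sum_add_distrib, mul_assoc, ← Finset.mul_sum, Finset.sum_neg_distrib]
  rw [key]
  simp only [Matrix.mul_assoc]
  ring

/-- The divergence-free property of `mixedCof`. -/
theorem sum_wd_mixedCof {g r : (Fin n → ℂ) → Matrix (Fin n) (Fin n) ℂ}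
    (hd : ∀ i j, DifferentiableAt ℝ (fun w => g w i j) z) (h0 : (g z).det ≠ 0)
    (hcl : ∀ k i j, wd c k (fun w => g w i j) z = wd c i (fun w => g w k j) z)
    (hdr : ∀ i j, DifferentiableAt ℝ (fun w => r w i j) z)
    (hclr : ∀ k i j, wd c k (fun w => r w i j) z = wd c i (fun w => r w k j) z) (b : Fin n) :
    ∑ k, wd c k (fun w => (mixedCof (g w) (r w)) b k) z = 0 := by
  have hI := differentiableAt_matrix_inv hd h0
  have hIr := differentiableAt_matrix_mul hI hdr
  have hT : DifferentiableAt ℝ (fun w => ((g w)⁻¹ * r w).trace) z :=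
    DifferentiableAt.fun_sum fun i _ => hIr i i
  have hTI : ∀ i j, DifferentiableAt ℝ
      (fun w => (((g w)⁻¹ * r w).trace • (g w)⁻¹) i j) z := fun i j => hT.mul (hI i j)
  have hIrI := differentiableAt_matrix_mul hIr hI
  have e1 : ∀ k, wd c k (fun w => (mixedCof (g w) (r w)) b k) z =
      (wdMat c k (fun w => mixedCof (g w) (r w)) z) b k := fun k => rfl
  have key := fun P Q => sum_trace_mul_eq_of_closed (X := fun k => wdMat c k g z)
    (fun k a b => hcl k a b) P Q b
  have keyr := fun P Q => sum_trace_mul_eq_of_closed (X := fun k => wdMat c k r z)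
    (fun k a b => hclr k a b) P Q b
  set G := (g z)⁻¹ with hG
  set R := r z with hR
  have e2 : ∀ k, (wdMat c k (fun w => mixedCof (g w) (r w)) z) b k =
      (g z).det * ((G * R).trace * ((G * wdMat c k g z).trace * G b k
          - (G * wdMat c k g z * G) b k)
        - ((G * R * G * wdMat c k g z).trace * G b k - (G * wdMat c k g z * (G * R * G)) b k)
        + ((G * wdMat c k r z).trace * G b k - (G * wdMat c k r z * G) b k)
        - ((G * wdMat c k g z).trace * (G * R * G) b k
          - (G * R * G * wdMat c k g z * G) b k)) := by
    intro k
    have t1 : (G * wdMat c k g z * G * R).trace = (G * R * G * wdMat c k g z).trace := by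
      rw [Matrix.mul_assoc (G * wdMat c k g z), Matrix.trace_mul_comm, ← Matrix.mul_assoc]
    have hS : ∀ i j, DifferentiableAt ℝ (fun w =>
        (((g w)⁻¹ * r w).trace • (g w)⁻¹ - (g w)⁻¹ * r w * (g w)⁻¹) i j) z :=
      fun i j => (hTI i j).fun_sub (hIrI i j)
    simp only [mixedCof]
    rw [wdMat_smul (differentiableAt_det hd) hS,
      wdMat_sub hTI hIrI, wdMat_smul hT hI, wdMat_mul hIr hI, wd_trace hIr, wdMat_mul hI hdr,
      wd_det_eq hd h0, wdMat_inv hd h0]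
    simp only [← hG, ← hR, Matrix.add_apply, Matrix.sub_apply, Matrix.smul_apply,
      Matrix.neg_apply, smul_eq_mul, Matrix.trace_add, Matrix.trace_neg, Matrix.neg_mul,
      Matrix.mul_neg, Matrix.add_mul, t1]
    simp only [← Matrix.mul_assoc]
    ring
  simp only [e1, e2, ← Finset.mul_sum, Finset.sum_add_distrib, Finset.sum_sub_distrib, key, keyr]
  simp only [Matrix.mul_assoc, sub_self, mul_zero, add_zero]

end WdMat
end MatrixCalculus

/-! ### Local identities of Kähler geometry -/

section Local

variable {n : ℕ} {c : ℂ} {a b : Fin n} {U : Set (Fin n → ℂ)} {z : Fin n → ℂ}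

/-- The Laplacian `∑ g^{a b̄} ∂ₐ∂_b̄ f`. -/
def lap (g : (Fin n → ℂ) → Matrix (Fin n) (Fin n) ℂ) (f : (Fin n → ℂ) → ℂ) (z : Fin n → ℂ) : ℂ :=
  ((g z)⁻¹ * ddbar f z).trace

/-- The components `g^{a b̄} ∂_b̄ f` of `∇^{1,0} f`. -/
def gradUp (g : (Fin n → ℂ) → Matrix (Fin n) (Fin n) ℂ) (f : (Fin n → ℂ) → ℂ) (a : Fin n)
    (z : Fin n → ℂ) : ℂ :=
  ∑ b, (g z)⁻¹ b a * dzbar b f z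

/-- The components `g^{a b̄} ∂ₐ f` of `∇^{0,1} f`. -/
def gradUpBar (g : (Fin n → ℂ) → Matrix (Fin n) (Fin n) ℂ) (f : (Fin n → ℂ) → ℂ) (b : Fin n)
    (z : Fin n → ℂ) : ℂ :=
  ∑ a, (g z)⁻¹ b a * dz a f z

/-- The function `log det g`. Its complex Hessian is minus the Ricci form. -/
def logDet (g : (Fin n → ℂ) → Matrix (Fin n) (Fin n) ℂ) (z : Fin n → ℂ) : ℂ :=
  ((Real.log (g z).det.re : ℝ) : ℂ)

/-- The pairing `∑ A^{a b̄} αₐ β_b̄` of covectors of type `(1,0)` and `(0,1)`. -/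
def pairing (A : Matrix (Fin n) (Fin n) ℂ) (α β : Fin n → ℂ) : ℂ :=
  ∑ a, ∑ b, A b a * α a * β b

theorem diffAt_of_contDiffOn (hU : IsOpen U) {f : (Fin n → ℂ) → ℂ} (hf : ContDiffOn ℝ ∞ f U)
    (hz : z ∈ U) : DifferentiableAt ℝ f z :=
  (hf.contDiffAt (hU.mem_nhds hz)).differentiableAt (by simp)

theorem ddbar_apply_eq (f : (Fin n → ℂ) → ℂ) : 
    ddbar f z a b = wd (-Complex.I) a (wd Complex.I b f) z := by
  simp only [ddbar, Matrix.of_apply, dz_eq_wd, dzbar_eq_wd]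

theorem contDiffOn_ddbar (hU : IsOpen U) {f : (Fin n → ℂ) → ℂ} (hf : ContDiffOn ℝ ∞ f U)
    (a b : Fin n) : ContDiffOn ℝ ∞ (fun w => ddbar f w a b) U := by
  simp only [ddbar_apply_eq]
  exact contDiffOn_wd hU (contDiffOn_wd hU hf)

theorem ddbar_closed (hU : IsOpen U) {f : (Fin n → ℂ) → ℂ} (hf : ContDiffOn ℝ ∞ f U)
    (hz : z ∈ U) (k i j : Fin n) :
    wd (-Complex.I) k (fun w => ddbar f w i j) z =
      wd (-Complex.I) i (fun w => ddbar f w k j) z := by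
  simp only [ddbar_apply_eq]
  exact wd_comm hU (contDiffOn_wd hU hf) hz

theorem ddbar_closed_bar (hU : IsOpen U) {f : (Fin n → ℂ) → ℂ} (hf : ContDiffOn ℝ ∞ f U)
    (hz : z ∈ U) (k i j : Fin n) :
    wd Complex.I k (fun w => ddbar f w i j) z = wd Complex.I j (fun w => ddbar f w i k) z := by
  simp only [ddbar_apply_eq]
  refine (wd_comm hU (contDiffOn_wd hU hf) hz).trans
    (Eq.trans ?_ (wd_comm hU (contDiffOn_wd hU hf) hz).symm)
  refine wd_congr ?_
  filter_upwards [hU.mem_nhds hz] with w hw using wd_comm hU hf hw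

theorem trace_mul_ddbar (A : Matrix (Fin n) (Fin n) ℂ) (f : (Fin n → ℂ) → ℂ) :
    (A * ddbar f z).trace = ∑ a, ∑ b, A b a * wd (-Complex.I) a (wd Complex.I b f) z := by
  rw [trace_mul_eq_sum]
  simp only [ddbar_apply_eq]

/-- `∂(χ A ∂̄ψ) = A(∂χ, ∂̄ψ) + χ tr (A ∂∂̄ψ)` for a divergence-free `A`. -/
theorem sum_dz_cofactor (hU : IsOpen U) {A : (Fin n → ℂ) → Matrix (Fin n) (Fin n) ℂ}
    (hA : ∀ i j, ContDiffOn ℝ ∞ (fun w => A w i j) U)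
    (hdiv : ∀ w ∈ U, ∀ b, ∑ a, wd (-Complex.I) a (fun w => A w b a) w = 0)
    {χ ψ : (Fin n → ℂ) → ℂ} (hχ : ContDiffOn ℝ ∞ χ U) (hψ : ContDiffOn ℝ ∞ ψ U) (hz : z ∈ U) :
    ∑ a, wd (-Complex.I) a (fun w => χ w * ∑ b, A w b a * wd Complex.I b ψ w) z =
      pairing (A z) (fun a => wd (-Complex.I) a χ z) (fun b => wd Complex.I b ψ z) +
        χ z * (A z * ddbar ψ z).trace := by
  have d1 := diffAt_of_contDiffOn hU hχ hz
  have d2 := fun i j => diffAt_of_contDiffOn hU (hA i j) hz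
  have d3 := fun b => diffAt_of_contDiffOn hU (contDiffOn_wd (c := Complex.I) (a := b) hU hψ) hz
  have e : ∀ a, wd (-Complex.I) a (fun w => χ w * ∑ b, A w b a * wd Complex.I b ψ w) z =
      wd (-Complex.I) a χ z * ∑ b, A z b a * wd Complex.I b ψ z +
      χ z * ∑ b, (wd (-Complex.I) a (fun w => A w b a) z * wd Complex.I b ψ z +
        A z b a * wd (-Complex.I) a (wd Complex.I b ψ) z) := by
    intro a
    rw [wd_mul d1 (DifferentiableAt.fun_sum fun b _ => (d2 b a).fun_mul (d3 b)),
      wd_sum _ fun b _ => (d2 b a).fun_mul (d3 b)]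
    congr 2
    exact Finset.sum_congr rfl fun b _ => wd_mul (d2 b a) (d3 b)
  simp only [e, Finset.sum_add_distrib, ← Finset.mul_sum]
  have h0 : ∑ a, ∑ b, wd (-Complex.I) a (fun w => A w b a) z * wd Complex.I b ψ z = 0 := by
    rw [Finset.sum_comm]
    exact Finset.sum_eq_zero fun b _ => by rw [← Finset.sum_mul, hdiv z hz, zero_mul]
  rw [h0, zero_add, trace_mul_ddbar]
  congr 1
  simp only [pairing, Finset.mul_sum]
  exact Finset.sum_congr rfl fun a _ => Finset.sum_congr rfl fun b _ => by ring

/-- `∂̄(ψ A ∂χ) = A(∂χ, ∂̄ψ) + ψ tr (A ∂∂̄χ)` for a divergence-free `A`. -/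
theorem sum_dzbar_cofactor (hU : IsOpen U) {A : (Fin n → ℂ) → Matrix (Fin n) (Fin n) ℂ}
    (hA : ∀ i j, ContDiffOn ℝ ∞ (fun w => A w i j) U)
    (hdiv : ∀ w ∈ U, ∀ a, ∑ b, wd Complex.I b (fun w => A w b a) w = 0)
    {χ ψ : (Fin n → ℂ) → ℂ} (hχ : ContDiffOn ℝ ∞ χ U) (hψ : ContDiffOn ℝ ∞ ψ U) (hz : z ∈ U) :
    ∑ b, wd Complex.I b (fun w => ψ w * ∑ a, A w b a * wd (-Complex.I) a χ w) z =
      pairing (A z) (fun a => wd (-Complex.I) a χ z) (fun b => wd Complex.I b ψ z) +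
        ψ z * (A z * ddbar χ z).trace := by
  have d1 := diffAt_of_contDiffOn hU hψ hz
  have d2 := fun i j => diffAt_of_contDiffOn hU (hA i j) hz
  have d3 := fun a => diffAt_of_contDiffOn hU (contDiffOn_wd (c := -Complex.I) (a := a) hU hχ) hz
  have e : ∀ b, wd Complex.I b (fun w => ψ w * ∑ a, A w b a * wd (-Complex.I) a χ w) z =
      wd Complex.I b ψ z * ∑ a, A z b a * wd (-Complex.I) a χ z +
      ψ z * ∑ a, (wd Complex.I b (fun w => A w b a) z * wd (-Complex.I) a χ z +
        A z b a * wd (-Complex.I) a (wd Complex.I b χ) z) := by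
    intro b
    rw [wd_mul d1 (DifferentiableAt.fun_sum fun a _ => (d2 b a).fun_mul (d3 a)),
      wd_sum _ fun a _ => (d2 b a).fun_mul (d3 a)]
    congr 2
    refine Finset.sum_congr rfl fun a _ => ?_
    rw [wd_mul (d2 b a) (d3 a), wd_comm hU hχ hz]
  simp only [e, Finset.sum_add_distrib, ← Finset.mul_sum]
  have h0 : ∑ b, ∑ a, wd Complex.I b (fun w => A w b a) z * wd (-Complex.I) a χ z = 0 := by
    rw [Finset.sum_comm]
    exact Finset.sum_eq_zero fun b _ => by rw [← Finset.sum_mul, hdiv z hz, zero_mul]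
  rw [h0, zero_add, trace_mul_ddbar]
  conv_rhs => rw [Finset.sum_comm]
  congr 1
  simp only [pairing, Finset.mul_sum]
  rw [Finset.sum_comm]
  exact Finset.sum_congr rfl fun a _ => Finset.sum_congr rfl fun b _ => by ring

section LogDet

variable {g : (Fin n → ℂ) → Matrix (Fin n) (Fin n) ℂ}

theorem contDiffOn_logDet {E : Type*} [NormedAddCommGroup E] [NormedSpace ℝ E] {s : Set E}
    {M : E → Matrix (Fin n) (Fin n) ℂ} (hM : ∀ i j, ContDiffOn ℝ ∞ (fun w => M w i j) s)
    (hp : ∀ w ∈ s, 0 < (M w).det) :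
    ContDiffOn ℝ ∞ (fun w => ((Real.log (M w).det.re : ℝ) : ℂ)) s := by
  refine Complex.ofRealCLM.contDiff.comp_contDiffOn ?_
  refine ContDiffOn.log (Complex.reCLM.contDiff.comp_contDiffOn (contDiffOn_det hM)) ?_
  intro w hw
  exact ((Complex.pos_iff.1 (hp w hw)).1).ne'

theorem logDet_eq_log {M : Matrix (Fin n) (Fin n) ℂ} (hp : 0 < M.det) :
    ((Real.log M.det.re : ℝ) : ℂ) = Complex.log M.det := by
  rw [Complex.ofReal_log (Complex.pos_iff.1 hp).1.le]
  congr 1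
  exact Complex.ext rfl (Complex.pos_iff.1 hp).2

theorem wd_logDet (hU : IsOpen U) (hg : ∀ i j, ContDiffOn ℝ ∞ (fun w => g w i j) U)
    (hp : ∀ w ∈ U, 0 < (g w).det) (hz : z ∈ U) :
    wd c a (logDet g) z = ((g z)⁻¹ * wdMat c a g z).trace := by
  have hd := fun i j => diffAt_of_contDiffOn hU (hg i j) hz
  have h0 : (g z).det ≠ 0 := (hp z hz).ne'
  have e1 : logDet g =ᶠ[𝓝 z] fun w => Complex.log (g w).det := by
    filter_upwards [hU.mem_nhds hz] with w hw using logDet_eq_log (hp w hw)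
  have hs : (g z).det ∈ Complex.slitPlane := Or.inl (Complex.pos_iff.1 (hp z hz)).1
  have h1 : HasFDerivAt (fun w => Complex.log (g w).det)
      (((g z).det⁻¹ • (1 : ℂ →L[ℝ] ℂ)).comp (fderiv ℝ (fun w => (g w).det) z)) z :=
    HasFDerivAt.comp (g := Complex.log) (f := fun w => (g w).det) z
      (Complex.hasStrictFDerivAt_log_real hs).hasFDerivAt (differentiableAt_det hd).hasFDerivAt
  have h2 := wd_det_eq (c := c) (a := a) hd h0
  rw [wd_congr e1, wd_eq_of_hasFDerivAt h1]
  rw [wd] at h2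
  have : ((g z)⁻¹ * wdMat c a g z).trace = (g z).det⁻¹ *
      ((g z).det * ((g z)⁻¹ * wdMat c a g z).trace) := (inv_mul_cancel_left₀ h0 _).symm
  rw [this, ← h2]
  simp
  ring

end LogDet

section Bochner

variable {g : (Fin n → ℂ) → Matrix (Fin n) (Fin n) ℂ} {v : (Fin n → ℂ) → ℂ}

theorem contDiffOn_gradUp (hU : IsOpen U) (hg : ∀ i j, ContDiffOn ℝ ∞ (fun w => g w i j) U)
    (hp : ∀ w ∈ U, 0 < (g w).det) (hv : ContDiffOn ℝ ∞ v U) (a : Fin n) :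
    ContDiffOn ℝ ∞ (gradUp g v a) U := by
  unfold gradUp
  rw [dzbar_eq_wd]
  exact ContDiffOn.sum fun b _ =>
    (contDiffOn_matrix_inv hg (fun w hw => (hp w hw).ne') b a).mul (contDiffOn_wd hU hv)

theorem contDiffOn_gradUpBar (hU : IsOpen U) (hg : ∀ i j, ContDiffOn ℝ ∞ (fun w => g w i j) U)
    (hp : ∀ w ∈ U, 0 < (g w).det) (hv : ContDiffOn ℝ ∞ v U) (b : Fin n) :
    ContDiffOn ℝ ∞ (gradUpBar g v b) U := by
  unfold gradUpBar
  rw [dz_eq_wd]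
  exact ContDiffOn.sum fun a _ =>
    (contDiffOn_matrix_inv hg (fun w hw => (hp w hw).ne') b a).mul (contDiffOn_wd hU hv)

theorem contDiffOn_lap (hU : IsOpen U) (hg : ∀ i j, ContDiffOn ℝ ∞ (fun w => g w i j) U)
    (hp : ∀ w ∈ U, 0 < (g w).det) (hv : ContDiffOn ℝ ∞ v U) :
    ContDiffOn ℝ ∞ (lap g v) U :=
  contDiffOn_trace (contDiffOn_matrix_mul
    (contDiffOn_matrix_inv hg fun w hw => (hp w hw).ne') (contDiffOn_ddbar hU hv))

theorem wd_det_eq_logDet (hU : IsOpen U) (hg : ∀ i j, ContDiffOn ℝ ∞ (fun w => g w i j) U)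
    (hp : ∀ w ∈ U, 0 < (g w).det) (hz : z ∈ U) :
    wd c a (fun w => (g w).det) z = (g z).det * wd c a (logDet g) z := by
  rw [wd_logDet hU hg hp hz, wd_det_eq (fun i j => diffAt_of_contDiffOn hU (hg i j) hz)
    (hp z hz).ne']

/-- The Laplacian as a divergence: `Δv = ∑ ∂ₐVᵃ + Vᵃ ∂ₐ log det g` with `V = ∇^{1,0} v`. This is
where the Kähler condition enters. -/
theorem lap_eq_div (hU : IsOpen U) (hg : ∀ i j, ContDiffOn ℝ ∞ (fun w => g w i j) U)
    (hp : ∀ w ∈ U, 0 < (g w).det)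
    (hcl : ∀ w ∈ U, ∀ k i j, wd (-Complex.I) k (fun w => g w i j) w =
      wd (-Complex.I) i (fun w => g w k j) w)
    (hv : ContDiffOn ℝ ∞ v U) (hz : z ∈ U) :
    lap g v z = ∑ a, (wd (-Complex.I) a (gradUp g v a) z +
      gradUp g v a z * wd (-Complex.I) a (logDet g) z) := by
  have h0 : (g z).det ≠ 0 := (hp z hz).ne'
  have hdiv : ∀ w ∈ U, ∀ b, ∑ a, wd (-Complex.I) a (fun w => (g w).adjugate b a) w = 0 :=
    fun w hw b => sum_wd_adjugate (fun i j => diffAt_of_contDiffOn hU (hg i j) hw)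
      (hp w hw).ne' (hcl w hw) b
  have key := sum_dz_cofactor hU (contDiffOn_adjugate hg) hdiv
    (contDiffOn_const (c := (1 : ℂ))) hv hz
  have e : ∀ a, wd (-Complex.I) a
      (fun w => (1 : ℂ) * ∑ b, (g w).adjugate b a * wd Complex.I b v w) z =
      (g z).det * (wd (-Complex.I) a (gradUp g v a) z +
        gradUp g v a z * wd (-Complex.I) a (logDet g) z) := by
    intro a
    have h1 : (fun w => (1 : ℂ) * ∑ b, (g w).adjugate b a * wd Complex.I b v w) =ᶠ[𝓝 z]
        fun w => (g w).det * gradUp g v a w := by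
      filter_upwards [hU.mem_nhds hz] with w hw
      rw [adjugate_eq_det_smul_inv (hp w hw).ne', gradUp, one_mul, Finset.mul_sum]
      exact Finset.sum_congr rfl fun b _ => by
        rw [Matrix.smul_apply, smul_eq_mul, dzbar_eq_wd]; ring
    rw [wd_congr h1, wd_mul (differentiableAt_det fun i j => diffAt_of_contDiffOn hU (hg i j) hz)
      (diffAt_of_contDiffOn hU (contDiffOn_gradUp hU hg hp hv a) hz),
      wd_det_eq_logDet hU hg hp hz]
    ring
  rw [Finset.sum_congr rfl fun a _ => e a, ← Finset.mul_sum] at key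
  simp only [wd_const, adjugate_eq_det_smul_inv h0, Matrix.smul_mul,
    Matrix.trace_smul, smul_eq_mul, one_mul] at key
  have hpz : pairing ((g z).det • (g z)⁻¹) (fun _ => 0) (fun b => wd Complex.I b v z) = 0 := by
    simp [pairing]
  rw [hpz, zero_add] at key
  exact (mul_left_cancel₀ h0 key).symm

/-- The pointwise commutation formula behind the Bochner formula: with `V = ∇^{1,0} v`,
`det g ∂_b̄ Δv = ∂ₐ (det g ∂_b̄ Vᵃ) + det g (∂ₐ∂_b̄ log det g) Vᵃ`. -/
theorem det_mul_dzbar_lap (hU : IsOpen U) (hg : ∀ i j, ContDiffOn ℝ ∞ (fun w => g w i j) U)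
    (hp : ∀ w ∈ U, 0 < (g w).det)
    (hcl : ∀ w ∈ U, ∀ k i j, wd (-Complex.I) k (fun w => g w i j) w =
      wd (-Complex.I) i (fun w => g w k j) w)
    (hv : ContDiffOn ℝ ∞ v U) (hz : z ∈ U) (b : Fin n) :
    (g z).det * wd Complex.I b (lap g v) z =
      ∑ a, wd (-Complex.I) a (fun w => (g w).det * wd Complex.I b (gradUp g v a) w) z +
      (g z).det * ∑ a, ddbar (logDet g) z a b * gradUp g v a z := by
  have hV := contDiffOn_gradUp hU hg hp hv
  have hL : ContDiffOn ℝ ∞ (logDet g) U := contDiffOn_logDet hg hp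
  have hD : DifferentiableAt ℝ (fun w => (g w).det) z :=
    differentiableAt_det fun i j => diffAt_of_contDiffOn hU (hg i j) hz
  have e1 : lap g v =ᶠ[𝓝 z] fun w => ∑ a, (wd (-Complex.I) a (gradUp g v a) w +
      gradUp g v a w * wd (-Complex.I) a (logDet g) w) := by
    filter_upwards [hU.mem_nhds hz] with w hw using lap_eq_div hU hg hp hcl hv hw
  have d1 : ∀ a, DifferentiableAt ℝ (fun w => wd (-Complex.I) a (gradUp g v a) w) z := fun a =>
    diffAt_of_contDiffOn hU (contDiffOn_wd hU (hV a)) hz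
  have d2 := fun a => diffAt_of_contDiffOn hU (hV a) hz
  have d3 : ∀ a, DifferentiableAt ℝ (fun w => wd (-Complex.I) a (logDet g) w) z := fun a =>
    diffAt_of_contDiffOn hU (contDiffOn_wd hU hL) hz
  rw [wd_congr e1, wd_sum _ fun a _ => (d1 a).fun_add ((d2 a).fun_mul (d3 a)), Finset.mul_sum,
    Finset.mul_sum, ← Finset.sum_add_distrib]
  refine Finset.sum_congr rfl fun a _ => ?_
  rw [wd_add (d1 a) ((d2 a).fun_mul (d3 a)), wd_mul (d2 a) (d3 a),
    wd_mul hD (diffAt_of_contDiffOn hU (contDiffOn_wd hU (hV a)) hz),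
    wd_det_eq_logDet hU hg hp hz, ddbar_apply_eq, wd_comm hU (hV a) hz,
    wd_comm (c := Complex.I) (d := -Complex.I) hU hL hz]
  ring

/-- For a real function on a Kähler manifold, `‖𝒟v‖² = ∑ ∂ₐ Yᵇ ∂_b̄ Vᵃ` with `V = ∇^{1,0} v` and
`Y = ∇^{0,1} v`. -/
theorem lichNormSq_eq (hU : IsOpen U) (hg : ∀ i j, ContDiffOn ℝ ∞ (fun w => g w i j) U)
    (hp : ∀ w ∈ U, 0 < (g w).det) (hherm : ∀ w ∈ U, (g w).IsHermitian)
    (hclbar : ∀ w ∈ U, ∀ k i j, wd Complex.I k (fun w => g w i j) w =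
      wd Complex.I j (fun w => g w i k) w)
    (hv : ContDiffOn ℝ ∞ v U) (hreal : ∀ w ∈ U, star (v w) = v w) (hz : z ∈ U) :
    lichNormSq g v z =
      ∑ a, ∑ b, wd (-Complex.I) a (gradUpBar g v b) z * wd Complex.I b (gradUp g v a) z := by
  have h0 : (g z).det ≠ 0 := (hp z hz).ne'
  have hu : IsUnit (g z).det := isUnit_iff_ne_zero.2 h0
  have hV := contDiffOn_gradUp hU hg hp hv
  set M : Matrix (Fin n) (Fin n) ℂ := Matrix.of fun a c => wd Complex.I c (gradUp g v a) z with hM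
  set N : Matrix (Fin n) (Fin n) ℂ := Matrix.of fun e d => wd (-Complex.I) e (gradUpBar g v d) z
    with hN
  have hlich : lich g v z = M := by
    ext a c
    simp only [lich, hM, Matrix.of_apply, dzbar_eq_wd]
    rfl
  have hstar : ∀ d e, star (M d e) = N e d := by
    intro d e
    simp only [hM, hN, Matrix.of_apply]
    have h1 := wd_star (c := -Complex.I) (a := e) (diffAt_of_contDiffOn hU (hV d) hz)
    have : star (-Complex.I) = Complex.I := by simp
    rw [this] at h1
    rw [← h1]
    refine wd_congr ?_
    filter_upwards [hU.mem_nhds hz] with w hw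
    simp only [gradUp, gradUpBar, star_sum, star_mul']
    refine Finset.sum_congr rfl fun b _ => ?_
    have hi : star ((g w)⁻¹ b d) = (g w)⁻¹ d b := by
      have := (hherm w hw).inv
      exact this.apply d b
    have hv' : star (wd Complex.I b v w) = wd (-Complex.I) b v w := by
      have h2 := wd_star (c := -Complex.I) (a := b) (diffAt_of_contDiffOn hU hv hw)
      rw [this] at h2
      rw [← h2]
      refine wd_congr ?_
      filter_upwards [hU.mem_nhds hw] with y hy using hreal y hy
    rw [hi, dzbar_eq_wd, hv', dz_eq_wd]
  -- The `(0,2)`-tensor `g_{a d̄} ∂_c̄ Vᵃ = ∇_c̄ ∇_d̄ v` is symmetric.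
  have hsymm : (g z).transpose * M = M.transpose * g z := by
    have hT : ∀ d c, ((g z).transpose * M) d c = wd Complex.I c (wd Complex.I d v) z -
        ∑ a, gradUp g v a z * wd Complex.I c (fun w => g w a d) z := by
      intro d c
      have e1 : wd Complex.I d v =ᶠ[𝓝 z] fun w => ∑ a, gradUp g v a w * g w a d := by
        filter_upwards [hU.mem_nhds hz] with w hw
        have hu' : IsUnit (g w).det := isUnit_iff_ne_zero.2 (hp w hw).ne'
        simp only [gradUp, Finset.sum_mul]
        rw [Finset.sum_comm]
        have : ∀ b, ∑ a, (g w)⁻¹ b a * dzbar b v w * g w a d =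
            (1 : Matrix (Fin n) (Fin n) ℂ) b d * dzbar b v w := by
          intro b
          rw [← Matrix.nonsing_inv_mul _ hu', Matrix.mul_apply, Finset.sum_mul]
          exact Finset.sum_congr rfl fun a _ => by ring
        simp only [this, Matrix.one_apply, ite_mul, one_mul, zero_mul]
        simp [dzbar_eq_wd]
      rw [wd_congr e1, wd_sum _ fun a _ => (diffAt_of_contDiffOn hU (hV a) hz).fun_mul
        (diffAt_of_contDiffOn hU (hg a d) hz), ← Finset.sum_sub_distrib, Matrix.mul_apply]
      refine Finset.sum_congr rfl fun a _ => ?_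
      rw [wd_mul (diffAt_of_contDiffOn hU (hV a) hz) (diffAt_of_contDiffOn hU (hg a d) hz)]
      simp [hM]
      ring
    ext d c
    have : (M.transpose * g z) d c = ((g z).transpose * M) c d := by
      rw [← Matrix.transpose_apply ((g z).transpose * M), Matrix.transpose_mul,
        Matrix.transpose_transpose]
    rw [this, hT, hT, wd_comm hU hv hz]
    congr 1
    exact Finset.sum_congr rfl fun a _ => by rw [hclbar z hz c a d]
  have hsum : lichNormSq g v z = ((g z).transpose * M * (g z)⁻¹ * N).trace := by
    rw [Matrix.mul_assoc ((g z).transpose * M), trace_mul_eq_sum]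
    simp only [lichNormSq, hlich, hstar, Matrix.mul_apply, Matrix.transpose_apply,
      Finset.sum_mul_sum]
    rw [Finset.sum_comm]
    conv_rhs => rw [Finset.sum_comm]
    refine Finset.sum_congr rfl fun d _ => ?_
    rw [Finset.sum_comm]
    exact Finset.sum_congr rfl fun c _ => Finset.sum_congr rfl fun a _ =>
      Finset.sum_congr rfl fun e _ => by ring
  rw [hsum, hsymm, Matrix.mul_assoc M.transpose, Matrix.mul_nonsing_inv _ hu, mul_one,
    trace_mul_eq_sum]
  simp only [hM, hN, Matrix.transpose_apply, Matrix.of_apply]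
  exact Finset.sum_congr rfl fun a _ => Finset.sum_congr rfl fun b _ => by ring

end Bochner
end Local

/-! ### Holomorphic changes of coordinates -/

section Holomorphic

variable {n : ℕ} {c : ℂ} {a b : Fin n} {z : Fin n → ℂ}

theorem single_smul_eq (k : ℂ) (i : Fin n) :
    (Pi.single i k : Fin n → ℂ) =
      k.re • (Pi.single i 1 : Fin n → ℂ) + k.im • (Pi.single i Complex.I : Fin n → ℂ) := by
  ext j
  by_cases h : j = i
  · subst h; simp [Complex.re_add_im]
  · simp [h]

theorem fderiv_real_apply_eq (f' : (Fin n → ℂ) →L[ℝ] ℂ) (w : Fin n → ℂ) :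
    f' w = ∑ i, ((w i).re * f' (Pi.single i 1) + (w i).im * f' (Pi.single i Complex.I)) := by
  conv_lhs => rw [← Finset.univ_sum_single w]
  rw [map_sum]
  refine Finset.sum_congr rfl fun i _ => ?_
  rw [single_smul_eq, map_add, map_smul, map_smul]
  simp

/-- The Wirtinger derivative `∂/∂zᵃ` of a composition with a holomorphic map. -/
theorem dz_comp {F : (Fin n → ℂ) → (Fin n → ℂ)} (hF : DifferentiableAt ℂ F z)
    {f : (Fin n → ℂ) → ℂ} (hf : DifferentiableAt ℝ f (F z)) :
    wd (-Complex.I) a (fun w => f (F w)) z =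
      ∑ i, fderiv ℂ F z (Pi.single a 1) i * wd (-Complex.I) i f (F z) := by
  have h : HasFDerivAt (fun w => f (F w))
      ((fderiv ℝ f (F z)).comp ((fderiv ℂ F z).restrictScalars ℝ)) z :=
    hf.hasFDerivAt.comp z (hF.hasFDerivAt.restrictScalars ℝ)
  have hI : fderiv ℂ F z (Pi.single a Complex.I) = Complex.I • fderiv ℂ F z (Pi.single a 1) := by
    rw [← map_smul]; congr 1; ext j; by_cases h : j = a
    · subst h; simp
    · simp [h]
  rw [wd_eq_of_hasFDerivAt h]
  simp only [ContinuousLinearMap.comp_apply, ContinuousLinearMap.coe_restrictScalars', hI]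
  rw [fderiv_real_apply_eq _ (fderiv ℂ F z (Pi.single a 1)), fderiv_real_apply_eq _ (Complex.I • _),
    Finset.mul_sum, ← Finset.sum_add_distrib, Finset.sum_div]
  refine Finset.sum_congr rfl fun i _ => ?_
  set k := fderiv ℂ F z (Pi.single a 1) i
  have hk : k = k.re + k.im * Complex.I := (Complex.re_add_im k).symm
  simp only [Pi.smul_apply, smul_eq_mul, Complex.mul_re, Complex.mul_im, Complex.I_re,
    Complex.I_im, wd]
  conv_rhs => rw [hk]
  have := Complex.I_mul_I
  push_cast
  linear_combination (-(1 : ℂ) / 2 * (k.im * fderiv ℝ f (F z) (Pi.single i Complex.I))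
    + (1 : ℂ) / 2 * (k.im * fderiv ℝ f (F z) (Pi.single i Complex.I)) * 2) * this

/-- The Wirtinger derivative `∂/∂z̄ᵃ` of a composition with a holomorphic map. -/
theorem dzbar_comp {F : (Fin n → ℂ) → (Fin n → ℂ)} (hF : DifferentiableAt ℂ F z)
    {f : (Fin n → ℂ) → ℂ} (hf : DifferentiableAt ℝ f (F z)) :
    wd Complex.I a (fun w => f (F w)) z =
      ∑ i, star (fderiv ℂ F z (Pi.single a 1) i) * wd Complex.I i f (F z) := by
  have hs : DifferentiableAt ℝ (fun w => star (f w)) (F z) := hf.star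
  have h1 := dz_comp (a := a) hF hs
  have hc : DifferentiableAt ℝ (fun w => f (F w)) z :=
    hf.comp z (hF.restrictScalars ℝ)
  have h2 : ∀ i, wd (-Complex.I) i (fun w => star (f w)) (F z) = star (wd Complex.I i f (F z)) := by
    intro i
    rw [wd_star hf]; simp
  rw [wd_star hc] at h1
  simp only [h2] at h1
  have h3 := congrArg star h1
  simpa [star_sum] using h3

theorem dzbar_eq_zero {f : (Fin n → ℂ) → ℂ} (hf : DifferentiableAt ℂ f z) :
    wd Complex.I a f z = 0 := by
  have hI : (Pi.single a Complex.I : Fin n → ℂ) = Complex.I • Pi.single a (1 : ℂ) := by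
    ext j; by_cases h : j = a
    · subst h; simp
    · simp [h]
  rw [wd_eq_of_hasFDerivAt (hf.hasFDerivAt.restrictScalars ℝ)]
  simp only [ContinuousLinearMap.coe_restrictScalars', hI, map_smul, smul_eq_mul, ← mul_assoc,
    Complex.I_mul_I]
  ring

theorem dz_star_eq_zero {f : (Fin n → ℂ) → ℂ} (hf : DifferentiableAt ℂ f z) :
    wd (-Complex.I) a (fun w => star (f w)) z = 0 := by
  rw [wd_star (hf.restrictScalars ℝ)]
  have : star (-Complex.I) = Complex.I := by simp
  rw [this, dzbar_eq_zero hf, star_zero]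

/-- The matrix `∂Fᵃ/∂zᵇ` of the derivative of `F`. -/
def holJac (F : (Fin n → ℂ) → (Fin n → ℂ)) (z : Fin n → ℂ) : Matrix (Fin n) (Fin n) ℂ :=
  Matrix.of fun a b => fderiv ℂ F z (Pi.single b 1) a

variable {O U : Set (Fin n → ℂ)} {F : (Fin n → ℂ) → (Fin n → ℂ)}

theorem differentiableAt_holJac (hO : IsOpen O) (hF : ContDiffOn ℂ ω F O) (hz : z ∈ O)
    (a b : Fin n) :
    DifferentiableAt ℂ (fun w => holJac F w a b) z := by
  have h1 : DifferentiableAt ℂ (fderiv ℂ F) z :=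
    (((hF.fderiv_of_isOpen (m := ω) hO le_top).contDiffAt (hO.mem_nhds hz))).differentiableAt
      (by simp)
  have h2 : DifferentiableAt ℂ (fun w => fderiv ℂ F w (Pi.single b 1)) z :=
    h1.clm_apply (differentiableAt_const _)
  exact differentiableAt_pi.1 h2 a

theorem differentiableAt_hol (hO : IsOpen O) (hF : ContDiffOn ℂ ω F O) (hz : z ∈ O) :
    DifferentiableAt ℂ F z :=
  (hF.contDiffAt (hO.mem_nhds hz)).differentiableAt (by simp)

/-- The complex Hessian of a composition with a holomorphic map. -/
theorem ddbar_comp (hO : IsOpen O) (hF : ContDiffOn ℂ ω F O) (hU : IsOpen U) (hFU : MapsTo F O U)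
    {f : (Fin n → ℂ) → ℂ} (hf : ContDiffOn ℝ ∞ f U) (hz : z ∈ O) :
    ddbar (fun w => f (F w)) z =
      (holJac F z).transpose * ddbar f (F z) * (holJac F z).map star := by
  ext a b
  have e1 : wd Complex.I b (fun w => f (F w)) =ᶠ[𝓝 z] fun w =>
      ∑ i, star (holJac F w i b) * wd Complex.I i f (F w) := by
    filter_upwards [hO.mem_nhds hz] with w hw
    exact dzbar_comp (differentiableAt_hol hO hF hw) (diffAt_of_contDiffOn hU hf (hFU hw))
  have hJ := fun i => differentiableAt_holJac hO hF hz i b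
  have d1 : ∀ i, DifferentiableAt ℝ (fun w => star (holJac F w i b)) z := fun i =>
    ((hJ i).restrictScalars ℝ).star
  have d2 : ∀ i, DifferentiableAt ℝ (wd Complex.I i f) (F z) := fun i =>
    diffAt_of_contDiffOn hU (contDiffOn_wd hU hf) (hFU hz)
  have d3 : ∀ i, DifferentiableAt ℝ (fun w => wd Complex.I i f (F w)) z := fun i =>
    (d2 i).comp z ((differentiableAt_hol hO hF hz).restrictScalars ℝ)
  rw [ddbar_apply_eq, wd_congr e1, wd_sum _ fun i _ => (d1 i).fun_mul (d3 i)]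
  have e2 : ∀ i, wd (-Complex.I) a (fun w => star (holJac F w i b) * wd Complex.I i f (F w)) z =
      ∑ j, holJac F z j a * ddbar f (F z) j i * star (holJac F z i b) := by
    intro i
    rw [wd_mul (d1 i) (d3 i), dz_star_eq_zero (hJ i), zero_mul, zero_add,
      dz_comp (differentiableAt_hol hO hF hz) (d2 i), Finset.mul_sum]
    refine Finset.sum_congr rfl fun j _ => ?_
    rw [ddbar_apply_eq]
    simp only [holJac, Matrix.of_apply]
    ring
  simp only [e2, Matrix.mul_apply, Matrix.transpose_apply, Matrix.map_apply, Finset.sum_mul]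

/-- `log |j|²` is pluriharmonic for a nowhere vanishing holomorphic `j`. -/
theorem ddbar_log_normSq (hO : IsOpen O) {j : (Fin n → ℂ) → ℂ} (hj : ContDiffOn ℂ ω j O)
    (hj0 : ∀ w ∈ O, j w ≠ 0) (hz : z ∈ O) :
    ddbar (fun w => ((Real.log (Complex.normSq (j w)) : ℝ) : ℂ)) z = 0 := by
  have hdj : ∀ w ∈ O, DifferentiableAt ℂ j w := fun w hw =>
    (hj.contDiffAt (hO.mem_nhds hw)).differentiableAt (by simp)
  have e1 : ∀ w ∈ O, ∀ b,
      wd Complex.I b (fun w => ((Real.log (Complex.normSq (j w)) : ℝ) : ℂ)) w =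
        star (fderiv ℂ j w (Pi.single b 1) / j w) := by
    intro w hw b
    have h1 : DifferentiableAt ℝ j w := (hdj w hw).restrictScalars ℝ
    have e2 : (fun w => ((Real.log (Complex.normSq (j w)) : ℝ) : ℂ)) =ᶠ[𝓝 w]
        fun w => Complex.log (j w * star (j w)) := by
      filter_upwards [hO.mem_nhds hw] with y hy
      rw [Complex.ofReal_log (Complex.normSq_nonneg _), ← Complex.mul_conj]
      rfl
    have hq : HasFDerivAt (fun w => j w * star (j w))
        (fderiv ℝ (fun w => j w * star (j w)) w) w := (h1.fun_mul h1.star).hasFDerivAt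
    have hpos : j w * star (j w) ∈ Complex.slitPlane := by
      left
      have : j w * star (j w) = (Complex.normSq (j w) : ℂ) := Complex.mul_conj _
      rw [this, Complex.ofReal_re]
      exact Complex.normSq_pos.2 (hj0 w hw)
    have h2 : HasFDerivAt (fun w => Complex.log (j w * star (j w))) _ w :=
      HasFDerivAt.comp (g := Complex.log) (f := fun w => j w * star (j w)) w
      (Complex.hasStrictFDerivAt_log_real hpos).hasFDerivAt hq
    have h3 : wd Complex.I b (fun w => Complex.log (j w * star (j w))) w =
        (j w * star (j w))⁻¹ * wd Complex.I b (fun w => j w * star (j w)) w := by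
      rw [wd_eq_of_hasFDerivAt h2, wd]
      simp
      ring
    have h4 : wd (-Complex.I) b j w = fderiv ℂ j w (Pi.single b 1) := by
      have h5 := dz_comp (a := b) (F := fun w => w) (z := w) differentiableAt_id h1
      have hI : (Pi.single b Complex.I : Fin n → ℂ) = Complex.I • Pi.single b (1 : ℂ) := by
        ext i; by_cases h : i = b
        · subst h; simp
        · simp [h]
      rw [wd_eq_of_hasFDerivAt ((hdj w hw).hasFDerivAt.restrictScalars ℝ)]
      simp only [ContinuousLinearMap.coe_restrictScalars', hI, map_smul, smul_eq_mul]
      linear_combination (-(1 : ℂ) / 2 * fderiv ℂ j w (Pi.single b 1)) * Complex.I_mul_I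
    rw [wd_congr e2, h3, wd_mul h1 h1.star, dzbar_eq_zero (hdj w hw), wd_star h1]
    have : star Complex.I = -Complex.I := by simp
    rw [this, h4, star_div₀]
    have h6 := hj0 w hw
    have h7 : star (j w) ≠ 0 := star_ne_zero.2 h6
    field_simp
    ring
  ext a b
  rw [ddbar_apply_eq]
  have e3 : wd Complex.I b (fun w => ((Real.log (Complex.normSq (j w)) : ℝ) : ℂ)) =ᶠ[𝓝 z]
      fun w => star (fderiv ℂ j w (Pi.single b 1) / j w) := by
    filter_upwards [hO.mem_nhds hz] with w hw using e1 w hw b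
  rw [wd_congr e3, dz_star_eq_zero]
  · rfl
  · have h1 : DifferentiableAt ℂ (fderiv ℂ j) z :=
      (((hj.fderiv_of_isOpen (m := ω) hO le_top).contDiffAt (hO.mem_nhds hz))).differentiableAt
        (by simp)
    simp only [div_eq_mul_inv]
    exact (h1.clm_apply (differentiableAt_const _)).mul ((hdj z hz).inv (hj0 z hz))

/-- The real Jacobian determinant is `|det ∂F|²`. -/
theorem det_fderiv_real (F : (Fin n → ℂ) → (Fin n → ℂ)) (z : Fin n → ℂ) :
    ((fderiv ℂ F z).restrictScalars ℝ).det = Complex.normSq (holJac F z).det := by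
  have h1 : holJac F z = LinearMap.toMatrix' (fderiv ℂ F z : (Fin n → ℂ) →ₗ[ℂ] (Fin n → ℂ)) := by
    ext a b
    simp [holJac, LinearMap.toMatrix'_apply]
  rw [h1, LinearMap.det_toMatrix', ← Algebra.norm_complex_apply]
  exact LinearMap.det_restrictScalars

end Holomorphic

/-! ### Tensors in charts and their transformation laws -/

section Charts

variable {n : ℕ} {X : Type*} [TopologicalSpace X]

/-- The part of the target of the chart `e` which corresponds to the common domain of `e` and
`e'`. -/
def overlap (e e' : OpenPartialHomeomorph X (Fin n → ℂ)) : Set (Fin n → ℂ) :=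
  e.target ∩ e.symm ⁻¹' e'.source

variable {e e' : OpenPartialHomeomorph X (Fin n → ℂ)} {z : Fin n → ℂ}

theorem isOpen_overlap : IsOpen (overlap e e') := e.isOpen_inter_preimage_symm e'.open_source

theorem transition_mem_overlap (hz : z ∈ overlap e e') : e' (e.symm z) ∈ overlap e' e :=
  ⟨e'.map_source hz.2, by
    simpa [e'.left_inv hz.2] using e.map_target hz.1⟩

theorem transition_transition (hz : z ∈ overlap e e') : e (e'.symm (e' (e.symm z))) = z := by
  rw [e'.left_inv hz.2, e.right_inv hz.1]

theorem image_overlap : (fun w => e' (e.symm w)) '' overlap e e' = overlap e' e := by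
  ext w
  constructor
  · rintro ⟨z, hz, rfl⟩
    exact transition_mem_overlap hz
  · intro hw
    exact ⟨e (e'.symm w), transition_mem_overlap hw, transition_transition hw⟩

theorem jacobian_eq_holJac : jacobian e e' z = holJac (fun w => e' (e.symm w)) z := rfl

variable [ChartedSpace (Fin n → ℂ) X] [IsManifold 𝓘(ℂ, Fin n → ℂ) ω X]

theorem contDiffOn_transition (he : e ∈ atlas (Fin n → ℂ) X) (he' : e' ∈ atlas (Fin n → ℂ) X) :
    ContDiffOn ℂ ω (fun w => e' (e.symm w)) (overlap e e') := by
  have h := (contDiffGroupoid ω 𝓘(ℂ, Fin n → ℂ)).compatible he he'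
  rw [contDiffGroupoid, mem_groupoid_of_pregroupoid] at h
  have h1 : ContDiffOn ℂ ω _ _ := h.1
  simpa [overlap, Function.comp_def, OpenPartialHomeomorph.trans_source] using h1

theorem jacobian_mul_jacobian (he : e ∈ atlas (Fin n → ℂ) X) (he' : e' ∈ atlas (Fin n → ℂ) X)
    (hz : z ∈ overlap e e') : jacobian e' e (e' (e.symm z)) * jacobian e e' z = 1 := by
  have h1 := differentiableAt_hol isOpen_overlap (contDiffOn_transition he he') hz
  have h2 := differentiableAt_hol isOpen_overlap (contDiffOn_transition he' he)
    (transition_mem_overlap hz)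
  have h3 : HasFDerivAt (fun w => e (e'.symm (e' (e.symm w))))
      ((fderiv ℂ (fun w => e (e'.symm w)) (e' (e.symm z))).comp
        (fderiv ℂ (fun w => e' (e.symm w)) z)) z :=
    HasFDerivAt.comp (g := fun w => e (e'.symm w)) z h2.hasFDerivAt h1.hasFDerivAt
  have h4 : HasFDerivAt (fun w => e (e'.symm (e' (e.symm w))))
      (ContinuousLinearMap.id ℂ (Fin n → ℂ)) z := by
    refine (hasFDerivAt_id z).congr_of_eventuallyEq ?_
    filter_upwards [isOpen_overlap.mem_nhds hz] with w hw using transition_transition hw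
  have h5 := h3.unique h4
  have hJ : ∀ (F : (Fin n → ℂ) → (Fin n → ℂ)) (z : Fin n → ℂ), holJac F z =
      LinearMap.toMatrix' (fderiv ℂ F z : (Fin n → ℂ) →ₗ[ℂ] (Fin n → ℂ)) := by
    intro F z
    ext a b
    simp [holJac, LinearMap.toMatrix'_apply]
  have h6 := congrArg (fun f : (Fin n → ℂ) →L[ℂ] (Fin n → ℂ) =>
    LinearMap.toMatrix' (f : (Fin n → ℂ) →ₗ[ℂ] (Fin n → ℂ))) h5
  rw [jacobian_eq_holJac, jacobian_eq_holJac, hJ, hJ, ← LinearMap.toMatrix'_comp]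
  simpa using h6

theorem det_jacobian_ne_zero (he : e ∈ atlas (Fin n → ℂ) X) (he' : e' ∈ atlas (Fin n → ℂ) X)
    (hz : z ∈ overlap e e') : (jacobian e e' z).det ≠ 0 := by
  intro h
  have := congrArg Matrix.det (jacobian_mul_jacobian he he' hz)
  rw [Matrix.det_mul, h, mul_zero, Matrix.det_one] at this
  exact zero_ne_one this

/-! #### The transformation laws -/

/-- A smooth function on `X`, given by its expressions in the charts. -/
structure IsScalar (f : OpenPartialHomeomorph X (Fin n → ℂ) → (Fin n → ℂ) → ℂ) : Prop where
  smooth : ∀ e ∈ atlas (Fin n → ℂ) X, ContDiffOn ℝ ∞ (f e) e.target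
  transform : ∀ e ∈ atlas (Fin n → ℂ) X, ∀ e' ∈ atlas (Fin n → ℂ) X, ∀ z ∈ overlap e e',
    f e z = f e' (e' (e.symm z))

/-- The transformation law of an `(n,n)`-form. -/
def IsDensity (D : OpenPartialHomeomorph X (Fin n → ℂ) → (Fin n → ℂ) → ℂ) : Prop :=
  ∀ e ∈ atlas (Fin n → ℂ) X, ∀ e' ∈ atlas (Fin n → ℂ) X, ∀ z ∈ overlap e e',
    D e z = (Complex.normSq (jacobian e e' z).det : ℂ) * D e' (e' (e.symm z))

/-- A smooth closed complex form of type `(1,1)`, given by its coefficients in the charts. -/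
structure IsClosedForm (h : Coeff n X) : Prop where
  smooth : ∀ e ∈ atlas (Fin n → ℂ) X, ∀ a b, ContDiffOn ℝ ∞ (fun z => h e z a b) e.target
  transform : ∀ e ∈ atlas (Fin n → ℂ) X, ∀ e' ∈ atlas (Fin n → ℂ) X, ∀ z ∈ overlap e e',
    h e z = (jacobian e e' z).transpose * h e' (e' (e.symm z)) * (jacobian e e' z).map star
  closed : ∀ e ∈ atlas (Fin n → ℂ) X, ∀ z ∈ e.target, ∀ k i j,
    wd (-Complex.I) k (fun w => h e w i j) z = wd (-Complex.I) i (fun w => h e w k j) z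
  closed_bar : ∀ e ∈ atlas (Fin n → ℂ) X, ∀ z ∈ e.target, ∀ k i j,
    wd Complex.I k (fun w => h e w i j) z = wd Complex.I j (fun w => h e w i k) z

/-- A smooth closed form of type `(n-1,n-1)`. It is given by the matrix `A` such that its product
with `i ∑ h a b dzᵃ ∧ dz̄ᵇ` is `∑ A b a * h a b` times the coordinate volume form: closed means that
the rows and columns of `A` are divergence free. -/
structure IsClosedCoform (A : Coeff n X) : Prop where
  smooth : ∀ e ∈ atlas (Fin n → ℂ) X, ∀ a b, ContDiffOn ℝ ∞ (fun z => A e z a b) e.target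
  transform : ∀ e ∈ atlas (Fin n → ℂ) X, ∀ e' ∈ atlas (Fin n → ℂ) X, ∀ z ∈ overlap e e',
    (jacobian e e' z).map star * A e z * (jacobian e e' z).transpose =
      (Complex.normSq (jacobian e e' z).det : ℂ) • A e' (e' (e.symm z))
  div : ∀ e ∈ atlas (Fin n → ℂ) X, ∀ z ∈ e.target, ∀ b,
    ∑ a, wd (-Complex.I) a (fun w => A e w b a) z = 0
  div_bar : ∀ e ∈ atlas (Fin n → ℂ) X, ∀ z ∈ e.target, ∀ a,
    ∑ b, wd Complex.I b (fun w => A e w b a) z = 0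

theorem det_map_star (J : Matrix (Fin n) (Fin n) ℂ) : (J.map star).det = star J.det := by
  rw [← Matrix.det_transpose, ← Matrix.det_conjTranspose]; rfl

theorem det_mul_det_star (J : Matrix (Fin n) (Fin n) ℂ) :
    J.det * (J.map star).det = (Complex.normSq J.det : ℂ) := by
  rw [det_map_star]; exact Complex.mul_conj _

section Scalar

variable {f : OpenPartialHomeomorph X (Fin n → ℂ) → (Fin n → ℂ) → ℂ}

theorem eventually_transform (hf : IsScalar f) (he : e ∈ atlas (Fin n → ℂ) X)
    (he' : e' ∈ atlas (Fin n → ℂ) X) (hz : z ∈ overlap e e') :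
    f e =ᶠ[𝓝 z] fun w => f e' (e' (e.symm w)) := by
  filter_upwards [isOpen_overlap.mem_nhds hz] with w hw using hf.transform e he e' he' w hw

theorem IsScalar.dz_transform (hf : IsScalar f) (he : e ∈ atlas (Fin n → ℂ) X)
    (he' : e' ∈ atlas (Fin n → ℂ) X) (hz : z ∈ overlap e e') :
    (fun a => wd (-Complex.I) a (f e) z) = (jacobian e e' z).transpose.mulVec
      fun a => wd (-Complex.I) a (f e') (e' (e.symm z)) := by
  funext a
  rw [wd_congr (eventually_transform hf he he' hz),
    dz_comp (F := fun w => e' (e.symm w))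
      (differentiableAt_hol isOpen_overlap (contDiffOn_transition he he') hz)
      (diffAt_of_contDiffOn e'.open_target (hf.smooth e' he') (e'.map_source hz.2))]
  simp [Matrix.mulVec, dotProduct, jacobian]

theorem IsScalar.dzbar_transform (hf : IsScalar f) (he : e ∈ atlas (Fin n → ℂ) X)
    (he' : e' ∈ atlas (Fin n → ℂ) X) (hz : z ∈ overlap e e') :
    (fun a => wd Complex.I a (f e) z) = ((jacobian e e' z).map star).transpose.mulVec
      fun a => wd Complex.I a (f e') (e' (e.symm z)) := by
  funext a
  rw [wd_congr (eventually_transform hf he he' hz),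
    dzbar_comp (F := fun w => e' (e.symm w))
      (differentiableAt_hol isOpen_overlap (contDiffOn_transition he he') hz)
      (diffAt_of_contDiffOn e'.open_target (hf.smooth e' he') (e'.map_source hz.2))]
  simp [Matrix.mulVec, dotProduct, jacobian]

theorem IsScalar.ddbar_transform (hf : IsScalar f) (he : e ∈ atlas (Fin n → ℂ) X)
    (he' : e' ∈ atlas (Fin n → ℂ) X) (hz : z ∈ overlap e e') :
    ddbar (f e) z = (jacobian e e' z).transpose * ddbar (f e') (e' (e.symm z)) *
      (jacobian e e' z).map star := by
  have h1 : ddbar (f e) z = ddbar (fun w => f e' (e' (e.symm w))) z := by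
    ext a b
    rw [ddbar_apply_eq, ddbar_apply_eq]
    exact wd_congr ((eventually_transform hf he he' hz).eventuallyEq_nhds.mono
      fun w hw => wd_congr hw)
  rw [h1, ddbar_comp isOpen_overlap (contDiffOn_transition he he') e'.open_target
    (fun w hw => e'.map_source hw.2) (hf.smooth e' he') hz]
  rfl

theorem IsScalar.isClosedForm_ddbar (hf : IsScalar f) :
    IsClosedForm fun e z => ddbar (f e) z where
  smooth e he a b := contDiffOn_ddbar e.open_target (hf.smooth e he) a b
  transform _ he _ he' _ hz := hf.ddbar_transform he he' hz
  closed e he _ hz k i j := ddbar_closed e.open_target (hf.smooth e he) hz k i j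
  closed_bar e he _ hz k i j := ddbar_closed_bar e.open_target (hf.smooth e he) hz k i j

end Scalar

theorem IsClosedRealForm.isClosedForm {h : Coeff n X} (hh : IsClosedRealForm h) :
    IsClosedForm h where
  smooth := hh.smooth
  transform e he e' he' z hz := by
    have := hh.transform e he e' he' (e.symm z) ⟨e.map_target hz.1, hz.2⟩
    rwa [e.right_inv hz.1] at this
  closed e he z hz k i j := by
    have := hh.closed e he z hz i j k
    rwa [dz_eq_wd] at this
  closed_bar e he z hz k i j := by
    have hd := fun i j => diffAt_of_contDiffOn e.open_target (hh.smooth e he i j) hz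
    have key : ∀ k i j, wd Complex.I k (fun w => h e w i j) z =
        star (wd (-Complex.I) k (fun w => h e w j i) z) := by
      intro k i j
      have h1 := wd_star (c := Complex.I) (a := k) (hd j i)
      have : star Complex.I = -Complex.I := by simp
      rw [this] at h1
      rw [← h1]
      refine wd_congr ?_
      filter_upwards [e.open_target.mem_nhds hz] with w hw
      exact ((hh.real e he w hw).apply i j).symm
    rw [key, key]
    have := hh.closed e he z hz j i k
    rw [dz_eq_wd] at this
    rw [this]

theorem IsClosedForm.add {h h' : Coeff n X} (hh : IsClosedForm h) (hh' : IsClosedForm h') :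
    IsClosedForm fun e z => h e z + h' e z where
  smooth e he a b := (hh.smooth e he a b).add (hh'.smooth e he a b)
  transform e he e' he' z hz := by
    rw [hh.transform e he e' he' z hz, hh'.transform e he e' he' z hz, Matrix.mul_add,
      Matrix.add_mul]
  closed e he z hz k i j := by
    have d := fun i j => diffAt_of_contDiffOn e.open_target (hh.smooth e he i j) hz
    have d' := fun i j => diffAt_of_contDiffOn e.open_target (hh'.smooth e he i j) hz
    simp only [Matrix.add_apply]
    rw [wd_add (d _ _) (d' _ _), wd_add (d _ _) (d' _ _), hh.closed e he z hz,
      hh'.closed e he z hz]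
  closed_bar e he z hz k i j := by
    have d := fun i j => diffAt_of_contDiffOn e.open_target (hh.smooth e he i j) hz
    have d' := fun i j => diffAt_of_contDiffOn e.open_target (hh'.smooth e he i j) hz
    simp only [Matrix.add_apply]
    rw [wd_add (d _ _) (d' _ _), wd_add (d _ _) (d' _ _), hh.closed_bar e he z hz,
      hh'.closed_bar e he z hz]

theorem IsClosedForm.smul {h : Coeff n X} (hh : IsClosedForm h) (k : ℂ) :
    IsClosedForm fun e z => k • h e z where
  smooth e he a b := contDiffOn_const.mul (hh.smooth e he a b)
  transform e he e' he' z hz := by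
    rw [hh.transform e he e' he' z hz, Matrix.mul_smul, Matrix.smul_mul]
  closed e he z hz l i j := by
    have d := fun i j => diffAt_of_contDiffOn e.open_target (hh.smooth e he i j) hz
    simp only [Matrix.smul_apply, smul_eq_mul]
    rw [wd_const_mul _ (d _ _), wd_const_mul _ (d _ _), hh.closed e he z hz]
  closed_bar e he z hz l i j := by
    have d := fun i j => diffAt_of_contDiffOn e.open_target (hh.smooth e he i j) hz
    simp only [Matrix.smul_apply, smul_eq_mul]
    rw [wd_const_mul _ (d _ _), wd_const_mul _ (d _ _), hh.closed_bar e he z hz]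

section Coform

variable {h r : Coeff n X}

theorem IsClosedForm.det_transform (hh : IsClosedForm h) : IsDensity fun e z => (h e z).det := by
  intro e he e' he' z hz
  simp only
  rw [hh.transform e he e' he' z hz, Matrix.det_mul, Matrix.det_mul, Matrix.det_transpose,
    ← det_mul_det_star]
  ring

theorem IsClosedForm.isClosedCoform_adjugate (hh : IsClosedForm h)
    (h0 : ∀ e ∈ atlas (Fin n → ℂ) X, ∀ z ∈ e.target, (h e z).det ≠ 0) :
    IsClosedCoform fun e z => (h e z).adjugate where
  smooth e he a b := contDiffOn_adjugate (hh.smooth e he) a b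
  transform e he e' he' z hz := by
    rw [hh.transform e he e' he' z hz, Matrix.adjugate_mul_distrib, Matrix.adjugate_mul_distrib]
    calc _ = ((jacobian e e' z).map star * ((jacobian e e' z).map star).adjugate) *
          (h e' (e' (e.symm z))).adjugate *
          ((jacobian e e' z).transpose.adjugate * (jacobian e e' z).transpose) := by
          simp only [Matrix.mul_assoc]
      _ = _ := by
          rw [Matrix.mul_adjugate, Matrix.adjugate_mul, ← det_mul_det_star, Matrix.det_transpose]
          simp [smul_smul]
  div e he z hz b :=
    sum_wd_adjugate (fun i j => diffAt_of_contDiffOn e.open_target (hh.smooth e he i j) hz)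
      (h0 e he z hz) (hh.closed e he z hz) b
  div_bar e he z hz a := by
    have := sum_wd_adjugate (c := Complex.I) (h := fun w => (h e w).transpose) (z := z)
      (fun i j => diffAt_of_contDiffOn e.open_target (hh.smooth e he j i) hz)
      (by rw [Matrix.det_transpose]; exact h0 e he z hz)
      (fun k i j => hh.closed_bar e he z hz k j i) a
    simpa only [← Matrix.adjugate_transpose, Matrix.transpose_apply] using this

theorem inv_transform {A B J : Matrix (Fin n) (Fin n) ℂ} (hJ : J.det ≠ 0)
    (hA : A = J.transpose * B * J.map star) :
    J.map star * A⁻¹ * J.transpose = B⁻¹ := by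
  have h1 : IsUnit (J.map star).det := by
    rw [det_map_star]; exact isUnit_iff_ne_zero.2 (star_ne_zero.2 hJ)
  have h2 : IsUnit J.transpose.det := by
    rw [Matrix.det_transpose]; exact isUnit_iff_ne_zero.2 hJ
  rw [hA, Matrix.mul_inv_rev, Matrix.mul_inv_rev]
  calc _ = (J.map star * (J.map star)⁻¹) * B⁻¹ * (J.transpose⁻¹ * J.transpose) := by
        simp only [Matrix.mul_assoc]
    _ = _ := by rw [Matrix.mul_nonsing_inv _ h1, Matrix.nonsing_inv_mul _ h2]; simp

theorem IsClosedForm.isClosedCoform_mixedCof (hh : IsClosedForm h)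
    (h0 : ∀ e ∈ atlas (Fin n → ℂ) X, ∀ z ∈ e.target, (h e z).det ≠ 0) (hr : IsClosedForm r) :
    IsClosedCoform fun e z => mixedCof (h e z) (r e z) where
  smooth e he a b := by
    have hi := contDiffOn_matrix_inv (hh.smooth e he) (h0 e he)
    have hir := contDiffOn_matrix_mul hi (hr.smooth e he)
    exact (contDiffOn_det (hh.smooth e he)).mul
      (((contDiffOn_trace hir).mul (hi a b)).sub (contDiffOn_matrix_mul hir hi a b))
  transform e he e' he' z hz := by
    set J := jacobian e e' z
    have hJ : J.det ≠ 0 := det_jacobian_ne_zero he he' hz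
    have e1 := inv_transform hJ (hh.transform e he e' he' z hz)
    have e2 := hr.transform e he e' he' z hz
    have e3 : (h e z).det = (Complex.normSq J.det : ℂ) * (h e' (e' (e.symm z))).det :=
      hh.det_transform e he e' he' z hz
    have e4 : ((h e z)⁻¹ * r e z).trace =
        ((h e' (e' (e.symm z)))⁻¹ * r e' (e' (e.symm z))).trace := by
      rw [e2, ← e1, ← Matrix.mul_assoc, Matrix.trace_mul_comm]
      simp only [← Matrix.mul_assoc]
      rfl
    have e5 : J.map star * ((h e z)⁻¹ * r e z * (h e z)⁻¹) * J.transpose =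
        (h e' (e' (e.symm z)))⁻¹ * r e' (e' (e.symm z)) * (h e' (e' (e.symm z)))⁻¹ := by
      rw [e2, ← e1]
      simp only [← Matrix.mul_assoc]
      rfl
    simp only [mixedCof]
    rw [Matrix.mul_smul, Matrix.smul_mul, Matrix.mul_sub, Matrix.sub_mul, e5, Matrix.mul_smul,
      Matrix.smul_mul, e1, e3, e4, smul_smul]
  div e he z hz b :=
    sum_wd_mixedCof (fun i j => diffAt_of_contDiffOn e.open_target (hh.smooth e he i j) hz)
      (h0 e he z hz) (hh.closed e he z hz)
      (fun i j => diffAt_of_contDiffOn e.open_target (hr.smooth e he i j) hz)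
      (hr.closed e he z hz) b
  div_bar e he z hz a := by
    have := sum_wd_mixedCof (c := Complex.I) (g := fun w => (h e w).transpose)
      (r := fun w => (r e w).transpose) (z := z)
      (fun i j => diffAt_of_contDiffOn e.open_target (hh.smooth e he j i) hz)
      (by rw [Matrix.det_transpose]; exact h0 e he z hz)
      (fun k i j => hh.closed_bar e he z hz k j i)
      (fun i j => diffAt_of_contDiffOn e.open_target (hr.smooth e he j i) hz)
      (fun k i j => hr.closed_bar e he z hz k j i) a
    simpa only [mixedCof_transpose, Matrix.transpose_apply] using this

theorem IsClosedCoform.pairing_transform {A : Coeff n X} (hA : IsClosedCoform A)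
    {f k : OpenPartialHomeomorph X (Fin n → ℂ) → (Fin n → ℂ) → ℂ} (hf : IsScalar f)
    (hk : IsScalar k) :
    IsDensity fun e z => pairing (A e z) (fun a => wd (-Complex.I) a (f e) z)
      (fun b => wd Complex.I b (k e) z) := by
  intro e he e' he' z hz
  have hp : ∀ (A : Matrix (Fin n) (Fin n) ℂ) (α β : Fin n → ℂ),
      pairing A α β = dotProduct β (A.mulVec α) := by
    intro A α β
    simp only [pairing, dotProduct, Matrix.mulVec, Finset.mul_sum]
    rw [Finset.sum_comm]
    exact Finset.sum_congr rfl fun a _ => Finset.sum_congr rfl fun b _ => by ring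
  simp only [hp]
  rw [hf.dz_transform he he' hz, hk.dzbar_transform he he' hz, Matrix.mulVec_transpose,
    ← Matrix.dotProduct_mulVec, Matrix.mulVec_mulVec, Matrix.mulVec_mulVec,
    hA.transform e he e' he' z hz, Matrix.smul_mulVec, dotProduct_smul, smul_eq_mul]

end Coform

section Metric

variable {g : Coeff n X}

theorem IsClosedForm.isClosedForm_logDet (hg : IsClosedForm g)
    (hp : ∀ e ∈ atlas (Fin n → ℂ) X, ∀ z ∈ e.target, 0 < (g e z).det) :
    IsClosedForm fun e z => ddbar (logDet (g e)) z where
  smooth e he a b := contDiffOn_ddbar e.open_target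
    (contDiffOn_logDet (hg.smooth e he) (hp e he)) a b
  closed e he z hz := ddbar_closed e.open_target
    (contDiffOn_logDet (hg.smooth e he) (hp e he)) hz
  closed_bar e he z hz := ddbar_closed_bar e.open_target
    (contDiffOn_logDet (hg.smooth e he) (hp e he)) hz
  transform e he e' he' z hz := by
    have hL' : ContDiffOn ℝ ∞ (logDet (g e')) e'.target :=
      contDiffOn_logDet (hg.smooth e' he') (hp e' he')
    have hT := contDiffOn_transition he he'
    have hJ : ContDiffOn ℂ ω (fun w => (jacobian e e' w).det) (overlap e e') := by
      simp only [Matrix.det_apply]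
      refine ContDiffOn.sum fun σ _ => ContDiffOn.const_smul _ (contDiffOn_prod fun i _ => ?_)
      have h1 : ContDiffOn ℂ ω (fun w => fderiv ℂ (fun w => e' (e.symm w)) w (Pi.single i 1))
          (overlap e e') := (hT.fderiv_of_isOpen (m := ω) isOpen_overlap le_top).clm_apply
            contDiffOn_const
      exact contDiffOn_pi.1 h1 (σ i)
    have hJ0 : ∀ w ∈ overlap e e', (jacobian e e' w).det ≠ 0 := fun w hw =>
      det_jacobian_ne_zero he he' hw
    have e1 : ∀ w ∈ overlap e e', logDet (g e) w = logDet (g e') (e' (e.symm w)) +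
        ((Real.log (Complex.normSq (jacobian e e' w).det) : ℝ) : ℂ) := by
      intro w hw
      have h1 : (g e w).det = (Complex.normSq (jacobian e e' w).det : ℂ) *
          (g e' (e' (e.symm w))).det := hg.det_transform e he e' he' w hw
      have h2 := (Complex.pos_iff.1 (hp e' he' _ (e'.map_source hw.2))).1
      have h3 := Complex.normSq_pos.2 (hJ0 w hw)
      simp only [logDet]
      rw [h1, Complex.re_ofReal_mul, Real.log_mul h3.ne' h2.ne', add_comm]
      push_cast
      rfl
    have hk : ContDiffOn ℝ ∞ (fun w => ((Real.log (Complex.normSq (jacobian e e' w).det) : ℝ) : ℂ))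
        (overlap e e') := by
      refine Complex.ofRealCLM.contDiff.comp_contDiffOn (ContDiffOn.log ?_ fun w hw =>
        (Complex.normSq_pos.2 (hJ0 w hw)).ne')
      have h1 : ContDiffOn ℝ ∞ (fun w => (jacobian e e' w).det) (overlap e e') :=
        (hJ.restrict_scalars ℝ).of_le le_top
      have h2 := Complex.reCLM.contDiff.comp_contDiffOn h1
      have h3 := Complex.imCLM.contDiff.comp_contDiffOn h1
      exact (h2.mul h2).add (h3.mul h3)
    have hc : ContDiffOn ℝ ∞ (fun w => logDet (g e') (e' (e.symm w))) (overlap e e') :=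
      hL'.comp ((hT.restrict_scalars ℝ).of_le le_top) fun w hw => e'.map_source hw.2
    have e2 : ddbar (logDet (g e)) z = ddbar (fun w => logDet (g e') (e' (e.symm w))) z +
        ddbar (fun w => ((Real.log (Complex.normSq (jacobian e e' w).det) : ℝ) : ℂ)) z := by
      ext a b
      simp only [Matrix.add_apply, ddbar_apply_eq]
      rw [← wd_add (diffAt_of_contDiffOn isOpen_overlap (contDiffOn_wd isOpen_overlap hc) hz)
        (diffAt_of_contDiffOn isOpen_overlap (contDiffOn_wd isOpen_overlap hk) hz)]
      refine wd_congr ?_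
      filter_upwards [isOpen_overlap.mem_nhds hz] with w hw
      rw [← wd_add (diffAt_of_contDiffOn isOpen_overlap hc hw)
        (diffAt_of_contDiffOn isOpen_overlap hk hw)]
      refine wd_congr ?_
      filter_upwards [isOpen_overlap.mem_nhds hw] with y hy using e1 y hy
    rw [e2, ddbar_log_normSq isOpen_overlap hJ hJ0 hz, add_zero,
      ddbar_comp isOpen_overlap hT e'.open_target (fun w hw => e'.map_source hw.2) hL' hz]
    rfl

variable {f : OpenPartialHomeomorph X (Fin n → ℂ) → (Fin n → ℂ) → ℂ}

theorem IsScalar.lap (hg : IsClosedForm g)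
    (hp : ∀ e ∈ atlas (Fin n → ℂ) X, ∀ z ∈ e.target, 0 < (g e z).det) (hf : IsScalar f) :
    IsScalar fun e z => lap (g e) (f e) z where
  smooth e he := contDiffOn_lap e.open_target (hg.smooth e he) (hp e he) (hf.smooth e he)
  transform e he e' he' z hz := by
    have e1 := inv_transform (det_jacobian_ne_zero he he' hz) (hg.transform e he e' he' z hz)
    simp only [ComplexifiedKahler.lap]
    rw [hf.ddbar_transform he he' hz, ← e1, ← Matrix.mul_assoc, Matrix.trace_mul_comm]
    simp only [← Matrix.mul_assoc]

/-- The transformation law of `∂̄ ∇^{1,0} f`. -/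
theorem IsScalar.dzbar_gradUp_transform (hg : IsClosedForm g)
    (hp : ∀ e ∈ atlas (Fin n → ℂ) X, ∀ z ∈ e.target, 0 < (g e z).det) (hf : IsScalar f)
    (he : e ∈ atlas (Fin n → ℂ) X) (he' : e' ∈ atlas (Fin n → ℂ) X) (hz : z ∈ overlap e e') :
    (Matrix.of fun a b => wd Complex.I b (gradUp (g e') (f e') a) (e' (e.symm z))) *
      (jacobian e e' z).map star =
    jacobian e e' z * Matrix.of fun a b => wd Complex.I b (gradUp (g e) (f e) a) z := by
  have hV := contDiffOn_gradUp e.open_target (hg.smooth e he) (hp e he) (hf.smooth e he)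
  have hV' := contDiffOn_gradUp e'.open_target (hg.smooth e' he') (hp e' he') (hf.smooth e' he')
  have hT := contDiffOn_transition he he'
  have e1 : ∀ w ∈ overlap e e', ∀ a, gradUp (g e') (f e') a (e' (e.symm w)) =
      ∑ b, jacobian e e' w a b * gradUp (g e) (f e) b w := by
    intro w hw a
    have h1 := inv_transform (det_jacobian_ne_zero he he' hw) (hg.transform e he e' he' w hw)
    have h2 := hf.dzbar_transform he he' hw
    have hG : ∀ e z, (fun a => gradUp (g e) (f e) a z) =
        ((g e z)⁻¹).transpose.mulVec (fun b => wd Complex.I b (f e) z) := by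
      intro e z
      funext a
      simp [gradUp, Matrix.mulVec, dotProduct, dzbar_eq_wd]
    have h3 : (fun a => gradUp (g e') (f e') a (e' (e.symm w))) =
        (jacobian e e' w).mulVec (fun a => gradUp (g e) (f e) a w) := by
      rw [hG, hG, h2, ← h1]
      simp only [Matrix.transpose_mul, Matrix.transpose_transpose, Matrix.mulVec_mulVec,
        Matrix.mul_assoc]
    exact congrFun h3 a
  ext a c
  have hJd : ∀ b, DifferentiableAt ℂ (fun w => jacobian e e' w a b) z := fun b =>
    differentiableAt_holJac isOpen_overlap hT hz a b
  have d2 : ∀ b, DifferentiableAt ℝ (gradUp (g e) (f e) b) z := fun b =>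
    diffAt_of_contDiffOn e.open_target (hV b) hz.1
  have h1 := dzbar_comp (a := c) (differentiableAt_hol isOpen_overlap hT hz)
    (diffAt_of_contDiffOn e'.open_target (hV' a) (e'.map_source hz.2))
  have h2 : (fun w => gradUp (g e') (f e') a (e' (e.symm w))) =ᶠ[𝓝 z]
      fun w => ∑ b, jacobian e e' w a b * gradUp (g e) (f e) b w := by
    filter_upwards [isOpen_overlap.mem_nhds hz] with w hw using e1 w hw a
  rw [wd_congr h2, wd_sum _ fun b _ => ((hJd b).restrictScalars ℝ).fun_mul (d2 b)] at h1
  have h3 : ∀ b, wd Complex.I c (fun w => jacobian e e' w a b * gradUp (g e) (f e) b w) z =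
      jacobian e e' z a b * wd Complex.I c (gradUp (g e) (f e) b) z := by
    intro b
    have h4 : wd Complex.I c (fun w => jacobian e e' w a b) z = 0 := dzbar_eq_zero (hJd b)
    rw [wd_mul ((hJd b).restrictScalars ℝ) (d2 b), h4, zero_mul, zero_add]
  simp only [h3] at h1
  simp only [Matrix.mul_apply, Matrix.of_apply, Matrix.map_apply]
  rw [h1]
  exact Finset.sum_congr rfl fun i _ => mul_comm _ _

end Metric
end Charts

/-! ### Integration over the manifold and Stokes' theorem -/

section Integration

variable {n : ℕ}

theorem integrableOn_of_support {U K : Set (Fin n → ℂ)} (hU : IsOpen U) (hK : IsCompact K)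
    (hKU : K ⊆ U) {f : (Fin n → ℂ) → ℂ} (hf : ContinuousOn f U)
    (hfK : ∀ w ∈ U, w ∉ K → f w = 0) : IntegrableOn f U :=
  ((hf.mono hKU).integrableOn_compact hK).of_forall_sdiff_eq_zero hU.measurableSet
    fun w hw => hfK w hw.1 hw.2

variable {X : Type*} [TopologicalSpace X] {e e' : OpenPartialHomeomorph X (Fin n → ℂ)}
  {z : Fin n → ℂ}
  [ChartedSpace (Fin n → ℂ) X] [IsManifold 𝓘(ℂ, Fin n → ℂ) ω X]

theorem contDiffOn_comp_symm {f : X → ℂ} (hf : ContMDiff 𝓘(ℝ, Fin n → ℂ) 𝓘(ℝ, ℂ) ∞ f)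
    (he : e ∈ atlas (Fin n → ℂ) X) : ContDiffOn ℝ ∞ (fun z => f (e.symm z)) e.target := by
  have : IsManifold 𝓘(ℝ, Fin n → ℂ) ∞ X := isManifold_real
  rw [← contMDiffOn_iff_contDiffOn]
  exact hf.comp_contMDiffOn
    (contMDiffOn_symm_of_mem_maximalAtlas (IsManifold.subset_maximalAtlas he))

theorem contDiffOn_comp_symm_param {T : Set ℝ} {f : ℝ × X → ℂ}
    (hf : ContMDiffOn (𝓘(ℝ, ℝ).prod 𝓘(ℝ, Fin n → ℂ)) 𝓘(ℝ, ℂ) ∞ f (T ×ˢ univ))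
    (he : e ∈ atlas (Fin n → ℂ) X) :
    ContDiffOn ℝ ∞ (fun q : ℝ × (Fin n → ℂ) => f (q.1, e.symm q.2)) (T ×ˢ e.target) := by
  have : IsManifold 𝓘(ℝ, Fin n → ℂ) ∞ X := isManifold_real
  rw [← contMDiffOn_iff_contDiffOn]
  have h1 : ContMDiffOn 𝓘(ℝ, ℝ × (Fin n → ℂ)) (𝓘(ℝ, ℝ).prod 𝓘(ℝ, Fin n → ℂ)) ∞
      (fun q : ℝ × (Fin n → ℂ) => (q.1, e.symm q.2)) (T ×ˢ e.target) := by
    refine contDiff_fst.contMDiff.contMDiffOn.prodMk ?_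
    exact (contMDiffOn_symm_of_mem_maximalAtlas (IsManifold.subset_maximalAtlas he)).comp
      contDiff_snd.contMDiff.contMDiffOn fun q hq => hq.2
  exact hf.comp h1 fun q hq => ⟨hq.1, mem_univ _⟩

theorem isScalar_of_contMDiff {f : X → ℂ} (hf : ContMDiff 𝓘(ℝ, Fin n → ℂ) 𝓘(ℝ, ℂ) ∞ f) :
    IsScalar fun (e : OpenPartialHomeomorph X (Fin n → ℂ)) z => f (e.symm z) where
  smooth _ he := contDiffOn_comp_symm hf he
  transform e _ e' _ z hz := by rw [e'.left_inv hz.2]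

/-- Invariance of the integral of an `(n,n)`-form under a change of coordinates. -/
theorem IsDensity.setIntegral_overlap
    {D : OpenPartialHomeomorph X (Fin n → ℂ) → (Fin n → ℂ) → ℂ}
    (hD : IsDensity D) (he : e ∈ atlas (Fin n → ℂ) X) (he' : e' ∈ atlas (Fin n → ℂ) X) :
    ∫ z in overlap e e', D e z = ∫ z in overlap e' e, D e' z := by
  have h1 := integral_image_eq_integral_abs_det_fderiv_smul (volume : Measure (Fin n → ℂ))
    (s := overlap e e') (f := fun w => e' (e.symm w))
    (f' := fun w => (fderiv ℂ (fun w => e' (e.symm w)) w).restrictScalars ℝ)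
    isOpen_overlap.measurableSet
    (fun w hw => ((differentiableAt_hol isOpen_overlap
      (contDiffOn_transition he he') hw).hasFDerivAt.restrictScalars ℝ).hasFDerivWithinAt)
    (fun w hw y hy hwy => by
      rw [← transition_transition hw, ← transition_transition hy]
      exact congrArg (fun u => e (e'.symm u)) hwy) (D e')
  rw [image_overlap] at h1
  rw [h1]
  refine setIntegral_congr_fun isOpen_overlap.measurableSet fun w hw => ?_
  rw [hD e he e' he' w hw, det_fderiv_real, abs_of_nonneg (Complex.normSq_nonneg _),
    Complex.real_smul]
  rfl

variable [CompactSpace X] [T2Space X]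

theorem tsupport_chartPartition (x : X) :
    tsupport (chartPartition n X x) ⊆ (chartAt (Fin n → ℂ) x).source := by
  have : IsManifold 𝓘(ℝ, Fin n → ℂ) ∞ X := isManifold_real
  exact (SmoothPartitionOfUnity.exists_isSubordinate_chartAt_source 𝓘(ℝ, Fin n → ℂ) X).choose_spec x

theorem finite_chartPartition :
    {x : X | (Function.support (chartPartition n X x)).Nonempty}.Finite :=
  (chartPartition n X).locallyFinite.finite_nonempty_of_compact

variable (n X) in
/-- The indices of the nonzero functions of the partition of unity. -/
def chartIndices : Finset X := (finite_chartPartition (n := n) (X := X)).toFinset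

theorem chartPartition_eq_zero {x : X} (hx : x ∉ chartIndices n X) (y : X) :
    chartPartition n X x y = 0 := by
  by_contra h
  exact hx ((Set.Finite.mem_toFinset _).2 (show (Function.support _).Nonempty from ⟨y, h⟩))

/-- The functions of the partition of unity in the charts. -/
def cut (n : ℕ) {X : Type*} [TopologicalSpace X] [ChartedSpace (Fin n → ℂ) X]
    [IsManifold 𝓘(ℂ, Fin n → ℂ) ω X] [CompactSpace X] [T2Space X] (x : X)
    (e : OpenPartialHomeomorph X (Fin n → ℂ)) (z : Fin n → ℂ) : ℂ :=
  ((chartPartition n X x (e.symm z) : ℝ) : ℂ)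

theorem isScalar_cut (x : X) : IsScalar (cut n x) := by
  have h : ContMDiff 𝓘(ℝ, Fin n → ℂ) 𝓘(ℝ, ℂ) ∞ fun y => ((chartPartition n X x y : ℝ) : ℂ) := by
    have h1 := (chartPartition n X x).contMDiff
    exact Complex.ofRealCLM.contDiff.contMDiff.comp h1
  exact isScalar_of_contMDiff h

theorem sum_cut (e : OpenPartialHomeomorph X (Fin n → ℂ)) (z : Fin n → ℂ) :
    ∑ x ∈ chartIndices n X, cut n x e z = 1 := by
  have h := (chartPartition n X).sum_eq_one (mem_univ (e.symm z))
  rw [finsum_eq_sum_of_support_subset (s := chartIndices n X)] at h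
  · simp only [cut, ← Complex.ofReal_sum, h, Complex.ofReal_one]
  · intro x hx
    by_contra hx'
    exact hx (chartPartition_eq_zero hx' _)

theorem integralTop_eq_sum (D : OpenPartialHomeomorph X (Fin n → ℂ) → (Fin n → ℂ) → ℂ) :
    integralTop D = ∑ x ∈ chartIndices n X, ∫ z in (chartAt (Fin n → ℂ) x).target,
      cut n x (chartAt (Fin n → ℂ) x) z * D (chartAt (Fin n → ℂ) x) z * 2 ^ n := by
  rw [integralTop, finsum_eq_sum_of_support_subset]
  · rfl
  · intro x hx
    by_contra hx'
    refine hx ?_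
    simp [chartPartition_eq_zero hx']

/-- The compact support of a function of the partition of unity, in its own chart. -/
def cutSupport (n : ℕ) {X : Type*} [TopologicalSpace X] [ChartedSpace (Fin n → ℂ) X]
    [IsManifold 𝓘(ℂ, Fin n → ℂ) ω X] [CompactSpace X] [T2Space X] (x : X) : Set (Fin n → ℂ) :=
  chartAt (Fin n → ℂ) x '' tsupport (chartPartition n X x)

theorem isCompact_cutSupport (x : X) : IsCompact (cutSupport n x) :=
  (isClosed_tsupport _).isCompact.image_of_continuousOn
    ((chartAt (Fin n → ℂ) x).continuousOn.mono (tsupport_chartPartition x))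

theorem cutSupport_subset (x : X) : cutSupport n x ⊆ (chartAt (Fin n → ℂ) x).target := by
  rintro _ ⟨y, hy, rfl⟩
  exact (chartAt (Fin n → ℂ) x).map_source (tsupport_chartPartition x hy)

theorem symm_notMem_tsupport {x : X} (hz : z ∈ (chartAt (Fin n → ℂ) x).target)
    (h : z ∉ cutSupport n x) :
    (chartAt (Fin n → ℂ) x).symm z ∉ tsupport (chartPartition n X x) := fun h' =>
  h ⟨_, h', (chartAt (Fin n → ℂ) x).right_inv hz⟩

theorem cut_eventually_eq_zero {x : X} (hz : z ∈ e.target)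
    (h : e.symm z ∉ tsupport (chartPartition n X x)) : cut n x e =ᶠ[𝓝 z] fun _ => 0 := by
  have h1 : ∀ᶠ y in 𝓝 (e.symm z), chartPartition n X x y = 0 :=
    notMem_tsupport_iff_eventuallyEq.1 h
  filter_upwards [(e.continuousAt_symm hz).eventually h1] with w hw
  rw [cut, hw, Complex.ofReal_zero]

theorem cut_eq_zero {x : X} (hz : z ∈ (chartAt (Fin n → ℂ) x).target) (h : z ∉ cutSupport n x) :
    cut n x (chartAt (Fin n → ℂ) x) z = 0 :=
  (cut_eventually_eq_zero hz (symm_notMem_tsupport hz h)).self_of_nhds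

theorem integrableOn_cut_mul (x : X) {f : (Fin n → ℂ) → ℂ}
    (hf : ContinuousOn f (chartAt (Fin n → ℂ) x).target) :
    IntegrableOn (fun z => cut n x (chartAt (Fin n → ℂ) x) z * f z)
      (chartAt (Fin n → ℂ) x).target :=
  integrableOn_of_support (chartAt (Fin n → ℂ) x).open_target (isCompact_cutSupport x)
    (cutSupport_subset x)
    ((((isScalar_cut x).smooth _ (chart_mem_atlas _ x)).continuousOn).mul hf)
    fun w hw hwK => by rw [cut_eq_zero hw hwK, zero_mul]

section Linearity

variable {D D' : OpenPartialHomeomorph X (Fin n → ℂ) → (Fin n → ℂ) → ℂ}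

theorem integralTop_congr (h : ∀ e ∈ atlas (Fin n → ℂ) X, ∀ z ∈ e.target, D e z = D' e z) :
    integralTop D = integralTop D' := by
  rw [integralTop_eq_sum, integralTop_eq_sum]
  refine Finset.sum_congr rfl fun x _ => setIntegral_congr_fun
    (chartAt (Fin n → ℂ) x).open_target.measurableSet fun z hz => ?_
  simp only [h _ (chart_mem_atlas _ x) z hz]

theorem integralTop_add (h : ∀ e ∈ atlas (Fin n → ℂ) X, ContinuousOn (D e) e.target)
    (h' : ∀ e ∈ atlas (Fin n → ℂ) X, ContinuousOn (D' e) e.target) :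
    integralTop (fun e z => D e z + D' e z) = integralTop D + integralTop D' := by
  simp only [integralTop_eq_sum, ← Finset.sum_add_distrib]
  refine Finset.sum_congr rfl fun x _ => ?_
  have i1 := (integrableOn_cut_mul x (h _ (chart_mem_atlas _ x))).mul_const ((2 : ℂ) ^ n)
  have i2 := (integrableOn_cut_mul x (h' _ (chart_mem_atlas _ x))).mul_const ((2 : ℂ) ^ n)
  rw [← integral_add i1 i2]
  congr 1
  funext z
  ring

theorem integralTop_const_mul (k : ℂ) (D : OpenPartialHomeomorph X (Fin n → ℂ) → (Fin n → ℂ) → ℂ) :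
    integralTop (fun e z => k * D e z) = k * integralTop D := by
  simp only [integralTop_eq_sum, Finset.mul_sum, ← integral_const_mul]
  refine Finset.sum_congr rfl fun x _ => ?_
  congr 1
  funext z
  ring

theorem integralTop_neg (D : OpenPartialHomeomorph X (Fin n → ℂ) → (Fin n → ℂ) → ℂ) :
    integralTop (fun e z => -D e z) = -integralTop D := by
  simpa using integralTop_const_mul (-1) D

theorem integralTop_sub (h : ∀ e ∈ atlas (Fin n → ℂ) X, ContinuousOn (D e) e.target)
    (h' : ∀ e ∈ atlas (Fin n → ℂ) X, ContinuousOn (D' e) e.target) :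
    integralTop (fun e z => D e z - D' e z) = integralTop D - integralTop D' := by
  simp only [sub_eq_add_neg]
  rw [integralTop_add (D' := fun e z => -D' e z) h fun e he => (h' e he).neg, integralTop_neg]

/-- The imaginary part of an integral. -/
theorem integralTop_im (h : ∀ e ∈ atlas (Fin n → ℂ) X, ContinuousOn (D e) e.target) :
    (integralTop D).im = (integralTop fun e z => ((D e z).im : ℂ)).re := by
  simp only [integralTop_eq_sum, Complex.im_sum, Complex.re_sum]
  refine Finset.sum_congr rfl fun x _ => ?_
  have i1 := (integrableOn_cut_mul x (h _ (chart_mem_atlas _ x))).mul_const ((2 : ℂ) ^ n)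
  have i2 := (integrableOn_cut_mul x (Complex.continuous_ofReal.comp_continuousOn
    (Complex.continuous_im.comp_continuousOn (h _ (chart_mem_atlas _ x))))).mul_const ((2 : ℂ) ^ n)
  have e1 := Complex.imCLM.integral_comp_comm i1
  have e2 := Complex.reCLM.integral_comp_comm i2
  simp only [Complex.imCLM_apply, Complex.reCLM_apply, Function.comp_apply] at e1 e2
  rw [← e1, ← e2]
  congr 1
  funext z
  have h2 : ((2 : ℂ) ^ n) = (((2 : ℝ) ^ n : ℝ) : ℂ) := by push_cast; rfl
  simp only [cut, h2, Complex.im_mul_ofReal, Complex.im_ofReal_mul, Complex.re_mul_ofReal,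
    Complex.ofReal_re]

/-- The integral of a nonnegative form is nonnegative. -/
theorem integralTop_re_nonneg (h : ∀ e ∈ atlas (Fin n → ℂ) X, ContinuousOn (D e) e.target)
    (h0 : ∀ e ∈ atlas (Fin n → ℂ) X, ∀ z ∈ e.target, 0 ≤ (D e z).re) :
    0 ≤ (integralTop D).re := by
  rw [integralTop_eq_sum, Complex.re_sum]
  refine Finset.sum_nonneg fun x _ => ?_
  have i1 := (integrableOn_cut_mul x (h _ (chart_mem_atlas _ x))).mul_const ((2 : ℂ) ^ n)
  have e1 := Complex.reCLM.integral_comp_comm i1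
  simp only [Complex.reCLM_apply] at e1
  rw [← e1]
  refine setIntegral_nonneg (chartAt (Fin n → ℂ) x).open_target.measurableSet fun z hz => ?_
  have h2 : ((2 : ℂ) ^ n) = (((2 : ℝ) ^ n : ℝ) : ℂ) := by push_cast; rfl
  simp only [cut, h2, Complex.re_mul_ofReal, Complex.re_ofReal_mul]
  have h3 := (chartPartition n X).nonneg x ((chartAt (Fin n → ℂ) x).symm z)
  have h4 := h0 _ (chart_mem_atlas _ x) z hz
  positivity

end Linearity

/-- Stokes' theorem on a compact complex manifold, for the divergence of `W`, a form of type
`(n-1,n)` (for `c = -i`) or `(n,n-1)` (for `c = i`). The tensorial nature of `W` enters through the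
hypothesis that `∂ρ ∧ W` is an `(n,n)`-form for the functions `ρ` of the partition of unity. -/
theorem integralTop_div_eq_zero {c : ℂ}
    {W : OpenPartialHomeomorph X (Fin n → ℂ) → Fin n → (Fin n → ℂ) → ℂ}
    (hW : ∀ e ∈ atlas (Fin n → ℂ) X, ∀ a, ContDiffOn ℝ ∞ (W e a) e.target)
    (hlaw : ∀ x : X, IsDensity fun e z => ∑ a, wd c a (cut n x e) z * W e a z) :
    integralTop (fun e z => ∑ a, wd c a (W e a) z) = 0 := by
  set Θ : X → OpenPartialHomeomorph X (Fin n → ℂ) → (Fin n → ℂ) → ℂ :=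
    fun x e z => ∑ a, wd c a (cut n x e) z * W e a z with hΘ
  have hΘc : ∀ x, ∀ e ∈ atlas (Fin n → ℂ) X, ContinuousOn (Θ x e) e.target := by
    intro x e he
    refine continuousOn_finsetSum _ fun a _ => ContinuousOn.mul ?_ (hW e he a).continuousOn
    exact (contDiffOn_wd e.open_target ((isScalar_cut x).smooth e he)).continuousOn
  have hΘ0 : ∀ x, ∀ e : OpenPartialHomeomorph X (Fin n → ℂ), ∀ z ∈ e.target,
      e.symm z ∉ tsupport (chartPartition n X x) → Θ x e z = 0 := by
    intro x e z hz h
    refine Finset.sum_eq_zero fun a _ => ?_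
    rw [wd_congr (cut_eventually_eq_zero hz h), wd_const, zero_mul]
  -- The integral in one chart, after integration by parts.
  have step1 : ∀ x : X, ∫ z in (chartAt (Fin n → ℂ) x).target,
      cut n x (chartAt (Fin n → ℂ) x) z * (∑ a, wd c a (W (chartAt (Fin n → ℂ) x) a) z) * 2 ^ n =
      -∫ z in (chartAt (Fin n → ℂ) x).target, Θ x (chartAt (Fin n → ℂ) x) z * 2 ^ n := by
    intro x
    set e := chartAt (Fin n → ℂ) x with he
    have hea : e ∈ atlas (Fin n → ℂ) X := chart_mem_atlas _ x
    have hs := (isScalar_cut (n := n) x).smooth e hea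
    have e1 : ∀ z ∈ e.target, cut n x e z * (∑ a, wd c a (W e a) z) * 2 ^ n =
        ∑ a, wd c a (fun w => cut n x e w * W e a w) z * 2 ^ n - Θ x e z * 2 ^ n := by
      intro z hz
      have h1 : ∀ a, wd c a (fun w => cut n x e w * W e a w) z =
          wd c a (cut n x e) z * W e a z + cut n x e z * wd c a (W e a) z := fun a =>
        wd_mul (diffAt_of_contDiffOn e.open_target hs hz)
          (diffAt_of_contDiffOn e.open_target (hW e hea a) hz)
      simp only [h1, hΘ, ← Finset.sum_mul, Finset.sum_add_distrib, ← Finset.mul_sum]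
      ring
    rw [setIntegral_congr_fun e.open_target.measurableSet e1]
    have hK : ∀ a, ∀ w ∈ e.target, w ∉ cutSupport n x → cut n x e w * W e a w = 0 :=
      fun a w hw hwK => by rw [cut_eq_zero hw hwK, zero_mul]
    have hI1 : ∀ a, IntegrableOn (fun z => wd c a (fun w => cut n x e w * W e a w) z * 2 ^ n)
        e.target := by
      intro a
      refine (integrableOn_of_support e.open_target (isCompact_cutSupport x) (cutSupport_subset x)
        (contDiffOn_wd e.open_target (hs.mul (hW e hea a))).continuousOn ?_).mul_const _
      intro w hw hwK
      have h1 : (fun w => cut n x e w * W e a w) =ᶠ[𝓝 w] fun _ => 0 := by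
        filter_upwards [cut_eventually_eq_zero hw (symm_notMem_tsupport hw hwK)] with y hy
        rw [hy, zero_mul]
      rw [wd_congr h1, wd_const]
    have hI2 : IntegrableOn (fun z => Θ x e z * 2 ^ n) e.target := by
      refine (integrableOn_of_support e.open_target (isCompact_cutSupport x) (cutSupport_subset x)
        (hΘc x e hea) ?_).mul_const _
      exact fun w hw hwK => hΘ0 x e w hw (symm_notMem_tsupport hw hwK)
    rw [integral_sub (integrable_finsetSum _ fun a _ => hI1 a) hI2,
      integral_finsetSum _ fun a _ => hI1 a]
    have h0 : ∀ a, ∫ z in e.target, wd c a (fun w => cut n x e w * W e a w) z * 2 ^ n = 0 := by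
      intro a
      rw [integral_mul_const, setIntegral_wd_eq_zero e.open_target (isCompact_cutSupport x)
        (hs.mul (hW e hea a)) (hK a) (cutSupport_subset x), zero_mul]
    simp only [h0, Finset.sum_const_zero, zero_sub]
  have hdens : ∀ x y : X, IsDensity fun e z => cut n y e z * Θ x e z := by
    intro x y e he e' he' z hz
    have h1 : Θ x e z = _ := hlaw x e he e' he' z hz
    simp only
    rw [h1, (isScalar_cut y).transform e he e' he' z hz]
    simp only [hΘ]
    ring
  -- The integrals of `ρ_y ∂ρ_x ∧ W` in the charts at `x` and at `y` agree.
  have step2 : ∀ x y : X, ∫ z in (chartAt (Fin n → ℂ) x).target,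
        cut n y (chartAt (Fin n → ℂ) x) z * Θ x (chartAt (Fin n → ℂ) x) z =
      ∫ z in (chartAt (Fin n → ℂ) y).target,
        cut n y (chartAt (Fin n → ℂ) y) z * Θ x (chartAt (Fin n → ℂ) y) z := by
    intro x y
    have h1 : ∀ e e' : OpenPartialHomeomorph X (Fin n → ℂ), ∀ F : (Fin n → ℂ) → ℂ,
        (∀ z ∈ e.target, e.symm z ∉ e'.source → F z = 0) →
        ∫ z in e.target, F z = ∫ z in overlap e e', F z := by
      intro e e' F hF
      refine setIntegral_eq_of_subset_of_forall_sdiff_eq_zero e.open_target.measurableSet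
        inter_subset_left fun z hz => hF z hz.1 fun h => hz.2 ⟨hz.1, h⟩
    rw [h1 _ (chartAt (Fin n → ℂ) y), h1 (chartAt (Fin n → ℂ) y) (chartAt (Fin n → ℂ) x)]
    · exact (hdens x y).setIntegral_overlap (chart_mem_atlas _ x) (chart_mem_atlas _ y)
    · intro z hz h
      rw [hΘ0 x _ z hz fun h' => h (tsupport_chartPartition x h'), mul_zero]
    · intro z hz h
      rw [(cut_eventually_eq_zero hz fun h' =>
        h (tsupport_chartPartition y h')).self_of_nhds, zero_mul]
  have step3 : ∀ x : X, ∫ z in (chartAt (Fin n → ℂ) x).target,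
      Θ x (chartAt (Fin n → ℂ) x) z * 2 ^ n = ∑ y ∈ chartIndices n X,
        (∫ z in (chartAt (Fin n → ℂ) y).target,
          cut n y (chartAt (Fin n → ℂ) y) z * Θ x (chartAt (Fin n → ℂ) y) z) * 2 ^ n := by
    intro x
    simp only [← step2, ← Finset.sum_mul]
    rw [integral_mul_const, ← integral_finsetSum]
    · congr 1
      refine setIntegral_congr_fun (chartAt (Fin n → ℂ) x).open_target.measurableSet fun z _ => ?_
      rw [← Finset.sum_mul, sum_cut, one_mul]
    · intro y _
      refine integrableOn_of_support (chartAt (Fin n → ℂ) x).open_target (isCompact_cutSupport x)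
        (cutSupport_subset x) (((isScalar_cut y).smooth _ (chart_mem_atlas _ x)).continuousOn.mul
          (hΘc x _ (chart_mem_atlas _ x))) fun w hw hwK => ?_
      rw [hΘ0 x _ w hw (symm_notMem_tsupport hw hwK), mul_zero]
  rw [integralTop_eq_sum, Finset.sum_congr rfl fun x _ => step1 x, Finset.sum_neg_distrib,
    neg_eq_zero, Finset.sum_congr rfl fun x _ => step3 x, Finset.sum_comm]
  refine Finset.sum_eq_zero fun y _ => ?_
  rw [← Finset.sum_mul, ← integral_finsetSum]
  · have h0 : ∀ z ∈ (chartAt (Fin n → ℂ) y).target, ∑ x ∈ chartIndices n X,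
        cut n y (chartAt (Fin n → ℂ) y) z * Θ x (chartAt (Fin n → ℂ) y) z = 0 := by
      intro z hz
      rw [← Finset.mul_sum]
      have h1 : ∑ x ∈ chartIndices n X, Θ x (chartAt (Fin n → ℂ) y) z = 0 := by
        simp only [hΘ]
        rw [Finset.sum_comm]
        refine Finset.sum_eq_zero fun a _ => ?_
        rw [← Finset.sum_mul, ← wd_sum _ fun x _ => diffAt_of_contDiffOn
          (chartAt (Fin n → ℂ) y).open_target
          ((isScalar_cut x).smooth _ (chart_mem_atlas _ y)) hz]
        simp only [sum_cut, wd_const, zero_mul]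
      rw [h1, mul_zero]
    rw [setIntegral_congr_fun (chartAt (Fin n → ℂ) y).open_target.measurableSet h0]
    simp
  · exact fun x _ => integrableOn_cut_mul y (hΘc x _ (chart_mem_atlas _ y))

end Integration

/-! ### Integral formulas on a compact Kähler manifold -/

section Formulas

variable {n : ℕ} {X : Type*} [TopologicalSpace X]
  [ChartedSpace (Fin n → ℂ) X] [IsManifold 𝓘(ℂ, Fin n → ℂ) ω X] [CompactSpace X] [T2Space X]
  {A g r : Coeff n X} {χ ψ v : OpenPartialHomeomorph X (Fin n → ℂ) → (Fin n → ℂ) → ℂ}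
  {e : OpenPartialHomeomorph X (Fin n → ℂ)}

theorem continuousOn_pairing (hA : ∀ e ∈ atlas (Fin n → ℂ) X, ∀ a b,
      ContDiffOn ℝ ∞ (fun z => A e z a b) e.target) (hχ : IsScalar χ) (hψ : IsScalar ψ)
    (he : e ∈ atlas (Fin n → ℂ) X) :
    ContinuousOn (fun z => pairing (A e z) (fun a => wd (-Complex.I) a (χ e) z)
      (fun b => wd Complex.I b (ψ e) z)) e.target :=
  continuousOn_finsetSum _ fun a _ => continuousOn_finsetSum _ fun b _ =>
    ((hA e he b a).continuousOn.mul
      (contDiffOn_wd e.open_target (hχ.smooth e he)).continuousOn).mul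
      (contDiffOn_wd e.open_target (hψ.smooth e he)).continuousOn

theorem continuousOn_trace_ddbar (hA : ∀ e ∈ atlas (Fin n → ℂ) X, ∀ a b,
      ContDiffOn ℝ ∞ (fun z => A e z a b) e.target) (hψ : IsScalar ψ)
    (he : e ∈ atlas (Fin n → ℂ) X) :
    ContinuousOn (fun z => (A e z * ddbar (ψ e) z).trace) e.target :=
  (contDiffOn_trace (contDiffOn_matrix_mul (hA e he)
    (contDiffOn_ddbar e.open_target (hψ.smooth e he)))).continuousOn

/-- `∫ χ A ∧ i∂∂̄ψ = -∫ A ∧ i∂χ ∧ ∂̄ψ` for a closed `(n-1,n-1)`-form `A`. -/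
theorem integralTop_mul_trace_ddbar (hA : IsClosedCoform A) (hχ : IsScalar χ) (hψ : IsScalar ψ) :
    integralTop (fun e z => χ e z * (A e z * ddbar (ψ e) z).trace) =
      -integralTop (fun e z => pairing (A e z) (fun a => wd (-Complex.I) a (χ e) z)
        (fun b => wd Complex.I b (ψ e) z)) := by
  have h := integralTop_div_eq_zero (n := n) (X := X) (c := -Complex.I)
    (W := fun e a z => χ e z * ∑ b, A e z b a * wd Complex.I b (ψ e) z)
    (fun e he a => (hχ.smooth e he).mul (ContDiffOn.sum fun b _ => (hA.smooth e he b a).mul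
      (contDiffOn_wd e.open_target (hψ.smooth e he))))
    (fun x => by
      have h1 := hA.pairing_transform (isScalar_cut (n := n) x) hψ
      intro e he e' he' z hz
      have h2 := h1 e he e' he' z hz
      have h3 : ∀ e : OpenPartialHomeomorph X (Fin n → ℂ), ∀ z,
          ∑ a, wd (-Complex.I) a (cut n x e) z *
            (χ e z * ∑ b, A e z b a * wd Complex.I b (ψ e) z) =
          χ e z * pairing (A e z) (fun a => wd (-Complex.I) a (cut n x e) z)
            (fun b => wd Complex.I b (ψ e) z) := by
        intro e z
        simp only [pairing, Finset.mul_sum]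
        exact Finset.sum_congr rfl fun a _ => Finset.sum_congr rfl fun b _ => by ring
      simp only [h3] at h2 ⊢
      rw [h2, hχ.transform e he e' he' z hz]
      ring)
  rw [integralTop_congr fun e he z hz => sum_dz_cofactor e.open_target (hA.smooth e he)
    (hA.div e he) (hχ.smooth e he) (hψ.smooth e he) hz,
    integralTop_add (fun e he => continuousOn_pairing hA.smooth hχ hψ he)
      (D' := fun e z => χ e z * (A e z * ddbar (ψ e) z).trace)
      (fun e he => (hχ.smooth e he).continuousOn.mul
        (continuousOn_trace_ddbar hA.smooth hψ he))] at h
  exact eq_neg_of_add_eq_zero_right h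

/-- The same integral, integrating `∂̄` by parts instead of `∂`. -/
theorem integralTop_mul_trace_ddbar' (hA : IsClosedCoform A) (hχ : IsScalar χ)
    (hψ : IsScalar ψ) :
    integralTop (fun e z => ψ e z * (A e z * ddbar (χ e) z).trace) =
      -integralTop (fun e z => pairing (A e z) (fun a => wd (-Complex.I) a (χ e) z)
        (fun b => wd Complex.I b (ψ e) z)) := by
  have h := integralTop_div_eq_zero (n := n) (X := X) (c := Complex.I)
    (W := fun e b z => ψ e z * ∑ a, A e z b a * wd (-Complex.I) a (χ e) z)
    (fun e he b => (hψ.smooth e he).mul (ContDiffOn.sum fun a _ => (hA.smooth e he b a).mul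
      (contDiffOn_wd e.open_target (hχ.smooth e he))))
    (fun x => by
      have h1 := hA.pairing_transform hχ (isScalar_cut (n := n) x)
      intro e he e' he' z hz
      have h2 := h1 e he e' he' z hz
      have h3 : ∀ e : OpenPartialHomeomorph X (Fin n → ℂ), ∀ z,
          ∑ b, wd Complex.I b (cut n x e) z *
            (ψ e z * ∑ a, A e z b a * wd (-Complex.I) a (χ e) z) =
          ψ e z * pairing (A e z) (fun a => wd (-Complex.I) a (χ e) z)
            (fun b => wd Complex.I b (cut n x e) z) := by
        intro e z
        simp only [pairing, Finset.mul_sum]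
        rw [Finset.sum_comm]
        exact Finset.sum_congr rfl fun a _ => Finset.sum_congr rfl fun b _ => by ring
      simp only [h3] at h2 ⊢
      rw [h2, hψ.transform e he e' he' z hz]
      ring)
  rw [integralTop_congr fun e he z hz => sum_dzbar_cofactor e.open_target (hA.smooth e he)
    (hA.div_bar e he) (hχ.smooth e he) (hψ.smooth e he) hz,
    integralTop_add (fun e he => continuousOn_pairing hA.smooth hχ hψ he)
      (D' := fun e z => ψ e z * (A e z * ddbar (χ e) z).trace)
      (fun e he => (hψ.smooth e he).continuousOn.mul
        (continuousOn_trace_ddbar hA.smooth hχ he))] at h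
  exact eq_neg_of_add_eq_zero_right h

/-- The operator `ψ ↦ A ∧ i∂∂̄ψ` is symmetric for a closed `(n-1,n-1)`-form `A`. -/
theorem integralTop_mul_trace_ddbar_comm (hA : IsClosedCoform A) (hχ : IsScalar χ)
    (hψ : IsScalar ψ) :
    integralTop (fun e z => χ e z * (A e z * ddbar (ψ e) z).trace) =
      integralTop (fun e z => ψ e z * (A e z * ddbar (χ e) z).trace) := by
  rw [integralTop_mul_trace_ddbar hA hχ hψ, integralTop_mul_trace_ddbar' hA hχ hψ]

theorem pairing_eq_dotProduct (A : Matrix (Fin n) (Fin n) ℂ) (α β : Fin n → ℂ) :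
    pairing A α β = dotProduct β (A.mulVec α) := by
  simp only [pairing, dotProduct, Matrix.mulVec, Finset.mul_sum]
  rw [Finset.sum_comm]
  exact Finset.sum_congr rfl fun a _ => Finset.sum_congr rfl fun b _ => by ring

section LocalBochner

variable {U : Set (Fin n → ℂ)} {z : Fin n → ℂ} {g : (Fin n → ℂ) → Matrix (Fin n) (Fin n) ℂ}
  {v : (Fin n → ℂ) → ℂ}

theorem det_mul_gradUpBar (hp : 0 < (g z).det) (b : Fin n) :
    (g z).det * gradUpBar g v b z = ∑ a, (g z).adjugate b a * wd (-Complex.I) a v z := by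
  rw [adjugate_eq_det_smul_inv hp.ne', gradUpBar, Finset.mul_sum]
  exact Finset.sum_congr rfl fun a _ => by
    rw [Matrix.smul_apply, smul_eq_mul, dz_eq_wd, mul_assoc]

theorem pairing_inv_mul_inv (r : Matrix (Fin n) (Fin n) ℂ) :
    pairing ((g z)⁻¹ * r * (g z)⁻¹) (fun a => wd (-Complex.I) a v z)
        (fun b => wd Complex.I b v z) =
      ∑ b, gradUpBar g v b z * ∑ a, r a b * gradUp g v a z := by
  have hY' : (fun b => gradUpBar g v b z) =
      (g z)⁻¹.mulVec fun a => wd (-Complex.I) a v z := by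
    funext b; simp [gradUpBar, Matrix.mulVec, dotProduct, dz_eq_wd]
  have hV' : (fun b => gradUp g v b z) =
      Matrix.vecMul (fun a => wd Complex.I a v z) (g z)⁻¹ := by
    funext b; simp [gradUp, Matrix.vecMul, dotProduct, dzbar_eq_wd, mul_comm]
  rw [pairing_eq_dotProduct, ← Matrix.mulVec_mulVec, ← hY', ← Matrix.mulVec_mulVec,
    Matrix.dotProduct_mulVec, ← hV']
  simp only [dotProduct, Matrix.mulVec, Finset.mul_sum]
  rw [Finset.sum_comm]
  exact Finset.sum_congr rfl fun a _ => Finset.sum_congr rfl fun b _ => by ring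

theorem pairing_adjugate_lap (hU : IsOpen U)
    (hg : ∀ i j, ContDiffOn ℝ ∞ (fun w => g w i j) U) (hp : ∀ w ∈ U, 0 < (g w).det)
    (hcl : ∀ w ∈ U, ∀ k i j, wd (-Complex.I) k (fun w => g w i j) w =
      wd (-Complex.I) i (fun w => g w k j) w)
    (hv : ContDiffOn ℝ ∞ v U) (hz : z ∈ U) :
    pairing (g z).adjugate (fun a => wd (-Complex.I) a v z)
        (fun b => wd Complex.I b (lap g v) z) =
      ∑ b, gradUpBar g v b z * (∑ a, wd (-Complex.I) a
        (fun w => (g w).det * wd Complex.I b (gradUp g v a) w) z) +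
      (g z).det * pairing ((g z)⁻¹ * ddbar (logDet g) z * (g z)⁻¹)
        (fun a => wd (-Complex.I) a v z) (fun b => wd Complex.I b v z) := by
  have h1 : pairing (g z).adjugate (fun a => wd (-Complex.I) a v z)
      (fun b => wd Complex.I b (lap g v) z) =
      ∑ b, gradUpBar g v b z * ((g z).det * wd Complex.I b (lap g v) z) := by
    simp only [pairing]
    rw [Finset.sum_comm]
    refine Finset.sum_congr rfl fun b _ => ?_
    rw [← Finset.sum_mul, ← det_mul_gradUpBar (hp z hz)]
    ring
  rw [h1, pairing_inv_mul_inv, Finset.mul_sum, ← Finset.sum_add_distrib]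
  refine Finset.sum_congr rfl fun b _ => ?_
  rw [det_mul_dzbar_lap hU hg hp hcl hv hz b]
  ring

theorem sum_dz_gradUpBar_mul (hU : IsOpen U)
    (hg : ∀ i j, ContDiffOn ℝ ∞ (fun w => g w i j) U) (hp : ∀ w ∈ U, 0 < (g w).det)
    (hv : ContDiffOn ℝ ∞ v U) (hz : z ∈ U) :
    ∑ a, wd (-Complex.I) a (fun z => ∑ b, gradUpBar g v b z *
        ((g z).det * wd Complex.I b (gradUp g v a) z)) z =
      (g z).det * (∑ a, ∑ b, wd (-Complex.I) a (gradUpBar g v b) z *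
        wd Complex.I b (gradUp g v a) z) +
      ∑ b, gradUpBar g v b z * ∑ a, wd (-Complex.I) a
        (fun w => (g w).det * wd Complex.I b (gradUp g v a) w) z := by
  have hDV : ∀ a b, ContDiffOn ℝ ∞ (fun w => (g w).det * wd Complex.I b (gradUp g v a) w) U :=
    fun a b => (contDiffOn_det hg).mul (contDiffOn_wd hU (contDiffOn_gradUp hU hg hp hv a))
  have d1 := fun b => diffAt_of_contDiffOn hU (contDiffOn_gradUpBar hU hg hp hv b) hz
  have d2 := fun a b => diffAt_of_contDiffOn hU (hDV a b) hz
  have h1 : ∀ a, wd (-Complex.I) a (fun z => ∑ b, gradUpBar g v b z *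
      ((g z).det * wd Complex.I b (gradUp g v a) z)) z =
      ∑ b, (wd (-Complex.I) a (gradUpBar g v b) z *
        ((g z).det * wd Complex.I b (gradUp g v a) z) +
        gradUpBar g v b z * wd (-Complex.I) a
          (fun w => (g w).det * wd Complex.I b (gradUp g v a) w) z) := by
    intro a
    rw [wd_sum _ fun b _ => (d1 b).fun_mul (d2 a b)]
    exact Finset.sum_congr rfl fun b _ => wd_mul (d1 b) (d2 a b)
  rw [Finset.sum_congr rfl fun a _ => h1 a]
  simp only [Finset.sum_add_distrib, Finset.mul_sum]
  refine congrArg₂ (· + ·) ?_ ?_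
  · exact Finset.sum_congr rfl fun a _ => Finset.sum_congr rfl fun b _ => by ring
  · exact Finset.sum_comm

end LocalBochner

section Kahler

theorem gradNormSq_eq_pairing (g : Matrix (Fin n) (Fin n) ℂ) (f : (Fin n → ℂ) → ℂ)
    (z : Fin n → ℂ) : gradNormSq g f z =
      pairing g⁻¹ (fun a => wd (-Complex.I) a f z) (fun b => wd Complex.I b f z) := by
  simp only [gradNormSq, pairing, dz_eq_wd, dzbar_eq_wd]

variable (hg : IsClosedForm g)
  (hp : ∀ e ∈ atlas (Fin n → ℂ) X, ∀ z ∈ e.target, 0 < (g e z).det)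

include hg hp in
/-- The Bochner formula in terms of `V = ∇^{1,0} v` and `Y = ∇^{0,1} v`:
`∫ (Δv)² ωⁿ = ∫ ∂ₐ Yᵇ ∂_b̄ Vᵃ ωⁿ + ∫ Ric (V, Y) ωⁿ`, where `-∂∂̄ log det g` is the Ricci form. -/
theorem integralTop_lap_sq (hv : IsScalar v) :
    integralTop (fun e z => lap (g e) (v e) z * ((g e z).adjugate * ddbar (v e) z).trace) =
      integralTop (fun e z => (g e z).det * ∑ a, ∑ b,
        wd (-Complex.I) a (gradUpBar (g e) (v e) b) z *
        wd Complex.I b (gradUp (g e) (v e) a) z) -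
      integralTop (fun e z => (g e z).det * pairing ((g e z)⁻¹ * ddbar (logDet (g e)) z * (g e z)⁻¹)
        (fun a => wd (-Complex.I) a (v e) z) (fun b => wd Complex.I b (v e) z)) := by
  have hA := hg.isClosedCoform_adjugate fun e he z hz => (hp e he z hz).ne'
  have hlap := IsScalar.lap hg hp hv
  have hV := fun e he => contDiffOn_gradUp e.open_target (hg.smooth e he) (hp e he)
    (hv.smooth e he)
  have hY := fun e he => contDiffOn_gradUpBar e.open_target (hg.smooth e he) (hp e he)
    (hv.smooth e he)
  have hD := fun e he => contDiffOn_det (hg.smooth e he)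
  have hR := hg.isClosedForm_logDet hp
  have hDV : ∀ e ∈ atlas (Fin n → ℂ) X, ∀ a b, ContDiffOn ℝ ∞
      (fun w => (g e w).det * wd Complex.I b (gradUp (g e) (v e) a) w) e.target := fun e he a b =>
    (hD e he).mul (contDiffOn_wd e.open_target (hV e he a))
  have hstokes := integralTop_div_eq_zero (n := n) (X := X) (c := -Complex.I)
    (W := fun e a z => ∑ b, gradUpBar (g e) (v e) b z *
      ((g e z).det * wd Complex.I b (gradUp (g e) (v e) a) z))
    (fun e he a => ContDiffOn.sum fun b _ => (hY e he b).mul (hDV e he a b))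
    (fun x => by
      intro e he e' he' z hz
      have h3 : ∀ e ∈ atlas (Fin n → ℂ) X, ∀ z ∈ e.target,
          ∑ a, wd (-Complex.I) a (cut n x e) z * ∑ b, gradUpBar (g e) (v e) b z *
            ((g e z).det * wd Complex.I b (gradUp (g e) (v e) a) z) =
          dotProduct (fun a => wd (-Complex.I) a (cut n x e) z)
            ((Matrix.of fun a b => wd Complex.I b (gradUp (g e) (v e) a) z).mulVec
              ((g e z).adjugate.mulVec fun a => wd (-Complex.I) a (v e) z)) := by
        intro e he z hz
        simp only [dotProduct, Matrix.mulVec, Matrix.of_apply,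
          ← det_mul_gradUpBar (hp e he z hz)]
        exact Finset.sum_congr rfl fun a _ => by
          congr 1
          exact Finset.sum_congr rfl fun b _ => by ring
      have hz' := (transition_mem_overlap hz).1
      simp only
      rw [h3 e he z hz.1, h3 e' he' _ hz', (isScalar_cut (n := n) x).dz_transform he he' hz,
        hv.dz_transform he he' hz]
      have h4 := hv.dzbar_gradUp_transform hg hp he he' hz
      have h5 := hA.transform e he e' he' z hz
      rw [Matrix.mulVec_transpose, ← Matrix.dotProduct_mulVec, Matrix.mulVec_mulVec, ← h4,
        Matrix.mulVec_mulVec, Matrix.mulVec_mulVec, Matrix.mul_assoc, Matrix.mul_assoc,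
        ← Matrix.mul_assoc ((jacobian e e' z).map star), h5, Matrix.mul_smul, Matrix.smul_mulVec,
        dotProduct_smul, smul_eq_mul, Matrix.mulVec_mulVec])
  have c1 : ∀ e ∈ atlas (Fin n → ℂ) X, ContinuousOn (fun z => (g e z).det *
      (∑ a, ∑ b, wd (-Complex.I) a (gradUpBar (g e) (v e) b) z *
        wd Complex.I b (gradUp (g e) (v e) a) z)) e.target := fun e he =>
    (hD e he).continuousOn.mul (continuousOn_finsetSum _ fun a _ => continuousOn_finsetSum _
      fun b _ => (contDiffOn_wd e.open_target (hY e he b)).continuousOn.mul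
        (contDiffOn_wd e.open_target (hV e he a)).continuousOn)
  have c2 : ∀ e ∈ atlas (Fin n → ℂ) X, ContinuousOn (fun z => ∑ b, gradUpBar (g e) (v e) b z *
      (∑ a, wd (-Complex.I) a
        (fun w => (g e w).det * wd Complex.I b (gradUp (g e) (v e) a) w) z)) e.target := fun e he =>
    continuousOn_finsetSum _ fun b _ => (hY e he b).continuousOn.mul (continuousOn_finsetSum _
      fun a _ => (contDiffOn_wd e.open_target (hDV e he a b)).continuousOn)
  have c3 : ∀ e ∈ atlas (Fin n → ℂ) X, ContinuousOn (fun z => (g e z).det *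
      pairing ((g e z)⁻¹ * ddbar (logDet (g e)) z * (g e z)⁻¹)
        (fun a => wd (-Complex.I) a (v e) z) (fun b => wd Complex.I b (v e) z)) e.target := by
    intro e he
    have hi := contDiffOn_matrix_inv (hg.smooth e he) fun w hw => (hp e he w hw).ne'
    exact (hD e he).continuousOn.mul (continuousOn_pairing (A := fun e z =>
      (g e z)⁻¹ * ddbar (logDet (g e)) z * (g e z)⁻¹) (fun e he => contDiffOn_matrix_mul
        (contDiffOn_matrix_mul (contDiffOn_matrix_inv (hg.smooth e he)
          fun w hw => (hp e he w hw).ne') (hR.smooth e he))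
        (contDiffOn_matrix_inv (hg.smooth e he) fun w hw => (hp e he w hw).ne')) hv hv he)
  rw [integralTop_congr fun e he z hz => sum_dz_gradUpBar_mul e.open_target (hg.smooth e he)
    (hp e he) (hv.smooth e he) hz, integralTop_add c1 c2] at hstokes
  have key := integralTop_mul_trace_ddbar' hA hv hlap
  rw [key, integralTop_congr fun e he z hz => pairing_adjugate_lap e.open_target (hg.smooth e he)
    (hp e he) (hg.closed e he) (hv.smooth e he) hz, integralTop_add c2 c3]
  linear_combination -hstokes

include hg hp in
/-- The convexity identity of Mabuchi for the scalar curvature part of the K-energy. -/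
theorem integralTop_lichNormSq (hherm : ∀ e ∈ atlas (Fin n → ℂ) X, ∀ z ∈ e.target,
      (g e z).IsHermitian) (hv : IsScalar v)
    (hreal : ∀ e ∈ atlas (Fin n → ℂ) X, ∀ z ∈ e.target, star (v e z) = v e z) :
    integralTop (fun e z => lichNormSq (g e) (v e) z * (g e z).det) =
      integralTop (fun e z => gradNormSq (g e z) (v e) z *
        ((g e z).adjugate * ddbar (logDet (g e)) z).trace) +
      integralTop (fun e z => v e z *
        (mixedCof (g e z) (ddbar (logDet (g e)) z) * ddbar (v e) z).trace) +
      integralTop (fun e z => v e z *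
        ((g e z).adjugate * ddbar (lap (g e) (v e)) z).trace) := by
  have hA := hg.isClosedCoform_adjugate fun e he z hz => (hp e he z hz).ne'
  have hlap := IsScalar.lap hg hp hv
  have hR := hg.isClosedForm_logDet hp
  have hK := hg.isClosedCoform_mixedCof (fun e he z hz => (hp e he z hz).ne') hR
  have hi := fun e he => contDiffOn_matrix_inv (hg.smooth e he) fun w hw => (hp e he w hw).ne'
  have h1 := integralTop_lap_sq hg hp hv
  have h2 : integralTop (fun e z => v e z * ((g e z).adjugate * ddbar (lap (g e) (v e)) z).trace) =
      integralTop (fun e z => lap (g e) (v e) z * ((g e z).adjugate * ddbar (v e) z).trace) :=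
    integralTop_mul_trace_ddbar_comm hA hv hlap
  have h3 := integralTop_mul_trace_ddbar hK hv hv
  have h4 : ∀ e ∈ atlas (Fin n → ℂ) X, ∀ z ∈ e.target,
      pairing (mixedCof (g e z) (ddbar (logDet (g e)) z)) (fun a => wd (-Complex.I) a (v e) z)
        (fun b => wd Complex.I b (v e) z) =
      gradNormSq (g e z) (v e) z * ((g e z).adjugate * ddbar (logDet (g e)) z).trace -
      (g e z).det * pairing ((g e z)⁻¹ * ddbar (logDet (g e)) z * (g e z)⁻¹)
        (fun a => wd (-Complex.I) a (v e) z) (fun b => wd Complex.I b (v e) z) := by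
    intro e he z hz
    rw [gradNormSq_eq_pairing, adjugate_eq_det_smul_inv (hp e he z hz).ne', Matrix.smul_mul,
      Matrix.trace_smul, smul_eq_mul]
    simp only [pairing, mixedCof, Matrix.smul_apply, Matrix.sub_apply, smul_eq_mul,
      Finset.mul_sum, Finset.sum_mul, ← Finset.sum_sub_distrib]
    exact Finset.sum_congr rfl fun a _ => Finset.sum_congr rfl fun b _ => by ring
  have c1 : ∀ e ∈ atlas (Fin n → ℂ) X, ContinuousOn (fun z => gradNormSq (g e z) (v e) z *
      ((g e z).adjugate * ddbar (logDet (g e)) z).trace) e.target := by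
    intro e he
    simp only [gradNormSq_eq_pairing]
    exact (continuousOn_pairing (A := fun e z => (g e z)⁻¹) hi hv hv he).mul
      (contDiffOn_trace (contDiffOn_matrix_mul (hA.smooth e he) (hR.smooth e he))).continuousOn
  have c3 : ∀ e ∈ atlas (Fin n → ℂ) X, ContinuousOn (fun z => (g e z).det *
      pairing ((g e z)⁻¹ * ddbar (logDet (g e)) z * (g e z)⁻¹)
        (fun a => wd (-Complex.I) a (v e) z) (fun b => wd Complex.I b (v e) z)) e.target :=
    fun e he => (contDiffOn_det (hg.smooth e he)).continuousOn.mul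
      (continuousOn_pairing (A := fun e z => (g e z)⁻¹ * ddbar (logDet (g e)) z * (g e z)⁻¹)
        (fun e he => contDiffOn_matrix_mul (contDiffOn_matrix_mul (hi e he) (hR.smooth e he))
          (hi e he)) hv hv he)
  rw [integralTop_congr h4, integralTop_sub c1 c3] at h3
  have h5 : integralTop (fun e z => lichNormSq (g e) (v e) z * (g e z).det) =
      integralTop (fun e z => (g e z).det * ∑ a, ∑ b,
        wd (-Complex.I) a (gradUpBar (g e) (v e) b) z *
        wd Complex.I b (gradUp (g e) (v e) a) z) := by
    refine integralTop_congr fun e he z hz => ?_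
    rw [lichNormSq_eq e.open_target (hg.smooth e he) (hp e he) (hherm e he) (hg.closed_bar e he)
      (hv.smooth e he) (hreal e he) hz, mul_comm]
  rw [h5, h2, h3]
  linear_combination -h1

end Kahler
end Formulas

/-! ### Integrals depending on parameters -/

section ParametricIntegral

variable {n : ℕ} {X : Type*} [TopologicalSpace X]
  [ChartedSpace (Fin n → ℂ) X] [IsManifold 𝓘(ℂ, Fin n → ℂ) ω X] [CompactSpace X] [T2Space X]

theorem continuousOn_integralTop {P : Type*} [TopologicalSpace P] [FirstCountableTopology P]
    {S : Set P}
    {D : P → OpenPartialHomeomorph X (Fin n → ℂ) → (Fin n → ℂ) → ℂ}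
    (hD : ∀ e ∈ atlas (Fin n → ℂ) X,
      ContinuousOn (fun q : P × (Fin n → ℂ) => D q.1 e q.2) (S ×ˢ e.target)) :
    ContinuousOn (fun t => integralTop (D t)) S := by
  simp only [integralTop_eq_sum]
  refine continuousOn_finsetSum _ fun x _ => ?_
  set e := chartAt (Fin n → ℂ) x
  have hea : e ∈ atlas (Fin n → ℂ) X := chart_mem_atlas _ x
  have h1 : ∀ t, ∫ z in e.target, cut n x e z * D t e z * 2 ^ n =
      ∫ z, e.target.indicator (fun z => cut n x e z * D t e z * 2 ^ n) z := fun t =>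
    (integral_indicator e.open_target.measurableSet).symm
  simp only [h1]
  have hcut := ((isScalar_cut (n := n) x).smooth e hea).continuousOn
  have hcont : ContinuousOn (fun q : P × (Fin n → ℂ) => cut n x e q.2 * D q.1 e q.2 * 2 ^ n)
      (S ×ˢ e.target) :=
    ((hcut.comp continuousOn_snd fun q hq => hq.2).mul (hD e hea)).mul continuousOn_const
  refine continuousOn_integral_of_compact_support (isCompact_cutSupport (n := n) x) ?_ ?_
  · rintro ⟨t, z⟩ ⟨ht, -⟩
    change ContinuousWithinAt (fun q : P × (Fin n → ℂ) =>
      e.target.indicator (fun z => cut n x e z * D q.1 e z * 2 ^ n) q.2) (S ×ˢ univ) (t, z)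
    by_cases hz : z ∈ e.target
    · have hnhds : (univ : Set P) ×ˢ e.target ∈ 𝓝 (t, z) :=
        prod_mem_nhds univ_mem (e.open_target.mem_nhds hz)
      have h2 : ContinuousWithinAt (fun q : P × (Fin n → ℂ) =>
          cut n x e q.2 * D q.1 e q.2 * 2 ^ n) (S ×ˢ univ) (t, z) := by
        refine (hcont (t, z) ⟨ht, hz⟩).mono_of_mem_nhdsWithin ?_
        filter_upwards [self_mem_nhdsWithin, mem_nhdsWithin_of_mem_nhds hnhds] with q hq hq'
        exact ⟨hq.1, hq'.2⟩
      refine h2.congr_of_eventuallyEq ?_ (by simp only [indicator_of_mem hz])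
      filter_upwards [mem_nhdsWithin_of_mem_nhds hnhds] with q hq
      exact indicator_of_mem hq.2 _
    · have h2 : (univ : Set P) ×ˢ (cutSupport n x)ᶜ ∈ 𝓝 (t, z) :=
        prod_mem_nhds univ_mem ((isCompact_cutSupport x).isClosed.isOpen_compl.mem_nhds
          fun h => hz (cutSupport_subset x h))
      refine (continuousWithinAt_const (b := (0 : ℂ))).congr_of_eventuallyEq ?_
        (by simp only [indicator_of_notMem hz])
      filter_upwards [mem_nhdsWithin_of_mem_nhds h2] with q hq
      by_cases hq' : q.2 ∈ e.target
      · rw [indicator_of_mem hq', cut_eq_zero hq' hq.2, zero_mul, zero_mul]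
      · exact indicator_of_notMem hq' _
  · intro t z _ hz
    by_cases hz' : z ∈ e.target
    · rw [indicator_of_mem hz', cut_eq_zero hz' hz, zero_mul, zero_mul]
    · exact indicator_of_notMem hz' _

/-- Differentiation under the integral over `X`. The support of the partition of unity provides the
compact sets on which the derivative is bounded. -/
theorem hasDerivAt_integralTop {I : Set ℝ} (hI : IsOpen I)
    {D D' : ℝ → OpenPartialHomeomorph X (Fin n → ℂ) → (Fin n → ℂ) → ℂ}
    (hD : ∀ e ∈ atlas (Fin n → ℂ) X, ∀ t ∈ I, ContinuousOn (D t e) e.target)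
    (hD' : ∀ e ∈ atlas (Fin n → ℂ) X,
      ContinuousOn (fun q : ℝ × (Fin n → ℂ) => D' q.1 e q.2) (I ×ˢ e.target))
    (hderiv : ∀ e ∈ atlas (Fin n → ℂ) X, ∀ t ∈ I, ∀ z ∈ e.target,
      HasDerivAt (fun s => D s e z) (D' t e z) t) {t : ℝ} (ht : t ∈ I) :
    HasDerivAt (fun s => integralTop (D s)) (integralTop (D' t)) t := by
  simp only [integralTop_eq_sum]
  refine HasDerivAt.fun_sum fun x _ => ?_
  set e := chartAt (Fin n → ℂ) x
  have hea : e ∈ atlas (Fin n → ℂ) X := chart_mem_atlas _ x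
  obtain ⟨δ, hδ, hball⟩ := Metric.nhds_basis_closedBall.mem_iff.1 (hI.mem_nhds ht)
  have hcut := ((isScalar_cut (n := n) x).smooth e hea).continuousOn
  have hK := isCompact_cutSupport (n := n) x
  have hKe : cutSupport n x ⊆ e.target := cutSupport_subset x
  have hcont : ContinuousOn (fun q : ℝ × (Fin n → ℂ) => cut n x e q.2 * D' q.1 e q.2 * 2 ^ n)
      (I ×ˢ e.target) :=
    ((hcut.comp continuousOn_snd fun q hq => hq.2).mul (hD' e hea)).mul continuousOn_const
  obtain ⟨C, hC⟩ := ((isCompact_closedBall t δ).prod hK).exists_bound_of_continuousOn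
    (hcont.mono (prod_mono hball hKe))
  have hslice : ∀ s ∈ I, ContinuousOn (fun z => D' s e z) e.target := fun s hs =>
    (hD' e hea).comp (f := fun z : Fin n → ℂ => (s, z)) (Continuous.prodMk_right s).continuousOn
      fun z hz => ⟨hs, hz⟩
  refine (hasDerivAt_integral_of_dominated_loc_of_deriv_le (𝕜 := ℝ)
    (F := fun s z => cut n x e z * D s e z * 2 ^ n)
    (F' := fun s z => cut n x e z * D' s e z * 2 ^ n) (s := Metric.closedBall t δ)
    (bound := (cutSupport n x).indicator fun _ => C) (Metric.closedBall_mem_nhds t hδ)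
    ?_ ?_ ?_ ?_ ?_ ?_).2
  · filter_upwards [hI.mem_nhds ht] with s hs
    exact ((hcut.mul (hD e hea s hs)).mul continuousOn_const).aestronglyMeasurable
      e.open_target.measurableSet
  · exact (integrableOn_cut_mul x (hD e hea t ht)).mul_const _
  · exact ((hcut.mul (hslice t ht)).mul continuousOn_const).aestronglyMeasurable
      e.open_target.measurableSet
  · refine ae_restrict_of_forall_mem e.open_target.measurableSet fun z hz s hs => ?_
    by_cases hzK : z ∈ cutSupport n x
    · rw [indicator_of_mem hzK]
      exact hC (s, z) ⟨hs, hzK⟩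
    · rw [indicator_of_notMem hzK, cut_eq_zero hz hzK, zero_mul, zero_mul, norm_zero]
  · refine Integrable.integrableOn ?_
    rw [integrable_indicator_iff hK.isClosed.measurableSet]
    exact integrableOn_const hK.measure_lt_top.ne
  · refine ae_restrict_of_forall_mem e.open_target.measurableSet fun z hz s hs => ?_
    exact ((hderiv e hea s (hball hs) z hz).const_mul _).mul_const _

end ParametricIntegral

section IntervalIntegral

/-- Continuity of an integral over `[0, 1]` in a parameter. -/
theorem continuousOn_integral_zero_one {T : Set ℝ} {F : ℝ → ℝ → ℝ}
    (hF : ContinuousOn (fun p : ℝ × ℝ => F p.1 p.2) (Icc 0 1 ×ˢ T)) :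
    ContinuousOn (fun t => ∫ s in (0 : ℝ)..1, F s t) T := by
  rw [continuousOn_iff_continuous_domRestrict]
  have h1 : Continuous fun p : T × ℝ => F (projIcc (0 : ℝ) 1 zero_le_one p.2) p.1 := by
    refine hF.comp_continuous (f := fun p : T × ℝ =>
      (((projIcc (0 : ℝ) 1 zero_le_one p.2 : Icc (0 : ℝ) 1) : ℝ), (p.1 : ℝ))) ?_ ?_
    · exact (continuous_subtype_val.comp (continuous_projIcc.comp continuous_snd)).prodMk
        (continuous_subtype_val.comp continuous_fst)
    · intro p
      exact ⟨(projIcc (0 : ℝ) 1 zero_le_one p.2).2, p.1.2⟩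
  have h2 := intervalIntegral.continuous_parametric_intervalIntegral_of_continuous'
    (f := fun (t : T) (s : ℝ) => F (projIcc (0 : ℝ) 1 zero_le_one s) t) (μ := volume) h1 0 1
  refine h2.congr fun t => ?_
  simp only [domRestrict_apply]
  refine intervalIntegral.integral_congr fun s hs => ?_
  rw [uIcc_of_le zero_le_one] at hs
  simp only [projIcc_of_mem zero_le_one hs]

/-- Differentiation of an integral over `[0, 1]` in a parameter. -/
theorem hasDerivAt_integral_zero_one {I : Set ℝ} (hI : IsOpen I) {F F' : ℝ → ℝ → ℝ}
    (hF : ContinuousOn (fun p : ℝ × ℝ => F p.1 p.2) (Icc 0 1 ×ˢ I))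
    (hF' : ContinuousOn (fun p : ℝ × ℝ => F' p.1 p.2) (Icc 0 1 ×ˢ I))
    (hderiv : ∀ s ∈ Icc (0 : ℝ) 1, ∀ t ∈ I, HasDerivAt (fun t => F s t) (F' s t) t)
    {t : ℝ} (ht : t ∈ I) :
    HasDerivAt (fun t => ∫ s in (0 : ℝ)..1, F s t) (∫ s in (0 : ℝ)..1, F' s t) t := by
  obtain ⟨δ, hδ, hball⟩ := Metric.nhds_basis_closedBall.mem_iff.1 (hI.mem_nhds ht)
  obtain ⟨C, hC⟩ := (isCompact_Icc.prod (isCompact_closedBall t δ)).exists_bound_of_continuousOn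
    (hF'.mono (prod_mono le_rfl hball))
  have hu : Set.uIoc (0 : ℝ) 1 ⊆ Icc 0 1 := by
    rw [uIoc_of_le zero_le_one]; exact Ioc_subset_Icc_self
  have hs : ∀ {F : ℝ → ℝ → ℝ}, ContinuousOn (fun p : ℝ × ℝ => F p.1 p.2) (Icc 0 1 ×ˢ I) →
      ∀ t ∈ I, ContinuousOn (fun s => F s t) (Icc 0 1) := fun hF t ht =>
    hF.comp (f := fun s : ℝ => (s, t)) (Continuous.prodMk_left t).continuousOn fun s hs => ⟨hs, ht⟩
  refine (intervalIntegral.hasDerivAt_integral_of_dominated_loc_of_deriv_le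
    (F := fun t s => F s t) (F' := fun t s => F' s t) (bound := fun _ => C)
    (Metric.closedBall_mem_nhds t hδ) ?_ ?_ ?_ ?_ ?_ ?_).2
  · filter_upwards [hI.mem_nhds ht] with t' ht'
    exact ((hs hF t' ht').mono hu).aestronglyMeasurable measurableSet_uIoc
  · refine ContinuousOn.intervalIntegrable ?_
    rw [uIcc_of_le zero_le_one]
    exact hs hF t ht
  · exact ((hs hF' t ht).mono hu).aestronglyMeasurable measurableSet_uIoc
  · exact Eventually.of_forall fun s hs' t' ht' => hC (s, t') ⟨hu hs', ht'⟩
  · exact intervalIntegrable_const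
  · exact Eventually.of_forall fun s hs' t' ht' => hderiv s (hu hs') t' (hball ht')

end IntervalIntegral

/-! ### The energy density and its variation -/

section Local

variable {n : ℕ} {P : Type*} [NormedAddCommGroup P] [NormedSpace ℝ P] {S : Set P}
  {U : Set (Fin n → ℂ)} {z : Fin n → ℂ}

theorem contDiffOn_ddbar_param (hU : IsOpen U) {F : P → (Fin n → ℂ) → ℂ}
    (hF : ContDiffOn ℝ ∞ (fun q : P × (Fin n → ℂ) => F q.1 q.2) (S ×ˢ U)) (a b : Fin n) :
    ContDiffOn ℝ ∞ (fun q : P × (Fin n → ℂ) => ddbar (F q.1) q.2 a b) (S ×ˢ U) := by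
  simp only [ddbar_apply_eq]
  exact contDiffOn_wd_param (F := fun p => wd Complex.I b (F p)) hU (contDiffOn_wd_param hU hF)

theorem hasDerivAt_ddbar_param {I : Set ℝ} (hI : IsOpen I) (hU : IsOpen U)
    {F F' : ℝ → (Fin n → ℂ) → ℂ}
    (hF : ContDiffOn ℝ ∞ (fun q : ℝ × (Fin n → ℂ) => F q.1 q.2) (I ×ˢ U))
    (hF' : ∀ t ∈ I, ∀ w ∈ U, HasDerivAt (fun s => F s w) (F' t w) t)
    {t : ℝ} (ht : t ∈ I) (hz : z ∈ U) (a b : Fin n) :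
    HasDerivAt (fun s => ddbar (F s) z a b) (ddbar (F' t) z a b) t := by
  simp only [ddbar_apply_eq]
  exact hasDerivAt_wd_param (F := fun s => wd Complex.I b (F s)) hI hU (contDiffOn_wd_param hU hF)
    (fun t ht w hw => hasDerivAt_wd_param hI hU hF hF' ht hw) ht hz

theorem ContDiffOn.ofReal_im {E : Type*} [NormedAddCommGroup E] [NormedSpace ℝ E] {s : Set E}
    {f : E → ℂ} (hf : ContDiffOn ℝ ∞ f s) : ContDiffOn ℝ ∞ (fun q => ((f q).im : ℂ)) s :=
  Complex.ofRealCLM.contDiff.comp_contDiffOn (Complex.imCLM.contDiff.comp_contDiffOn hf)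

theorem ContDiffOn.ofReal_re {E : Type*} [NormedAddCommGroup E] [NormedSpace ℝ E] {s : Set E}
    {f : E → ℂ} (hf : ContDiffOn ℝ ∞ f s) : ContDiffOn ℝ ∞ (fun q => ((f q).re : ℂ)) s :=
  Complex.ofRealCLM.contDiff.comp_contDiffOn (Complex.reCLM.contDiff.comp_contDiffOn hf)

theorem hasDerivAt_ofReal_im {f : ℝ → ℂ} {f' : ℂ} {t : ℝ} (hf : HasDerivAt f f' t) :
    HasDerivAt (fun s => ((f s).im : ℂ)) ((f'.im : ℝ) : ℂ) t :=
  (Complex.ofRealCLM.hasFDerivAt.comp_hasDerivAt t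
    (Complex.imCLM.hasFDerivAt.comp_hasDerivAt t hf))

theorem hasDerivAt_trace {M : ℝ → Matrix (Fin n) (Fin n) ℂ} {M' : Matrix (Fin n) (Fin n) ℂ}
    {t : ℝ} (h : ∀ i j, HasDerivAt (fun s => M s i j) (M' i j) t) :
    HasDerivAt (fun s => (M s).trace) M'.trace t :=
  HasDerivAt.fun_sum fun i _ => h i i

theorem hasDerivAt_matrix_mul {M N : ℝ → Matrix (Fin n) (Fin n) ℂ}
    {M' N' : Matrix (Fin n) (Fin n) ℂ} {t : ℝ}
    (hM : ∀ i j, HasDerivAt (fun s => M s i j) (M' i j) t)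
    (hN : ∀ i j, HasDerivAt (fun s => N s i j) (N' i j) t) (i j : Fin n) :
    HasDerivAt (fun s => (M s * N s) i j) ((M' * N t + M t * N') i j) t := by
  simp only [Matrix.mul_apply, Matrix.add_apply, ← Finset.sum_add_distrib]
  exact HasDerivAt.fun_sum fun k _ => (hM i k).mul (hN k j)

/-- The derivative of `tr (adj G · R)`, which is up to a factor the top form `ρ ∧ ωⁿ⁻¹`. -/
theorem hasDerivAt_trace_adjugate_mul {G R : ℝ → Matrix (Fin n) (Fin n) ℂ}
    {G' R' : Matrix (Fin n) (Fin n) ℂ} {t : ℝ}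
    (hG : ∀ i j, HasDerivAt (fun s => G s i j) (G' i j) t)
    (hR : ∀ i j, HasDerivAt (fun s => R s i j) (R' i j) t)
    (h0 : ∀ᶠ s in 𝓝 t, (G s).det ≠ 0) :
    HasDerivAt (fun s => ((G s).adjugate * R s).trace)
      ((mixedCof (G t) (R t) * G').trace + ((G t).adjugate * R').trace) t := by
  have h0t := h0.self_of_nhds
  have h1 : HasDerivAt (fun s => (G s).det * ((G s)⁻¹ * R s).trace) _ t :=
    (hasDerivAt_det hG).mul
      (hasDerivAt_trace (hasDerivAt_matrix_mul (hasDerivAt_matrix_inv hG h0t) hR))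
  refine (h1.congr_of_eventuallyEq ?_).congr_deriv ?_
  · filter_upwards [h0] with s hs
    rw [adjugate_eq_det_smul_inv hs, Matrix.smul_mul, Matrix.trace_smul, smul_eq_mul]
  · have h2 : ((G t)⁻¹ * R t * (G t)⁻¹ * G').trace = ((G t)⁻¹ * G' * (G t)⁻¹ * R t).trace := by
      rw [Matrix.mul_assoc ((G t)⁻¹ * R t), Matrix.trace_mul_comm, ← Matrix.mul_assoc]
    rw [adjugate_eq_det_smul_inv h0t, mixedCof]
    simp only [Matrix.smul_mul, Matrix.trace_smul, smul_eq_mul, Matrix.sub_mul, Matrix.trace_sub,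
      Matrix.trace_add, Matrix.neg_mul, Matrix.trace_neg, h2]
    ring

end Local

section EnergyDensity

variable {n : ℕ} {X : Type*} [TopologicalSpace X]

/-- The density of `(γ (B + iω)ⁿ - (s(ω) - c) ωⁿ) / n!` in the chart `e`, for the forms `B` and `ω`
with complex potential `φ`. The scalar curvature is written as the trace of the Ricci form, so that
`-s(ω) det g = tr (adj g · ∂∂̄ log det g)`. -/
def energyDensity (γ : ℂ) (c : ℝ) (b₀ g₀ : Coeff n X) (φ : X → ℂ)
    (e : OpenPartialHomeomorph X (Fin n → ℂ)) (z : Fin n → ℂ) : ℂ :=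
  γ * (addPotential (complexify b₀ g₀) φ e z).det +
    ((addPotential g₀ (imPart φ) e z).adjugate *
      ddbar (logDet (addPotential g₀ (imPart φ) e)) z).trace +
    c * (addPotential g₀ (imPart φ) e z).det

/-- The variation of `energyDensity` at the potential `φ` in the direction `ψ`. -/
def energyDensityVar (γ : ℂ) (c : ℝ) (b₀ g₀ : Coeff n X) (φ ψ : X → ℂ)
    (e : OpenPartialHomeomorph X (Fin n → ℂ)) (z : Fin n → ℂ) : ℂ :=
  γ * ((addPotential (complexify b₀ g₀) φ e z).adjugate *
      ddbar (fun w => ψ (e.symm w)) z).trace +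
    ((mixedCof (addPotential g₀ (imPart φ) e z)
        (ddbar (logDet (addPotential g₀ (imPart φ) e)) z) *
        ddbar (fun w => imPart ψ (e.symm w)) z).trace +
      ((addPotential g₀ (imPart φ) e z).adjugate *
        ddbar (lap (addPotential g₀ (imPart φ) e) fun w => imPart ψ (e.symm w)) z).trace) +
    c * ((addPotential g₀ (imPart φ) e z).adjugate *
      ddbar (fun w => imPart ψ (e.symm w)) z).trace

variable {P : Type*} [NormedAddCommGroup P] [NormedSpace ℝ P] {S : Set P}
  {e : OpenPartialHomeomorph X (Fin n → ℂ)} {h b₀ g₀ : Coeff n X} {γ : ℂ} {c : ℝ}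
  {Φ Ψ : P → X → ℂ} {z : Fin n → ℂ}

/-- In the chart `e`, the functions `Φ p`, `p ∈ S`, depend smoothly on the parameter and the
point. -/
def SmoothFamilyIn (e : OpenPartialHomeomorph X (Fin n → ℂ)) (S : Set P) (Φ : P → X → ℂ) : Prop :=
  ContDiffOn ℝ ∞ (fun q : P × (Fin n → ℂ) => Φ q.1 (e.symm q.2)) (S ×ˢ e.target)

theorem SmoothFamilyIn.imPart (h : SmoothFamilyIn e S Φ) :
    SmoothFamilyIn e S fun p => imPart (Φ p) := ContDiffOn.ofReal_im h

theorem contDiffOn_addPotential (hh : ∀ a b, ContDiffOn ℝ ∞ (fun z => h e z a b) e.target)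
    (hΦ : SmoothFamilyIn e S Φ) (a b : Fin n) :
    ContDiffOn ℝ ∞ (fun q : P × (Fin n → ℂ) => addPotential h (Φ q.1) e q.2 a b)
      (S ×ˢ e.target) :=
  ((hh a b).comp contDiffOn_snd fun _ hq => hq.2).add
    (contDiffOn_ddbar_param (F := fun p w => Φ p (e.symm w)) e.open_target hΦ a b)

theorem hasDerivAt_addPotential {I : Set ℝ} (hI : IsOpen I) {Φ Φ' : ℝ → X → ℂ}
    (hΦ : SmoothFamilyIn e I Φ) (hd : ∀ t ∈ I, ∀ x, HasDerivAt (fun s => Φ s x) (Φ' t x) t)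
    {t : ℝ} (ht : t ∈ I) (hz : z ∈ e.target) (a b : Fin n) :
    HasDerivAt (fun s => addPotential h (Φ s) e z a b)
      (ddbar (fun w => Φ' t (e.symm w)) z a b) t :=
  (hasDerivAt_ddbar_param hI e.open_target (F := fun s w => Φ s (e.symm w)) hΦ
    (F' := fun s w => Φ' s (e.symm w)) (fun t ht _ _ => hd t ht _) ht hz a b).const_add _

variable (hh₀ : ∀ a b, ContDiffOn ℝ ∞ (fun z => complexify b₀ g₀ e z a b) e.target)
  (hg₀ : ∀ a b, ContDiffOn ℝ ∞ (fun z => g₀ e z a b) e.target)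

include hg₀ in
theorem contDiffOn_logDet_addPotential (hΦ : SmoothFamilyIn e S Φ)
    (hp : ∀ p ∈ S, ∀ z ∈ e.target, 0 < (addPotential g₀ (imPart (Φ p)) e z).det) :
    ContDiffOn ℝ ∞ (fun q : P × (Fin n → ℂ) => logDet (addPotential g₀ (imPart (Φ q.1)) e) q.2)
      (S ×ˢ e.target) :=
  contDiffOn_logDet (M := fun q : P × (Fin n → ℂ) => addPotential g₀ (imPart (Φ q.1)) e q.2)
    (contDiffOn_addPotential (Φ := fun p => imPart (Φ p)) hg₀ hΦ.imPart)
    fun q hq => hp q.1 hq.1 q.2 hq.2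

include hg₀ in
theorem contDiffOn_ddbar_logDet_addPotential (hΦ : SmoothFamilyIn e S Φ)
    (hp : ∀ p ∈ S, ∀ z ∈ e.target, 0 < (addPotential g₀ (imPart (Φ p)) e z).det) (a b : Fin n) :
    ContDiffOn ℝ ∞ (fun q : P × (Fin n → ℂ) =>
      ddbar (logDet (addPotential g₀ (imPart (Φ q.1)) e)) q.2 a b) (S ×ˢ e.target) :=
  contDiffOn_ddbar_param (F := fun p => logDet (addPotential g₀ (imPart (Φ p)) e)) e.open_target
    (contDiffOn_logDet_addPotential hg₀ hΦ hp) a b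

include hh₀ hg₀ in
theorem contDiffOn_energyDensity (hΦ : SmoothFamilyIn e S Φ)
    (hp : ∀ p ∈ S, ∀ z ∈ e.target, 0 < (addPotential g₀ (imPart (Φ p)) e z).det) :
    ContDiffOn ℝ ∞ (fun q : P × (Fin n → ℂ) => energyDensity γ c b₀ g₀ (Φ q.1) e q.2)
      (S ×ˢ e.target) := by
  have hG := contDiffOn_addPotential (Φ := fun p => imPart (Φ p)) hg₀ hΦ.imPart
  have hH := contDiffOn_addPotential hh₀ hΦ
  exact ((contDiffOn_const.mul (contDiffOn_det hH)).add (contDiffOn_trace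
    (contDiffOn_matrix_mul (contDiffOn_adjugate hG)
      (contDiffOn_ddbar_logDet_addPotential hg₀ hΦ hp)))).add
    (contDiffOn_const.mul (contDiffOn_det hG))

theorem contDiffOn_matrix_smul {E : Type*} [NormedAddCommGroup E] [NormedSpace ℝ E] {s : Set E}
    {f : E → ℂ} {M : E → Matrix (Fin n) (Fin n) ℂ} (hf : ContDiffOn ℝ ∞ f s)
    (hM : ∀ i j, ContDiffOn ℝ ∞ (fun w => M w i j) s) (i j : Fin n) :
    ContDiffOn ℝ ∞ (fun w => (f w • M w) i j) s := hf.mul (hM i j)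

theorem contDiffOn_mixedCof {E : Type*} [NormedAddCommGroup E] [NormedSpace ℝ E] {s : Set E}
    {M N : E → Matrix (Fin n) (Fin n) ℂ} (hM : ∀ i j, ContDiffOn ℝ ∞ (fun w => M w i j) s)
    (hN : ∀ i j, ContDiffOn ℝ ∞ (fun w => N w i j) s) (h0 : ∀ w ∈ s, (M w).det ≠ 0)
    (i j : Fin n) : ContDiffOn ℝ ∞ (fun w => mixedCof (M w) (N w) i j) s := by
  have hi := contDiffOn_matrix_inv hM h0
  have h1 := contDiffOn_matrix_mul hi hN
  exact (contDiffOn_det hM).mul ((contDiffOn_matrix_smul (contDiffOn_trace h1) hi i j).sub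
    (contDiffOn_matrix_mul h1 hi i j))

include hh₀ hg₀ in
theorem contDiffOn_energyDensityVar (hΦ : SmoothFamilyIn e S Φ) (hΨ : SmoothFamilyIn e S Ψ)
    (hp : ∀ p ∈ S, ∀ z ∈ e.target, 0 < (addPotential g₀ (imPart (Φ p)) e z).det) :
    ContDiffOn ℝ ∞ (fun q : P × (Fin n → ℂ) => energyDensityVar γ c b₀ g₀ (Φ q.1) (Ψ q.1) e q.2)
      (S ×ˢ e.target) := by
  have hG := contDiffOn_addPotential (Φ := fun p => imPart (Φ p)) hg₀ hΦ.imPart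
  have hH := contDiffOn_addPotential hh₀ hΦ
  have h0 : ∀ q ∈ S ×ˢ e.target, (addPotential g₀ (imPart (Φ q.1)) e q.2).det ≠ 0 :=
    fun q hq => (hp q.1 hq.1 q.2 hq.2).ne'
  have hv := contDiffOn_ddbar_param (F := fun p w => imPart (Ψ p) (e.symm w)) e.open_target
    hΨ.imPart
  have hw := contDiffOn_ddbar_param (F := fun p w => Ψ p (e.symm w)) e.open_target hΨ
  have hlap := contDiffOn_ddbar_param
    (F := fun p => lap (addPotential g₀ (imPart (Φ p)) e) fun w => imPart (Ψ p) (e.symm w))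
    e.open_target
    (contDiffOn_trace (contDiffOn_matrix_mul (contDiffOn_matrix_inv hG h0) hv))
  have hadj := contDiffOn_adjugate hG
  exact ((contDiffOn_const.mul (contDiffOn_trace (contDiffOn_matrix_mul (contDiffOn_adjugate hH)
    hw))).add ((contDiffOn_trace (contDiffOn_matrix_mul (contDiffOn_mixedCof hG
      (contDiffOn_ddbar_logDet_addPotential hg₀ hΦ hp) h0) hv)).add
    (contDiffOn_trace (contDiffOn_matrix_mul hadj hlap)))).add
    (contDiffOn_const.mul (contDiffOn_trace (contDiffOn_matrix_mul hadj hv)))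

include hg₀ in
/-- The term with `lap` comes from the Ricci form: the variation of `log det g` is the Laplacian of
the imaginary part of the velocity. -/
theorem hasDerivAt_energyDensity {I : Set ℝ} (hI : IsOpen I) {Φ Φ' : ℝ → X → ℂ}
    (hΦ : SmoothFamilyIn e I Φ) (hd : ∀ t ∈ I, ∀ x, HasDerivAt (fun s => Φ s x) (Φ' t x) t)
    (hp : ∀ t ∈ I, ∀ z ∈ e.target, 0 < (addPotential g₀ (imPart (Φ t)) e z).det)
    {t : ℝ} (ht : t ∈ I) (hz : z ∈ e.target) :
    HasDerivAt (fun s => energyDensity γ c b₀ g₀ (Φ s) e z)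
      (energyDensityVar γ c b₀ g₀ (Φ t) (Φ' t) e z) t := by
  have hG : ∀ t ∈ I, ∀ z ∈ e.target, ∀ a b,
      HasDerivAt (fun s => addPotential g₀ (imPart (Φ s)) e z a b)
        (ddbar (fun w => imPart (Φ' t) (e.symm w)) z a b) t := fun t ht z hz a b =>
    hasDerivAt_addPotential (Φ := fun s => imPart (Φ s)) (Φ' := fun s => imPart (Φ' s)) hI
      hΦ.imPart (fun t ht x => hasDerivAt_ofReal_im (hd t ht x)) ht hz a b
  have hL : ∀ t ∈ I, ∀ z ∈ e.target,
      HasDerivAt (fun s => logDet (addPotential g₀ (imPart (Φ s)) e) z)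
        (lap (addPotential g₀ (imPart (Φ t)) e) (fun w => imPart (Φ' t) (e.symm w)) z) t := by
    intro t ht z hz
    have hpos := hp t ht z hz
    have h1 := (hasDerivAt_det (hG t ht z hz)).clog_real
      (Or.inl (Complex.pos_iff.1 hpos).1)
    refine (h1.congr_of_eventuallyEq ?_).congr_deriv ?_
    · filter_upwards [hI.mem_nhds ht] with s hs
      exact logDet_eq_log (hp s hs z hz)
    · rw [adjugate_eq_det_smul_inv hpos.ne', Matrix.smul_mul, Matrix.trace_smul, smul_eq_mul,
        mul_div_cancel_left₀ _ hpos.ne']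
      rfl
  have hR := hasDerivAt_ddbar_param hI e.open_target
    (F := fun s => logDet (addPotential g₀ (imPart (Φ s)) e))
    (contDiffOn_logDet_addPotential hg₀ hΦ hp)
    hL ht hz
  refine ((((hasDerivAt_det (hasDerivAt_addPotential hI hΦ hd ht hz)).const_mul γ).add
    (hasDerivAt_trace_adjugate_mul (hG t ht z hz) hR ?_)).add
    ((hasDerivAt_det (hG t ht z hz)).const_mul (c : ℂ)))
  filter_upwards [hI.mem_nhds ht] with s hs
  exact (hp s hs z hz).ne'

end EnergyDensity

section EnergyIntegral

variable {n : ℕ} {X : Type*} [TopologicalSpace X]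
  [ChartedSpace (Fin n → ℂ) X] [IsManifold 𝓘(ℂ, Fin n → ℂ) ω X] [CompactSpace X] [T2Space X]
  {b₀ g₀ : Coeff n X} {γ : ℂ} {c : ℝ}

variable (hh₀ : ∀ e ∈ atlas (Fin n → ℂ) X, ∀ a b,
    ContDiffOn ℝ ∞ (fun z => complexify b₀ g₀ e z a b) e.target)
  (hg₀ : ∀ e ∈ atlas (Fin n → ℂ) X, ∀ a b, ContDiffOn ℝ ∞ (fun z => g₀ e z a b) e.target)

include hh₀ hg₀

theorem continuousOn_integralTop_mul_energyDensity {P : Type*} [NormedAddCommGroup P]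
    [NormedSpace ℝ P] {S : Set P} {Φ Ψ : P → X → ℂ}
    (hΦ : ∀ e ∈ atlas (Fin n → ℂ) X, SmoothFamilyIn e S Φ)
    (hΨ : ∀ e ∈ atlas (Fin n → ℂ) X, SmoothFamilyIn e S Ψ)
    (hp : ∀ p ∈ S, ∀ e ∈ atlas (Fin n → ℂ) X, ∀ z ∈ e.target,
      0 < (addPotential g₀ (imPart (Φ p)) e z).det) :
    ContinuousOn (fun p => integralTop fun e z =>
      Ψ p (e.symm z) * energyDensity γ c b₀ g₀ (Φ p) e z) S :=
  continuousOn_integralTop fun e he => (ContDiffOn.mul (hΨ e he) (contDiffOn_energyDensity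
    (hh₀ e he) (hg₀ e he) (hΦ e he) fun p hp' => hp p hp' e he)).continuousOn

theorem continuousOn_integralTop_energyDensity_add_var {P : Type*} [NormedAddCommGroup P]
    [NormedSpace ℝ P] {S : Set P} {Φ Φ' Ψ Ψ' : P → X → ℂ}
    (hΦ : ∀ e ∈ atlas (Fin n → ℂ) X, SmoothFamilyIn e S Φ)
    (hΦ' : ∀ e ∈ atlas (Fin n → ℂ) X, SmoothFamilyIn e S Φ')
    (hΨ : ∀ e ∈ atlas (Fin n → ℂ) X, SmoothFamilyIn e S Ψ)
    (hΨ' : ∀ e ∈ atlas (Fin n → ℂ) X, SmoothFamilyIn e S Ψ')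
    (hp : ∀ p ∈ S, ∀ e ∈ atlas (Fin n → ℂ) X, ∀ z ∈ e.target,
      0 < (addPotential g₀ (imPart (Φ p)) e z).det) :
    ContinuousOn (fun p => integralTop fun e z =>
      Ψ' p (e.symm z) * energyDensity γ c b₀ g₀ (Φ p) e z +
        Ψ p (e.symm z) * energyDensityVar γ c b₀ g₀ (Φ p) (Φ' p) e z) S :=
  continuousOn_integralTop fun e he => ((ContDiffOn.mul (hΨ' e he) (contDiffOn_energyDensity
    (hh₀ e he) (hg₀ e he) (hΦ e he) fun p hp' => hp p hp' e he)).add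
    (ContDiffOn.mul (hΨ e he) (contDiffOn_energyDensityVar
      (hh₀ e he) (hg₀ e he) (hΦ e he) (hΦ' e he) fun p hp' => hp p hp' e he))).continuousOn

theorem hasDerivAt_integralTop_mul_energyDensity {I : Set ℝ} (hI : IsOpen I)
    {Φ Φ' Ψ Ψ' : ℝ → X → ℂ}
    (hΦ : ∀ e ∈ atlas (Fin n → ℂ) X, SmoothFamilyIn e I Φ)
    (hΦ' : ∀ e ∈ atlas (Fin n → ℂ) X, SmoothFamilyIn e I Φ')
    (hΨ : ∀ e ∈ atlas (Fin n → ℂ) X, SmoothFamilyIn e I Ψ)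
    (hΨ' : ∀ e ∈ atlas (Fin n → ℂ) X, SmoothFamilyIn e I Ψ')
    (hp : ∀ p ∈ I, ∀ e ∈ atlas (Fin n → ℂ) X, ∀ z ∈ e.target,
      0 < (addPotential g₀ (imPart (Φ p)) e z).det)
    (hdΦ : ∀ t ∈ I, ∀ x, HasDerivAt (fun s => Φ s x) (Φ' t x) t)
    (hdΨ : ∀ t ∈ I, ∀ x, HasDerivAt (fun s => Ψ s x) (Ψ' t x) t) {t : ℝ} (ht : t ∈ I) :
    HasDerivAt (fun s => integralTop fun e z =>
        Ψ s (e.symm z) * energyDensity γ c b₀ g₀ (Φ s) e z)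
      (integralTop fun e z => Ψ' t (e.symm z) * energyDensity γ c b₀ g₀ (Φ t) e z +
        Ψ t (e.symm z) * energyDensityVar γ c b₀ g₀ (Φ t) (Φ' t) e z) t := by
  refine hasDerivAt_integralTop hI (D := fun s e z =>
      Ψ s (e.symm z) * energyDensity γ c b₀ g₀ (Φ s) e z)
    (D' := fun t e z => Ψ' t (e.symm z) * energyDensity γ c b₀ g₀ (Φ t) e z +
        Ψ t (e.symm z) * energyDensityVar γ c b₀ g₀ (Φ t) (Φ' t) e z) ?_ ?_ ?_ ht
  · intro e he s hs
    have h1 := ContDiffOn.mul (hΨ e he) (contDiffOn_energyDensity (γ := γ) (c := c)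
      (hh₀ e he) (hg₀ e he) (hΦ e he) fun p hp' => hp p hp' e he)
    exact h1.continuousOn.comp (f := fun z : Fin n → ℂ => (s, z))
      (Continuous.prodMk_right s).continuousOn fun z hz => ⟨hs, hz⟩
  · intro e he
    exact ((ContDiffOn.mul (hΨ' e he) (contDiffOn_energyDensity
      (hh₀ e he) (hg₀ e he) (hΦ e he) fun p hp' => hp p hp' e he)).add
      (ContDiffOn.mul (hΨ e he) (contDiffOn_energyDensityVar
        (hh₀ e he) (hg₀ e he) (hΦ e he) (hΦ' e he) fun p hp' => hp p hp' e he))).continuousOn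
  · intro e he t ht z hz
    exact (hdΨ t ht _).mul (hasDerivAt_energyDensity (hg₀ e he) hI (hΦ e he) hdΦ
      (fun p hp' => hp p hp' e he) ht hz)

end EnergyIntegral

/-! ### Real forms and the symmetry of the second variation -/

section Hermitian

variable {n : ℕ} {U : Set (Fin n → ℂ)} {z : Fin n → ℂ} {f : (Fin n → ℂ) → ℂ}

theorem isHermitian_ddbar (hU : IsOpen U) (hf : ContDiffOn ℝ ∞ f U)
    (hreal : ∀ w ∈ U, star (f w) = f w) (hz : z ∈ U) : (ddbar f z).IsHermitian := by
  ext a b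
  have hd : ∀ w ∈ U, DifferentiableAt ℝ f w := fun w hw => diffAt_of_contDiffOn hU hf hw
  have h1 : wd (-Complex.I) a (wd Complex.I b f) z =
      star (wd Complex.I a (wd (-Complex.I) b f) z) := by
    have h2 : wd Complex.I b f =ᶠ[𝓝 z] fun w => star (wd (-Complex.I) b f w) := by
      filter_upwards [hU.mem_nhds hz] with w hw
      have h3 := wd_star (c := -Complex.I) (a := b) (hd w hw)
      rw [star_neg, Complex.star_def, Complex.conj_I, neg_neg] at h3
      rw [← star_star (wd (-Complex.I) b f w), ← wd_congr (c := -Complex.I) (a := b)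
        (show (fun w => star (f w)) =ᶠ[𝓝 w] f by
          filter_upwards [hU.mem_nhds hw] with w' hw' using hreal w' hw'), wd_star (hd w hw),
        star_star, star_star, star_neg, Complex.star_def, Complex.conj_I, neg_neg]
    rw [wd_congr h2, wd_star (diffAt_of_contDiffOn hU (contDiffOn_wd hU hf) hz), star_neg,
      Complex.star_def, Complex.conj_I, neg_neg]
  rw [Matrix.conjTranspose_apply, ddbar_apply_eq, ddbar_apply_eq, h1, wd_comm hU hf hz]

theorem star_trace_mul {A B : Matrix (Fin n) (Fin n) ℂ} (hA : A.IsHermitian)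
    (hB : B.IsHermitian) : star (A * B).trace = (A * B).trace := by
  rw [← Matrix.trace_conjTranspose, Matrix.conjTranspose_mul, hA.eq, hB.eq, Matrix.trace_mul_comm]

theorem isHermitian_mixedCof {A B : Matrix (Fin n) (Fin n) ℂ} (hA : A.IsHermitian)
    (hB : B.IsHermitian) : (mixedCof A B).IsHermitian := by
  have h1 : A⁻¹.IsHermitian := hA.inv
  have h2 : star A.det = A.det := by rw [← Matrix.det_conjTranspose, hA.eq]
  rw [Matrix.IsHermitian, mixedCof, Matrix.conjTranspose_smul, Matrix.conjTranspose_sub,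
    Matrix.conjTranspose_smul, star_trace_mul h1 hB, Matrix.conjTranspose_mul,
    Matrix.conjTranspose_mul, h1.eq, hB.eq, h2, Matrix.mul_assoc]

/-- `B + iω` is nondegenerate because `ω` is positive. -/
theorem det_add_I_smul_ne_zero {b g : Matrix (Fin n) (Fin n) ℂ} (hb : b.IsHermitian)
    (hg : g.PosDef) : (b + Complex.I • g).det ≠ 0 := by
  intro h
  obtain ⟨x, hx, hx0⟩ := Matrix.exists_mulVec_eq_zero_iff.2 h
  have h1 : dotProduct (star x) ((b + Complex.I • g).mulVec x) = 0 := by rw [hx0, dotProduct_zero]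
  rw [Matrix.add_mulVec, dotProduct_add, Matrix.smul_mulVec, dotProduct_smul] at h1
  have h2 := hg.dotProduct_mulVec_pos hx
  have h3 : (dotProduct (star x) (b.mulVec x)).im = 0 := by
    have := hb.im_star_dotProduct_mulVec_self x
    simpa using this
  have h4 := congrArg Complex.im h1
  simp [h3] at h4
  exact (Complex.pos_iff.1 h2).1.ne' h4

end Hermitian

section Symmetry

variable {n : ℕ} {X : Type*} [TopologicalSpace X]
  [ChartedSpace (Fin n → ℂ) X] [IsManifold 𝓘(ℂ, Fin n → ℂ) ω X] [CompactSpace X] [T2Space X]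

/-- A function on `X`, read in the charts. -/
abbrev onCharts (φ : X → ℂ) : OpenPartialHomeomorph X (Fin n → ℂ) → (Fin n → ℂ) → ℂ :=
  fun e z => φ (e.symm z)

variable {b₀ g₀ g : Coeff n X} {γ : ℂ} {c : ℝ} {φ χ ψ : X → ℂ}

theorem isScalar_onCharts (h : ∀ e ∈ atlas (Fin n → ℂ) X,
    ContDiffOn ℝ ∞ (fun z => φ (e.symm z)) e.target) : IsScalar (onCharts (n := n) φ) where
  smooth := h
  transform e _ e' _ z hz := by simp only [onCharts]; rw [e'.left_inv hz.2]

theorem IsScalar.imPart (h : IsScalar (onCharts (n := n) φ)) :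
    IsScalar (onCharts (n := n) (imPart φ)) :=
  isScalar_onCharts fun e he => ContDiffOn.ofReal_im (h.smooth e he)

theorem IsScalar.rePart (h : IsScalar (onCharts (n := n) φ)) :
    IsScalar (onCharts (n := n) (rePart φ)) :=
  isScalar_onCharts fun e he => ContDiffOn.ofReal_re (h.smooth e he)

theorem IsClosedForm.addPotential {h : Coeff n X} (hh : IsClosedForm h)
    (hφ : IsScalar (onCharts (n := n) φ)) : IsClosedForm (addPotential h φ) :=
  hh.add hφ.isClosedForm_ddbar

theorem addPotential_complexify (hφ : IsScalar (onCharts (n := n) φ))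
    {e : OpenPartialHomeomorph X (Fin n → ℂ)} (he : e ∈ atlas (Fin n → ℂ) X) {z : Fin n → ℂ}
    (hz : z ∈ e.target) :
    addPotential (complexify b₀ g₀) φ e z =
      addPotential b₀ (rePart φ) e z + Complex.I • addPotential g₀ (imPart φ) e z := by
  have hr := hφ.rePart.smooth e he
  have hi := hφ.imPart.smooth e he
  have h1 : ddbar (fun w => φ (e.symm w)) z =
      ddbar (fun w => rePart φ (e.symm w)) z +
        Complex.I • ddbar (fun w => imPart φ (e.symm w)) z := by
    ext a b
    rw [Matrix.add_apply, Matrix.smul_apply, smul_eq_mul]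
    simp only [ddbar_apply_eq]
    rw [← wd_const_mul _ (diffAt_of_contDiffOn e.open_target (contDiffOn_wd e.open_target hi) hz),
      ← wd_add (diffAt_of_contDiffOn e.open_target (contDiffOn_wd e.open_target hr) hz)
        ((diffAt_of_contDiffOn e.open_target (contDiffOn_wd e.open_target hi) hz).const_mul _)]
    refine wd_congr ?_
    filter_upwards [e.open_target.mem_nhds hz] with w hw
    rw [← wd_const_mul _ (diffAt_of_contDiffOn e.open_target hi hw),
      ← wd_add (diffAt_of_contDiffOn e.open_target hr hw)
        ((diffAt_of_contDiffOn e.open_target hi hw).const_mul _)]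
    congr 1
    funext w
    simp only [onCharts, ComplexifiedKahler.rePart, ComplexifiedKahler.imPart]
    rw [mul_comm Complex.I, Complex.re_add_im]
  simp only [addPotential, complexify, h1, smul_add]
  abel

theorem isHermitian_addPotential {h : Coeff n X}
    (hh : ∀ e ∈ atlas (Fin n → ℂ) X, ∀ z ∈ e.target, (h e z).IsHermitian)
    (hφ : IsScalar (onCharts (n := n) φ)) (hreal : ∀ x, star (φ x) = φ x)
    {e : OpenPartialHomeomorph X (Fin n → ℂ)} (he : e ∈ atlas (Fin n → ℂ) X) {z : Fin n → ℂ}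
    (hz : z ∈ e.target) : (addPotential h φ e z).IsHermitian :=
  (hh e he z hz).add
    (isHermitian_ddbar e.open_target (hφ.smooth e he) (fun _ _ => hreal _) hz)

theorem star_imPart (φ : X → ℂ) (x : X) : star (imPart φ x) = imPart φ x :=
  Complex.conj_ofReal _

theorem star_rePart (φ : X → ℂ) (x : X) : star (rePart φ x) = rePart φ x :=
  Complex.conj_ofReal _

/-- The part of the second variation that depends on `ω` only. -/
def realVar (c : ℝ) (g : Coeff n X) (v : X → ℂ) (e : OpenPartialHomeomorph X (Fin n → ℂ))
    (z : Fin n → ℂ) : ℂ :=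
  ((mixedCof (g e z) (ddbar (logDet (g e)) z) * ddbar (fun w => v (e.symm w)) z).trace +
    ((g e z).adjugate * ddbar (lap (g e) fun w => v (e.symm w)) z).trace) +
  c * ((g e z).adjugate * ddbar (fun w => v (e.symm w)) z).trace

theorem energyDensityVar_eq (e : OpenPartialHomeomorph X (Fin n → ℂ)) (z : Fin n → ℂ) :
    energyDensityVar γ c b₀ g₀ φ ψ e z =
      γ * ((addPotential (complexify b₀ g₀) φ e z).adjugate *
        ddbar (fun w => ψ (e.symm w)) z).trace +
      realVar c (addPotential g₀ (imPart φ)) (imPart ψ) e z := by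
  rw [energyDensityVar, realVar, add_assoc]

section RealForm

variable (hg : IsClosedForm g)
  (hpos : ∀ e ∈ atlas (Fin n → ℂ) X, ∀ z ∈ e.target, (g e z).PosDef)

include hpos hg

theorem isHermitian_ddbar_logDet {e : OpenPartialHomeomorph X (Fin n → ℂ)}
    (he : e ∈ atlas (Fin n → ℂ) X) {z : Fin n → ℂ} (hz : z ∈ e.target) :
    (ddbar (logDet (g e)) z).IsHermitian :=
  isHermitian_ddbar e.open_target
    (contDiffOn_logDet (hg.smooth e he) fun w hw => (hpos e he w hw).det_pos)
    (fun _ _ => Complex.conj_ofReal _) hz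

theorem star_lap {v : X → ℂ} (hv : IsScalar (onCharts (n := n) v)) (hreal : ∀ x, star (v x) = v x)
    {e : OpenPartialHomeomorph X (Fin n → ℂ)} (he : e ∈ atlas (Fin n → ℂ) X) {z : Fin n → ℂ}
    (hz : z ∈ e.target) :
    star (lap (g e) (fun w => v (e.symm w)) z) = lap (g e) (fun w => v (e.symm w)) z :=
  star_trace_mul (hpos e he z hz).isHermitian.inv
    (isHermitian_ddbar e.open_target (hv.smooth e he) (fun _ _ => hreal _) hz)

theorem star_realVar {v : X → ℂ} (hv : IsScalar (onCharts (n := n) v))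
    (hreal : ∀ x, star (v x) = v x)
    {e : OpenPartialHomeomorph X (Fin n → ℂ)} (he : e ∈ atlas (Fin n → ℂ) X) {z : Fin n → ℂ}
    (hz : z ∈ e.target) : star (realVar c g v e z) = realVar c g v e z := by
  have hG := (hpos e he z hz).isHermitian
  have hv' := isHermitian_ddbar e.open_target (hv.smooth e he) (fun _ _ => hreal _) hz
  have hlap := isHermitian_ddbar e.open_target
    ((hv.lap hg fun e he z hz => (hpos e he z hz).det_pos).smooth e he)
    (fun w hw => star_lap hg hpos hv hreal he hw) hz
  rw [realVar, star_add, star_add, star_mul', star_trace_mul hG.adjugate hv',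
    star_trace_mul hG.adjugate hlap,
    star_trace_mul (isHermitian_mixedCof hG (isHermitian_ddbar_logDet hg hpos he hz)) hv',
    Complex.star_def, Complex.conj_ofReal]

theorem continuousOn_realVar {v : X → ℂ} (hv : IsScalar (onCharts (n := n) v))
    {e : OpenPartialHomeomorph X (Fin n → ℂ)} (he : e ∈ atlas (Fin n → ℂ) X) :
    ContinuousOn (realVar c g v e) e.target := by
  have hdet : ∀ e ∈ atlas (Fin n → ℂ) X, ∀ z ∈ e.target, 0 < (g e z).det :=
    fun e he z hz => (hpos e he z hz).det_pos
  have h0 : ∀ e ∈ atlas (Fin n → ℂ) X, ∀ z ∈ e.target, (g e z).det ≠ 0 :=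
    fun e he z hz => (hdet e he z hz).ne'
  have hA := (hg.isClosedCoform_adjugate h0).smooth
  have hM := (hg.isClosedCoform_mixedCof h0 (hg.isClosedForm_logDet hdet)).smooth
  have c1 : ContinuousOn (fun z => (mixedCof (g e z) (ddbar (logDet (g e)) z) *
      ddbar (fun x => v (e.symm x)) z).trace) e.target := continuousOn_trace_ddbar
      (A := fun e z => mixedCof (g e z) (ddbar (logDet (g e)) z))
      (ψ := onCharts v) hM hv he
  have c2 : ContinuousOn (fun z => ((g e z).adjugate *
      ddbar (lap (g e) fun x => v (e.symm x)) z).trace) e.target :=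
    continuousOn_trace_ddbar (A := fun e z => (g e z).adjugate)
      (ψ := fun e z => lap (g e) (fun x => v (e.symm x)) z) hA (hv.lap hg hdet) he
  have c3 : ContinuousOn (fun z => ((g e z).adjugate *
      ddbar (fun x => v (e.symm x)) z).trace) e.target :=
    continuousOn_trace_ddbar (A := fun e z => (g e z).adjugate) (ψ := onCharts v) hA hv he
  exact (c1.add c2).add (continuousOn_const.mul c3)

theorem integralTop_mul_realVar {v w : X → ℂ} (hv : IsScalar (onCharts (n := n) v))
    (hw : IsScalar (onCharts (n := n) w)) :
    integralTop (fun e z => v (e.symm z) * realVar c g w e z) =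
      (integralTop (fun e z => v (e.symm z) * (mixedCof (g e z) (ddbar (logDet (g e)) z) *
          ddbar (fun x => w (e.symm x)) z).trace) +
        integralTop (fun e z => v (e.symm z) * ((g e z).adjugate *
          ddbar (lap (g e) fun x => w (e.symm x)) z).trace)) +
      c * integralTop (fun e z => v (e.symm z) *
        ((g e z).adjugate * ddbar (fun x => w (e.symm x)) z).trace) := by
  have hdet : ∀ e ∈ atlas (Fin n → ℂ) X, ∀ z ∈ e.target, 0 < (g e z).det :=
    fun e he z hz => (hpos e he z hz).det_pos
  have h0 : ∀ e ∈ atlas (Fin n → ℂ) X, ∀ z ∈ e.target, (g e z).det ≠ 0 :=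
    fun e he z hz => (hdet e he z hz).ne'
  have hA := (hg.isClosedCoform_adjugate h0).smooth
  have hM := (hg.isClosedCoform_mixedCof h0 (hg.isClosedForm_logDet hdet)).smooth
  have c1 : ∀ e ∈ atlas (Fin n → ℂ) X, ContinuousOn (fun z => v (e.symm z) *
      (mixedCof (g e z) (ddbar (logDet (g e)) z) * ddbar (fun x => w (e.symm x)) z).trace)
      e.target := fun e he =>
    ((hv.smooth e he).continuousOn).mul (continuousOn_trace_ddbar
      (A := fun e z => mixedCof (g e z) (ddbar (logDet (g e)) z))
      (ψ := onCharts w) hM hw he)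
  have c2 : ∀ e ∈ atlas (Fin n → ℂ) X, ContinuousOn (fun z => v (e.symm z) *
      ((g e z).adjugate * ddbar (lap (g e) fun x => w (e.symm x)) z).trace) e.target :=
    fun e he => ((hv.smooth e he).continuousOn).mul
      (continuousOn_trace_ddbar (A := fun e z => (g e z).adjugate)
      (ψ := fun e z => lap (g e) (fun x => w (e.symm x)) z) hA (hw.lap hg hdet) he)
  have c3 : ∀ e ∈ atlas (Fin n → ℂ) X, ContinuousOn (fun z => (c : ℂ) * (v (e.symm z) *
      ((g e z).adjugate * ddbar (fun x => w (e.symm x)) z).trace)) e.target := fun e he =>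
    continuousOn_const.mul (((hv.smooth e he).continuousOn).mul
      (continuousOn_trace_ddbar (A := fun e z => (g e z).adjugate)
      (ψ := onCharts w) hA hw he))
  have c12 : ∀ e ∈ atlas (Fin n → ℂ) X, ContinuousOn (fun z => v (e.symm z) *
      (mixedCof (g e z) (ddbar (logDet (g e)) z) * ddbar (fun x => w (e.symm x)) z).trace +
      v (e.symm z) * ((g e z).adjugate * ddbar (lap (g e) fun x => w (e.symm x)) z).trace)
      e.target := fun e he => (c1 e he).add (c2 e he)
  rw [← integralTop_const_mul, ← integralTop_add c1 c2, ← integralTop_add c12 c3]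
  refine integralTop_congr fun e _ z _ => ?_
  rw [realVar]
  ring

/-- The variation of the scalar curvature density is symmetric. The two summands with `lap` are each
other's transposes, as both integrate to `∫ Δv Δw ωⁿ`. -/
theorem integralTop_mul_realVar_comm {v w : X → ℂ} (hv : IsScalar (onCharts (n := n) v))
    (hw : IsScalar (onCharts (n := n) w)) :
    integralTop (fun e z => v (e.symm z) * realVar c g w e z) =
      integralTop (fun e z => w (e.symm z) * realVar c g v e z) := by
  have hdet : ∀ e ∈ atlas (Fin n → ℂ) X, ∀ z ∈ e.target, 0 < (g e z).det :=
    fun e he z hz => (hpos e he z hz).det_pos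
  have h0 : ∀ e ∈ atlas (Fin n → ℂ) X, ∀ z ∈ e.target, (g e z).det ≠ 0 :=
    fun e he z hz => (hdet e he z hz).ne'
  have hA := hg.isClosedCoform_adjugate h0
  have hM := hg.isClosedCoform_mixedCof h0 (hg.isClosedForm_logDet hdet)
  rw [integralTop_mul_realVar hg hpos hv hw, integralTop_mul_realVar hg hpos hw hv,
    integralTop_mul_trace_ddbar_comm hM hv hw, integralTop_mul_trace_ddbar_comm hA hv hw,
    integralTop_mul_trace_ddbar_comm hA hv (hw.lap hg hdet),
    integralTop_mul_trace_ddbar_comm hA hw (hv.lap hg hdet)]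
  congr 2
  refine integralTop_congr fun e he z hz => ?_
  rw [adjugate_eq_det_smul_inv (h0 e he z hz), Matrix.smul_mul, Matrix.trace_smul,
    Matrix.smul_mul, Matrix.trace_smul]
  simp only [lap, smul_eq_mul]
  ring

/-- Pairing a real density with a complex function sees only the imaginary part of the function. -/
theorem im_integralTop_mul_realVar {v w : X → ℂ} (hv : IsScalar (onCharts (n := n) v))
    (hw : IsScalar (onCharts (n := n) w)) (hreal : ∀ x, star (w x) = w x) :
    (integralTop (fun e z => v (e.symm z) * realVar c g w e z)).im =
      (integralTop (fun e z => imPart v (e.symm z) * realVar c g w e z)).re := by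
  rw [integralTop_im (D := fun e z => v (e.symm z) * realVar c g w e z) fun e he =>
    ((hv.smooth e he).continuousOn).mul (continuousOn_realVar hg hpos hw he)]
  congr 1
  refine integralTop_congr fun e he z hz => ?_
  have h1 := Complex.conj_eq_iff_im.1 (star_realVar (c := c) hg hpos hw hreal he hz)
  apply Complex.ext <;> simp [imPart, h1]

end RealForm

variable (hb : IsClosedRealForm b₀) (hg : IsKahlerForm g₀) (hφ : IsScalar (onCharts (n := n) φ))
  (hpos : ∀ e ∈ atlas (Fin n → ℂ) X, ∀ z ∈ e.target, (addPotential g₀ (imPart φ) e z).PosDef)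

include hb hg hφ hpos

theorem isClosedCoform_adjugate_addPotential_complexify :
    IsClosedCoform fun e z => (addPotential (complexify b₀ g₀) φ e z).adjugate := by
  refine IsClosedForm.isClosedCoform_adjugate
    ((hb.isClosedForm.add (hg.toIsClosedRealForm.isClosedForm.smul Complex.I)).addPotential hφ)
    fun e he z hz => ?_
  rw [addPotential_complexify hφ he hz]
  exact det_add_I_smul_ne_zero
    (isHermitian_addPotential hb.real hφ.rePart (star_rePart φ) he hz) (hpos e he z hz)

theorem im_integralTop_mul_energyDensityVar (hχ : IsScalar (onCharts (n := n) χ))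
    (hψ : IsScalar (onCharts (n := n) ψ)) :
    (integralTop (fun e z => χ (e.symm z) * energyDensityVar γ c b₀ g₀ φ ψ e z)).im =
      (γ * integralTop (fun e z => χ (e.symm z) *
        ((addPotential (complexify b₀ g₀) φ e z).adjugate *
          ddbar (fun w => ψ (e.symm w)) z).trace)).im +
      (integralTop (fun e z => imPart χ (e.symm z) *
        realVar c (addPotential g₀ (imPart φ)) (imPart ψ) e z)).re := by
  have hG := hg.toIsClosedRealForm.isClosedForm.addPotential hφ.imPart
  have hA := isClosedCoform_adjugate_addPotential_complexify hb hg hφ hpos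
  have c1 : ∀ e ∈ atlas (Fin n → ℂ) X, ContinuousOn (fun z => γ * (χ (e.symm z) *
      ((addPotential (complexify b₀ g₀) φ e z).adjugate *
        ddbar (fun w => ψ (e.symm w)) z).trace)) e.target := fun e he =>
    continuousOn_const.mul (((hχ.smooth e he).continuousOn).mul
      (continuousOn_trace_ddbar
      (A := fun e z => (addPotential (complexify b₀ g₀) φ e z).adjugate) (ψ := onCharts ψ)
      hA.smooth hψ he))
  have c2 : ∀ e ∈ atlas (Fin n → ℂ) X, ContinuousOn (fun z => χ (e.symm z) *
      realVar c (addPotential g₀ (imPart φ)) (imPart ψ) e z) e.target := fun e he =>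
    ((hχ.smooth e he).continuousOn).mul (continuousOn_realVar hG hpos hψ.imPart he)
  rw [← im_integralTop_mul_realVar hG hpos hχ hψ.imPart (star_imPart ψ), ← Complex.add_im,
    ← integralTop_const_mul, ← integralTop_add c1 c2]
  congr 2
  funext e z
  rw [energyDensityVar_eq]
  ring

/-- The 1-form `σ` is closed. -/
theorem im_integralTop_mul_energyDensityVar_comm (hχ : IsScalar (onCharts (n := n) χ))
    (hψ : IsScalar (onCharts (n := n) ψ)) :
    (integralTop (fun e z => χ (e.symm z) * energyDensityVar γ c b₀ g₀ φ ψ e z)).im =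
      (integralTop (fun e z => ψ (e.symm z) * energyDensityVar γ c b₀ g₀ φ χ e z)).im := by
  rw [im_integralTop_mul_energyDensityVar hb hg hφ hpos hχ hψ,
    im_integralTop_mul_energyDensityVar hb hg hφ hpos hψ hχ,
    integralTop_mul_realVar_comm (hg.toIsClosedRealForm.isClosedForm.addPotential hφ.imPart) hpos
      hχ.imPart hψ.imPart,
    integralTop_mul_trace_ddbar_comm
      (isClosedCoform_adjugate_addPotential_complexify hb hg hφ hpos) hχ hψ]

end Symmetry

/-! ### Top forms as determinants -/

section TopForms

variable {n : ℕ}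

theorem wedgeTop_eq_sum_det (h : Fin n → Matrix (Fin n) (Fin n) ℂ) :
    wedgeTop h = ∑ σ : Equiv.Perm (Fin n), ((Equiv.Perm.sign σ : ℤ) : ℂ) *
      (Matrix.of fun k j => h k (σ k) j).det := by
  refine Finset.sum_congr rfl fun σ _ => ?_
  rw [← Matrix.det_transpose, Matrix.det_apply', Finset.mul_sum]
  refine Finset.sum_congr rfl fun τ _ => ?_
  simp only [Matrix.transpose_apply, Matrix.of_apply]
  ring

theorem sign_mul_sign (σ : Equiv.Perm (Fin n)) :
    ((Equiv.Perm.sign σ : ℤ) : ℂ) * ((Equiv.Perm.sign σ : ℤ) : ℂ) = 1 := by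
  rw [← Int.cast_mul, ← Units.val_mul, Int.units_mul_self, Units.val_one, Int.cast_one]

theorem powTop_eq (h : Matrix (Fin n) (Fin n) ℂ) : powTop h = (n.factorial : ℂ) * h.det := by
  rw [powTop, wedgeTop_eq_sum_det]
  have h1 : ∀ σ : Equiv.Perm (Fin n), ((Equiv.Perm.sign σ : ℤ) : ℂ) *
      (Matrix.of fun k j => h (σ k) j).det = h.det := fun σ => by
    have h2 := Matrix.det_permute σ h
    rw [show (Matrix.of fun k j => h (σ k) j) = h.submatrix σ id from rfl, h2, ← mul_assoc,
      sign_mul_sign, one_mul]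
  rw [Finset.sum_congr rfl fun σ _ => h1 σ, Finset.sum_const, Finset.card_univ,
    Fintype.card_perm, Fintype.card_fin, nsmul_eq_mul]

theorem det_updateRow_eq_sum (h : Matrix (Fin n) (Fin n) ℂ) (i : Fin n) (r : Fin n → ℂ) :
    (h.updateRow i r).det = ∑ j, h.adjugate j i * r j := by
  rw [← Matrix.cramer_transpose_apply, Matrix.cramer_eq_adjugate_mulVec,
    ← Matrix.adjugate_transpose]
  rfl

/-- `n ξ ∧ hⁿ⁻¹ = n! tr (adj h · ξ)`, as in the expansion of a determinant along each of its
rows. -/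
theorem mul_wedgePowTop (ξ h : Matrix (Fin n) (Fin n) ℂ) :
    (n : ℂ) * wedgePowTop ξ h = (n.factorial : ℂ) * (h.adjugate * ξ).trace := by
  rcases Nat.eq_zero_or_pos n with rfl | hn
  · simp [Matrix.trace]
  set o : Fin n := ⟨0, hn⟩
  set f : Fin n → ℂ := fun a => ∑ j, h.adjugate j a * ξ a j
  have h1 : ∀ σ : Equiv.Perm (Fin n), ((Equiv.Perm.sign σ : ℤ) : ℂ) *
      (Matrix.of fun k j => (if k.val = 0 then ξ else h) (σ k) j).det = f (σ o) := fun σ => by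
    have h2 : (Matrix.of fun k j => (if k.val = 0 then ξ else h) (σ k) j) =
        (h.updateRow (σ o) (ξ (σ o))).submatrix σ id := by
      ext k j
      by_cases hk : k = o
      · subst hk; simp [o]
      · have hk' : k.val ≠ 0 := fun h' => hk (Fin.ext h')
        simp [hk', Matrix.updateRow_ne (σ.injective.ne hk)]
    rw [h2, Matrix.det_permute, ← mul_assoc, sign_mul_sign, one_mul, det_updateRow_eq_sum]
  -- every row is as likely as the first one to be replaced by a row of `ξ`
  have h3 : ∀ k : Fin n, ∑ σ : Equiv.Perm (Fin n), f (σ k) =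
      ∑ σ : Equiv.Perm (Fin n), f (σ o) := fun k => by
    rw [← Equiv.sum_comp (Equiv.mulRight (Equiv.swap o k)) fun σ => f (σ o)]
    simp
  have h4 : wedgePowTop ξ h = ∑ σ : Equiv.Perm (Fin n), f (σ o) := by
    rw [wedgePowTop, wedgeTop_eq_sum_det]
    exact Finset.sum_congr rfl fun σ _ => h1 σ
  have h5 : (n : ℂ) * ∑ σ : Equiv.Perm (Fin n), f (σ o) =
      ∑ σ : Equiv.Perm (Fin n), ∑ k, f (σ k) := by
    symm
    rw [Finset.sum_comm, Finset.sum_congr rfl fun k _ => h3 k, Finset.sum_const, Finset.card_univ,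
      Fintype.card_fin, nsmul_eq_mul]
  rw [h4, h5, Finset.sum_congr rfl fun σ _ => Equiv.sum_comp σ f, Finset.sum_const,
    Finset.card_univ, Fintype.card_perm, Fintype.card_fin, nsmul_eq_mul, trace_mul_eq_sum]

theorem mul_wedgePowTop_dfdbarf (f : (Fin n → ℂ) → ℂ) (z : Fin n → ℂ)
    (h : Matrix (Fin n) (Fin n) ℂ) :
    (n : ℂ) * wedgePowTop (dfdbarf f z) h = (n.factorial : ℂ) * pairing h.adjugate
      (fun a => wd (-Complex.I) a f z) (fun b => wd Complex.I b f z) := by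
  rw [mul_wedgePowTop, trace_mul_eq_sum, pairing]
  congr 1
  simp only [dfdbarf, Matrix.of_apply, dz_eq_wd, dzbar_eq_wd, mul_assoc]

end TopForms

/-! ### Adapted frames -/

section Frames

variable {n : ℕ} {g b : Matrix (Fin n) (Fin n) ℂ}

open scoped MatrixOrder in
theorem exists_conjTranspose_mul_self {g : Matrix (Fin n) (Fin n) ℂ} (hg : g.PosSemidef) :
    ∃ k : Matrix (Fin n) (Fin n) ℂ, g = k.conjTranspose * k :=
  CStarAlgebra.nonneg_iff_eq_star_mul_self.mp hg.nonneg

/-- Simultaneous diagonalisation of a positive definite and a Hermitian form. -/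
theorem exists_isAdaptedFrame (hg : g.PosDef) (hb : b.IsHermitian) :
    ∃ p, IsAdaptedFrame g b p := by
  obtain ⟨k, hk⟩ := exists_conjTranspose_mul_self hg.posSemidef
  have hk0 : IsUnit k.det := by
    rw [isUnit_iff_ne_zero]
    intro h0
    have := hg.det_pos.ne'
    rw [hk, Matrix.det_mul, h0, mul_zero] at this
    exact this rfl
  have hk1 : k * k⁻¹ = 1 := Matrix.mul_nonsing_inv k hk0
  have hg1 : (k⁻¹).conjTranspose * g * k⁻¹ = 1 := by
    rw [hk, ← Matrix.mul_assoc, ← Matrix.conjTranspose_mul, hk1, Matrix.conjTranspose_one,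
      Matrix.one_mul, hk1]
  have hb1 : ((k⁻¹).conjTranspose * b * k⁻¹).IsHermitian :=
    Matrix.isHermitian_conjTranspose_mul_mul _ hb
  set w : Matrix (Fin n) (Fin n) ℂ :=
    (hb1.eigenvectorUnitary : Matrix (Fin n) (Fin n) ℂ)
  have hw : w.conjTranspose * w = 1 := Unitary.coe_star_mul_self hb1.eigenvectorUnitary
  have hbw : w.conjTranspose * ((k⁻¹).conjTranspose * b * k⁻¹) * w =
      Matrix.diagonal fun i => ((hb1.eigenvalues i : ℝ) : ℂ) := by
    have := hb1.conjStarAlgAut_star_eigenvectorUnitary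
    rw [Unitary.conjStarAlgAut_star_apply] at this
    exact this
  have hstar : (((k⁻¹ * w).map star).map star) = k⁻¹ * w := by
    ext i j; simp only [Matrix.map_apply, star_star]
  have htr : ((k⁻¹ * w).map star).transpose = w.conjTranspose * (k⁻¹).conjTranspose := by
    rw [← Matrix.conjTranspose_mul]; rfl
  refine ⟨((k⁻¹ * w).map star, hb1.eigenvalues), ?_, ?_⟩
  · simp only [hstar, htr]
    rw [show w.conjTranspose * (k⁻¹).conjTranspose * g * (k⁻¹ * w) =
      w.conjTranspose * ((k⁻¹).conjTranspose * g * k⁻¹) * w by simp only [Matrix.mul_assoc],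
      hg1, Matrix.mul_one, hw]
  · simp only [hstar, htr]
    rw [← hbw]
    simp only [Matrix.mul_assoc]

theorem isAdaptedFrame_adaptedFrame (hg : g.PosDef) (hb : b.IsHermitian) :
    IsAdaptedFrame g b (adaptedFrame g b) :=
  Classical.epsilon_spec (exists_isAdaptedFrame hg hb)

/-- The polar form of `λ + i`; its argument is `arccot λ ∈ (0, π)`. -/
theorem add_I_eq (x : ℝ) :
    (x : ℂ) + Complex.I = (Real.sqrt (1 + x ^ 2) : ℂ) * Complex.exp (arccot x * Complex.I) := by
  have h0 : 0 < Real.sqrt (1 + x ^ 2) := Real.sqrt_pos.2 (by positivity)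
  rw [Complex.exp_mul_I, ← Complex.ofReal_cos, ← Complex.ofReal_sin, arccot,
    Real.cos_pi_div_two_sub, Real.sin_pi_div_two_sub, Real.cos_arctan, Real.sin_arctan]
  push_cast
  have h1 : (Real.sqrt (1 + x ^ 2) : ℂ) ≠ 0 := by exact_mod_cast h0.ne'
  field_simp

theorem prod_add_I_eq (l : Fin n → ℝ) : ∏ k, ((l k : ℂ) + Complex.I) =
    ((∏ k, Real.sqrt (1 + l k ^ 2) : ℝ) : ℂ) * Complex.exp (((∑ k, arccot (l k) : ℝ) : ℂ) *
      Complex.I) := by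
  simp only [add_I_eq]
  rw [Finset.prod_mul_distrib, ← Complex.exp_sum]
  push_cast
  rw [Finset.sum_mul]

/-- If `Pᵀ h P̄` is diagonal, the pairing with `h⁻¹` is diagonal in the components of the covectors
in the coframe. -/
theorem pairing_inv_eq_sum {p h : Matrix (Fin n) (Fin n) ℂ} {d : Fin n → ℂ}
    (hp : IsUnit p.det) (hd : ∀ k, d k ≠ 0)
    (h1 : p.transpose * h * p.map star = Matrix.diagonal d) (α β : Fin n → ℂ) :
    pairing h⁻¹ α β =
      ∑ k, (p.transpose.mulVec α) k * ((p.map star).transpose.mulVec β) k / d k := by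
  have hq : IsUnit (p.map star).det := by rw [det_map_star]; exact hp.star
  have hpt : IsUnit p.transpose.det := by rwa [Matrix.det_transpose]
  have h2 : h⁻¹ = p.map star * (Matrix.diagonal fun k => (d k)⁻¹) * p.transpose := by
    have h3 : h = (p.transpose)⁻¹ * Matrix.diagonal d * (p.map star)⁻¹ := by
      rw [← h1]
      simp only [Matrix.mul_assoc, Matrix.mul_nonsing_inv _ hq, Matrix.mul_one]
      rw [← Matrix.mul_assoc, Matrix.nonsing_inv_mul _ hpt, Matrix.one_mul]
    have h4 : (Matrix.diagonal d) * (Matrix.diagonal fun k => (d k)⁻¹) = 1 := by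
      rw [Matrix.diagonal_mul_diagonal, ← Matrix.diagonal_one]
      congr 1; funext k; exact mul_inv_cancel₀ (hd k)
    refine Matrix.inv_eq_right_inv ?_
    rw [h3]
    calc (p.transpose)⁻¹ * Matrix.diagonal d * (p.map star)⁻¹ *
        (p.map star * (Matrix.diagonal fun k => (d k)⁻¹) * p.transpose)
        = (p.transpose)⁻¹ * (Matrix.diagonal d * (((p.map star)⁻¹ * p.map star) *
          (Matrix.diagonal fun k => (d k)⁻¹))) * p.transpose := by simp only [Matrix.mul_assoc]
      _ = 1 := by
        rw [Matrix.nonsing_inv_mul _ hq, Matrix.one_mul, h4, Matrix.mul_one,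
          Matrix.nonsing_inv_mul _ hpt]
  rw [pairing_eq_dotProduct, h2, ← Matrix.mulVec_mulVec, ← Matrix.mulVec_mulVec,
    Matrix.dotProduct_mulVec, ← Matrix.mulVec_transpose]
  simp only [dotProduct, Matrix.mulVec_diagonal]
  refine Finset.sum_congr rfl fun k _ => ?_
  rw [div_eq_mul_inv]
  ring

/-- The determinant in an adapted frame. -/
theorem det_eq_of_isAdaptedFrame {p : Matrix (Fin n) (Fin n) ℂ × (Fin n → ℝ)}
    (hp : IsAdaptedFrame g b p) :
    (b + Complex.I • g).det = g.det * ∏ k, ((p.2 k : ℂ) + Complex.I) := by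
  have h1 : p.1.transpose * (b + Complex.I • g) * p.1.map star =
      Matrix.diagonal fun k => (p.2 k : ℂ) + Complex.I := by
    rw [Matrix.mul_add, Matrix.add_mul, hp.2, Matrix.mul_smul, Matrix.smul_mul, hp.1,
      Matrix.smul_one_eq_diagonal, Matrix.diagonal_add]
  have h2 := congrArg Matrix.det h1
  have h3 := congrArg Matrix.det hp.1
  rw [Matrix.det_mul, Matrix.det_mul, Matrix.det_diagonal] at h2
  rw [Matrix.det_mul, Matrix.det_mul, Matrix.det_one] at h3
  rw [← h2]
  linear_combination (-(b + Complex.I • g).det) * h3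

/-- The component form of the identity behind the second variation: `Im (φ̈ - Z)` is the sum of
squares when `Im φ̈ = ∑ |vₖ|²` and `Z = ∑ (uₖ + i vₖ)(ūₖ + i v̄ₖ) / (λₖ + i)`. -/
theorem im_sum_div_add_I (l : Fin n → ℝ) (u v : Fin n → ℂ) :
    (∑ k, Complex.normSq (v k)) - (∑ k, (u k + Complex.I * v k) *
        (star (u k) + Complex.I * star (v k)) / ((l k : ℂ) + Complex.I)).im =
      ∑ k, ‖u k - (l k : ℂ) * v k‖ ^ 2 / (1 + l k ^ 2) := by
  rw [Complex.im_sum, ← Finset.sum_sub_distrib]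
  refine Finset.sum_congr rfl fun k _ => ?_
  have h0 : (1 : ℝ) + l k ^ 2 ≠ 0 := by positivity
  have h1 : Complex.normSq ((l k : ℂ) + Complex.I) = 1 + l k ^ 2 := by
    simp [Complex.normSq_apply]; ring
  rw [← Complex.normSq_eq_norm_sq, Complex.div_im, h1]
  simp only [Complex.normSq_apply, Complex.add_re, Complex.add_im, Complex.mul_re, Complex.mul_im,
    Complex.sub_re, Complex.sub_im, Complex.star_def, Complex.conj_re, Complex.conj_im,
    Complex.I_re, Complex.I_im, Complex.ofReal_re, Complex.ofReal_im]
  field_simp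
  ring

/-- If `Re (e^{iη} w) = 0` then `Im (e^{iη} w) = Im w / cos η`. -/
theorem im_exp_mul {η : ℝ} (hη : Real.cos η ≠ 0) {w : ℂ}
    (hw : (Complex.exp (η * Complex.I) * w).re = 0) :
    (Complex.exp (η * Complex.I) * w).im = w.im / Real.cos η := by
  rw [Complex.exp_mul_I, ← Complex.ofReal_cos, ← Complex.ofReal_sin] at hw ⊢
  simp only [Complex.mul_re, Complex.mul_im, Complex.add_re, Complex.add_im, Complex.ofReal_re,
    Complex.ofReal_im, Complex.I_re, Complex.I_im] at hw ⊢
  have h1 := Real.sin_sq_add_cos_sq η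
  rw [eq_div_iff hη]
  simp only [mul_zero, mul_one, zero_add, add_zero, sub_zero] at hw ⊢
  linear_combination (Real.sin η) * hw + w.im * h1

/-- The trace of a product of positive semidefinite matrices is nonnegative. -/
theorem trace_mul_nonneg {A B : Matrix (Fin n) (Fin n) ℂ} (hA : A.PosSemidef)
    (hB : B.PosSemidef) : 0 ≤ (A * B).trace := by
  obtain ⟨k, rfl⟩ := exists_conjTranspose_mul_self hA
  rw [Matrix.mul_assoc, Matrix.trace_mul_comm]
  exact (hB.mul_mul_conjTranspose_same k).trace_nonneg

theorem lichNormSq_nonneg {g : (Fin n → ℂ) → Matrix (Fin n) (Fin n) ℂ}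
    (f : (Fin n → ℂ) → ℂ) {z : Fin n → ℂ} (hg : (g z).PosDef) : 0 ≤ lichNormSq g f z := by
  have h1 : lichNormSq g f z = ((g z).transpose *
      (lich g f z * (g z)⁻¹ * (lich g f z).conjTranspose)).trace := by
    rw [trace_mul_eq_sum, lichNormSq]
    refine Finset.sum_congr rfl fun a _ => Finset.sum_congr rfl fun d _ => ?_
    simp only [Matrix.transpose_apply, Matrix.mul_apply, Matrix.conjTranspose_apply,
      Finset.sum_mul, Finset.mul_sum]
    rw [Finset.sum_comm]
    refine Finset.sum_congr rfl fun e _ => Finset.sum_congr rfl fun c _ => ?_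
    ring
  rw [h1]
  exact trace_mul_nonneg hg.posSemidef.transpose
    (hg.inv.posSemidef.mul_mul_conjTranspose_same _)

end Frames

section Algebra

variable {n : ℕ} {g b : Matrix (Fin n) (Fin n) ℂ} {θ : ℝ}

/-- `e^{-iθ} (ω^ℂ)ⁿ = r e^{i(Θ - θ)} ωⁿ`. -/
theorem exp_mul_det_eq (hg : g.PosDef) (hb : b.IsHermitian) :
    Complex.exp (-(θ * Complex.I)) * (b + Complex.I • g).det =
      ((g.det.re * lagrangianRadius g b : ℝ) : ℂ) *
        Complex.exp (((lagrangianPhase g b - θ : ℝ) : ℂ) * Complex.I) := by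
  have h1 := Complex.pos_iff.1 hg.det_pos
  have h2 : g.det = (g.det.re : ℂ) := by
    apply Complex.ext <;> simp [h1.2]
  rw [det_eq_of_isAdaptedFrame (isAdaptedFrame_adaptedFrame hg hb), prod_add_I_eq, h2,
    lagrangianRadius, lagrangianPhase]
  push_cast
  rw [sub_mul, Complex.exp_sub, Complex.exp_neg]
  simp only [Complex.ofReal_re]
  ring

theorem lagrangianRadius_pos (g b : Matrix (Fin n) (Fin n) ℂ) : 0 < lagrangianRadius g b :=
  Finset.prod_pos fun _ _ => Real.sqrt_pos.2 (by positivity)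

theorem sumSquares_nonneg (g b : Matrix (Fin n) (Fin n) ℂ) (u v : Fin n → ℂ) :
    0 ≤ sumSquares g b u v :=
  Finset.sum_nonneg fun _ _ => by positivity

/-- `Re (e^{-iθ} (ω^ℂ)ⁿ) > 0` means `cos (Θ - θ) > 0`. -/
theorem cos_phase_pos (hg : g.PosDef) (hb : b.IsHermitian)
    (h : 0 < (Complex.exp (-(θ * Complex.I)) * powTop (b + Complex.I • g)).re) :
    0 < Real.cos (lagrangianPhase g b - θ) := by
  rw [powTop_eq, mul_left_comm, exp_mul_det_eq hg hb, ← Complex.ofReal_natCast, ← mul_assoc,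
    ← Complex.ofReal_mul, Complex.re_ofReal_mul, Complex.exp_ofReal_mul_I_re] at h
  have h1 : 0 < g.det.re := (Complex.pos_iff.1 hg.det_pos).1
  have h2 := lagrangianRadius_pos g b
  have h3 : (0 : ℝ) < n.factorial := by exact_mod_cast n.factorial_pos
  exact (mul_pos_iff_of_pos_left (by positivity)).1 h

/-- The pointwise form of the second variation along a geodesic: `a` is the acceleration and `u`,
`v` are the `(1,0)`-derivatives of the real and imaginary parts of the velocity. -/
theorem im_mul_sub_pairing (hg : g.PosDef) (hb : b.IsHermitian) {a : ℂ} {u v : Fin n → ℂ}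
    (hcos : 0 < Real.cos (lagrangianPhase g b - θ))
    (ha : (a.im : ℂ) = pairing g⁻¹ v (star v))
    (hre : (Complex.exp (-(θ * Complex.I)) * (a * (b + Complex.I • g).det -
      pairing (b + Complex.I • g).adjugate (u + Complex.I • v)
        (star u + Complex.I • star v))).re = 0) :
    (Complex.exp (-(θ * Complex.I)) * (a * (b + Complex.I • g).det -
      pairing (b + Complex.I • g).adjugate (u + Complex.I • v)
        (star u + Complex.I • star v))).im =
      lagrangianRadius g b / Real.cos (lagrangianPhase g b - θ) * sumSquares g b u v *
        g.det.re := by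
  have hp := isAdaptedFrame_adaptedFrame hg hb
  set p := (adaptedFrame g b).1 with hp_def
  set l := (adaptedFrame g b).2 with hl_def
  have hdet : IsUnit p.det := by
    rw [isUnit_iff_ne_zero]
    intro h0
    have h3 := congrArg Matrix.det hp.1
    rw [Matrix.det_mul, Matrix.det_mul, Matrix.det_one, Matrix.det_transpose, h0] at h3
    simp at h3
  have hstar : ∀ w : Fin n → ℂ, (p.map star).transpose.mulVec (star w) =
      star (p.transpose.mulVec w) := by
    intro w
    ext k
    simp [Matrix.mulVec, dotProduct, mul_comm]
  have hH : p.transpose * (b + Complex.I • g) * p.map star =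
      Matrix.diagonal fun k => (l k : ℂ) + Complex.I := by
    rw [Matrix.mul_add, Matrix.add_mul, hp.2, Matrix.mul_smul, Matrix.smul_mul, hp.1,
      Matrix.smul_one_eq_diagonal, Matrix.diagonal_add]
  have hl0 : ∀ k, (l k : ℂ) + Complex.I ≠ 0 := fun k h0 => by
    have := congrArg Complex.im h0
    simp at this
  have ha' : a.im = ∑ k, Complex.normSq ((p.transpose.mulVec v) k) := by
    have h1 : p.transpose * g * p.map star = Matrix.diagonal fun _ => (1 : ℂ) := by
      rw [hp.1, Matrix.diagonal_one]
    rw [pairing_inv_eq_sum hdet (fun _ => one_ne_zero) h1, hstar] at ha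
    have h2 := congrArg Complex.re ha
    rw [Complex.ofReal_re, Complex.re_sum] at h2
    rw [h2]
    refine Finset.sum_congr rfl fun k _ => ?_
    simp [Complex.normSq_apply, Complex.mul_re]
  set Z := ∑ k, ((p.transpose.mulVec u) k + Complex.I * (p.transpose.mulVec v) k) *
      (star ((p.transpose.mulVec u) k) + Complex.I * star ((p.transpose.mulVec v) k)) /
        ((l k : ℂ) + Complex.I) with hZ
  have h2 : pairing (b + Complex.I • g).adjugate (u + Complex.I • v) (star u + Complex.I • star v) =
      (b + Complex.I • g).det * Z := by
    rw [adjugate_eq_det_smul_inv (det_add_I_smul_ne_zero hb hg), hZ, ← smul_eq_mul]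
    have h3 := pairing_inv_eq_sum hdet hl0 hH (u + Complex.I • v) (star u + Complex.I • star v)
    rw [Matrix.mulVec_add, Matrix.mulVec_add, Matrix.mulVec_smul, Matrix.mulVec_smul, hstar,
      hstar] at h3
    rw [pairing_eq_dotProduct, Matrix.smul_mulVec, dotProduct_smul, ← pairing_eq_dotProduct, h3]
    rfl
  have h4 : Complex.exp (-(θ * Complex.I)) * (a * (b + Complex.I • g).det -
      (b + Complex.I • g).det * Z) = ((g.det.re * lagrangianRadius g b : ℝ) : ℂ) *
        (Complex.exp (((lagrangianPhase g b - θ : ℝ) : ℂ) * Complex.I) * (a - Z)) := by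
    rw [← mul_assoc, ← exp_mul_det_eq hg hb]
    ring
  have hdr : 0 < g.det.re * lagrangianRadius g b :=
    mul_pos (Complex.pos_iff.1 hg.det_pos).1 (lagrangianRadius_pos g b)
  rw [h2, h4, Complex.re_ofReal_mul] at hre
  rw [h2, h4, Complex.im_ofReal_mul, im_exp_mul hcos.ne'
    ((mul_eq_zero.1 hre).resolve_left hdr.ne'), Complex.sub_im, ha', im_sum_div_add_I]
  rw [sumSquares, ← hp_def, ← hl_def]
  ring

end Algebra

/-! ### The first derivative of the energy -/

section Families

variable {n : ℕ} {X : Type*} [TopologicalSpace X] {P Q : Type*} [NormedAddCommGroup P]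
  [NormedSpace ℝ P] [NormedAddCommGroup Q] [NormedSpace ℝ Q] {S : Set P} {S' : Set Q}
  {e : OpenPartialHomeomorph X (Fin n → ℂ)} {Φ : P → X → ℂ}

theorem SmoothFamilyIn.comp (h : SmoothFamilyIn e S Φ) {ρ : Q → P} (hρ : ContDiff ℝ ∞ ρ)
    (hmaps : MapsTo ρ S' S) : SmoothFamilyIn e S' fun q => Φ (ρ q) :=
  ContDiffOn.comp (g := fun q : P × (Fin n → ℂ) => Φ q.1 (e.symm q.2))
    (f := fun q : Q × (Fin n → ℂ) => (ρ q.1, q.2)) h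
    ((hρ.comp contDiff_fst).prodMk contDiff_snd).contDiffOn fun _ hq => ⟨hmaps hq.1, hq.2⟩

theorem SmoothFamilyIn.ofReal_mul (h : SmoothFamilyIn e S Φ) {ρ : P → ℝ}
    (hρ : ContDiff ℝ ∞ ρ) : SmoothFamilyIn e S fun p x => ((ρ p : ℝ) : ℂ) * Φ p x :=
  ContDiffOn.mul (Complex.ofRealCLM.contDiff.comp (hρ.comp contDiff_fst)).contDiffOn h

variable [ChartedSpace (Fin n → ℂ) X] [IsManifold 𝓘(ℂ, Fin n → ℂ) ω X] [CompactSpace X] [T2Space X]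

theorem isScalar_of_smoothFamily (h : ∀ e ∈ atlas (Fin n → ℂ) X, SmoothFamilyIn e S Φ) {p : P}
    (hp : p ∈ S) : IsScalar (onCharts (n := n) (Φ p)) :=
  isScalar_onCharts fun e he => ContDiffOn.comp
    (g := fun q : P × (Fin n → ℂ) => Φ q.1 (e.symm q.2)) (f := fun z : Fin n → ℂ => (p, z)) (h e he)
    (contDiff_prodMk_right p).contDiffOn fun _ hz => ⟨hp, hz⟩

theorem smoothFamilyIn_const {φ : X → ℂ} (hφ : IsScalar (onCharts (n := n) φ))
    (he : e ∈ atlas (Fin n → ℂ) X) : SmoothFamilyIn e S fun _ => φ :=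
  (hφ.smooth e he).comp contDiffOn_snd fun _ hq => hq.2

end Families

section Energy

variable {n : ℕ} {X : Type*} [TopologicalSpace X]
  [ChartedSpace (Fin n → ℂ) X] [IsManifold 𝓘(ℂ, Fin n → ℂ) ω X] [CompactSpace X] [T2Space X]
  {b₀ g₀ : Coeff n X} {γ : ℂ} {c : ℝ} {φ ψ : X → ℂ}

theorem energyDensity_eq (hφ : IsScalar (onCharts (n := n) φ))
    {e : OpenPartialHomeomorph X (Fin n → ℂ)} (he : e ∈ atlas (Fin n → ℂ) X) {z : Fin n → ℂ}
    (hz : z ∈ e.target) (hp : (addPotential g₀ (imPart φ) e z).det ≠ 0) :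
    γ * powTop (complexify (addPotential b₀ (rePart φ)) (addPotential g₀ (imPart φ)) e z) -
      (scalarCurv (addPotential g₀ (imPart φ) e) z - c) * powTop (addPotential g₀ (imPart φ) e z) =
      (n.factorial : ℂ) * energyDensity γ c b₀ g₀ φ e z := by
  have h1 : scalarCurv (addPotential g₀ (imPart φ) e) z =
      -((addPotential g₀ (imPart φ) e z)⁻¹ *
        ddbar (logDet (addPotential g₀ (imPart φ) e)) z).trace := by
    rw [scalarCurv, trace_mul_eq_sum, ← Finset.sum_neg_distrib]
    refine Finset.sum_congr rfl fun a _ => ?_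
    rw [← Finset.sum_neg_distrib]
    refine Finset.sum_congr rfl fun b _ => ?_
    rw [mul_neg]
    rfl
  rw [h1, powTop_eq, powTop_eq, complexify, ← addPotential_complexify hφ he hz, energyDensity,
    adjugate_eq_det_smul_inv hp, Matrix.smul_mul, Matrix.trace_smul, smul_eq_mul]
  ring

/-- The 1-form `σ` in terms of the energy density. -/
theorem firstVariation_eq (hφ : IsScalar (onCharts (n := n) φ))
    (hp : ∀ e ∈ atlas (Fin n → ℂ) X, ∀ z ∈ e.target,
      (addPotential g₀ (imPart φ) e z).PosDef) :
    firstVariation γ c (addPotential b₀ (rePart φ)) (addPotential g₀ (imPart φ)) ψ =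
      n.factorial * (integralTop fun e z =>
        ψ (e.symm z) * energyDensity γ c b₀ g₀ φ e z).im := by
  rw [firstVariation, ← Complex.im_ofReal_mul, Complex.ofReal_natCast, ← integralTop_const_mul]
  congr 1
  refine integralTop_congr fun e he z hz => ?_
  rw [energyDensity_eq hφ he hz (hp e he z hz).det_pos.ne']
  ring

/-- Kähler potentials form a convex set. -/
theorem posDef_addPotential_ofReal_mul (hg : IsKahlerForm g₀)
    (hφ : IsScalar (onCharts (n := n) φ))
    (hp : ∀ e ∈ atlas (Fin n → ℂ) X, ∀ z ∈ e.target,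
      (addPotential g₀ (imPart φ) e z).PosDef) {s : ℝ} (hs : s ∈ Icc (0 : ℝ) 1)
    {e : OpenPartialHomeomorph X (Fin n → ℂ)} (he : e ∈ atlas (Fin n → ℂ) X) {z : Fin n → ℂ}
    (hz : z ∈ e.target) :
    (addPotential g₀ (imPart fun x => (s : ℂ) * φ x) e z).PosDef := by
  have hi := hφ.imPart.smooth e he
  have h1 : ddbar (fun w => imPart (fun x => (s : ℂ) * φ x) (e.symm w)) z =
      (s : ℂ) • ddbar (fun w => imPart φ (e.symm w)) z := by
    ext a b
    rw [Matrix.smul_apply, smul_eq_mul, ddbar_apply_eq, ddbar_apply_eq,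
      ← wd_const_mul _ (diffAt_of_contDiffOn e.open_target (contDiffOn_wd e.open_target hi) hz)]
    refine wd_congr ?_
    filter_upwards [e.open_target.mem_nhds hz] with w hw
    rw [← wd_const_mul _ (diffAt_of_contDiffOn e.open_target hi hw)]
    congr 1
    funext w
    simp [imPart]
  have h2 : addPotential g₀ (imPart fun x => (s : ℂ) * φ x) e z =
      ((1 - s : ℝ) : ℂ) • g₀ e z + (s : ℂ) • addPotential g₀ (imPart φ) e z := by
    simp only [addPotential, h1, smul_add, ← add_assoc, ← add_smul]
    congr 2
    push_cast
    simp
  rw [h2]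
  have hg' := hg.pos e he z hz
  rcases eq_or_lt_of_le hs.1 with h0 | h0
  · rw [← h0]; simpa using hg'
  · exact Matrix.PosDef.posSemidef_add
      (hg'.posSemidef.smul (Complex.zero_le_real.2 (sub_nonneg.2 hs.2)))
      ((hp e he z hz).smul (Complex.zero_lt_real.2 h0))

/-- The energy as an integral over the segment from `0` to `φ`. -/
theorem complexifiedKEnergy_eq (hg : IsKahlerForm g₀) (hφ : IsScalar (onCharts (n := n) φ))
    (hp : ∀ e ∈ atlas (Fin n → ℂ) X, ∀ z ∈ e.target,
      (addPotential g₀ (imPart φ) e z).PosDef) :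
    complexifiedKEnergy γ b₀ g₀ φ = n.factorial * ∫ s in (0 : ℝ)..1, (integralTop fun e z =>
      φ (e.symm z) * energyDensity γ (constC γ b₀ g₀) b₀ g₀ (fun x => (s : ℂ) * φ x) e z).im := by
  rw [complexifiedKEnergy, ← intervalIntegral.integral_const_mul]
  refine intervalIntegral.integral_congr fun s hs => ?_
  rw [uIcc_of_le zero_le_one] at hs
  refine firstVariation_eq (isScalar_onCharts fun e he => contDiffOn_const.mul (hφ.smooth e he)) ?_
  exact fun e he z hz => posDef_addPotential_ofReal_mul hg hφ hp hs he hz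

variable (hb : IsClosedRealForm b₀) (hg : IsKahlerForm g₀)
include hb hg

theorem contDiffOn_complexify {e : OpenPartialHomeomorph X (Fin n → ℂ)}
    (he : e ∈ atlas (Fin n → ℂ) X) (i j : Fin n) :
    ContDiffOn ℝ ∞ (fun z => complexify b₀ g₀ e z i j) e.target :=
  (hb.smooth e he i j).add (contDiffOn_const.mul (hg.smooth e he i j))

theorem continuousOn_energyDensity (hφ : IsScalar (onCharts (n := n) φ))
    (hp : ∀ e ∈ atlas (Fin n → ℂ) X, ∀ z ∈ e.target, (addPotential g₀ (imPart φ) e z).PosDef)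
    {e : OpenPartialHomeomorph X (Fin n → ℂ)} (he : e ∈ atlas (Fin n → ℂ) X) :
    ContinuousOn (energyDensity γ c b₀ g₀ φ e) e.target :=
  (contDiffOn_energyDensity (S := (univ : Set ℝ)) (Φ := fun _ => φ)
    (contDiffOn_complexify hb hg he) (hg.smooth e he) (smoothFamilyIn_const hφ he)
    fun _ _ z hz => (hp e he z hz).det_pos).continuousOn.comp
    (f := fun z : Fin n → ℂ => ((0 : ℝ), z)) (Continuous.prodMk_right 0).continuousOn
    fun _ hz => ⟨mem_univ _, hz⟩

theorem continuousOn_energyDensityVar (hφ : IsScalar (onCharts (n := n) φ))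
    (hψ : IsScalar (onCharts (n := n) ψ))
    (hp : ∀ e ∈ atlas (Fin n → ℂ) X, ∀ z ∈ e.target, (addPotential g₀ (imPart φ) e z).PosDef)
    {e : OpenPartialHomeomorph X (Fin n → ℂ)} (he : e ∈ atlas (Fin n → ℂ) X) :
    ContinuousOn (energyDensityVar γ c b₀ g₀ φ ψ e) e.target :=
  (contDiffOn_energyDensityVar (S := (univ : Set ℝ)) (Φ := fun _ => φ) (Ψ := fun _ => ψ)
    (contDiffOn_complexify hb hg he) (hg.smooth e he) (smoothFamilyIn_const hφ he)
    (smoothFamilyIn_const hψ he)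
    fun _ _ z hz => (hp e he z hz).det_pos).continuousOn.comp
    (f := fun z : Fin n → ℂ => ((0 : ℝ), z)) (Continuous.prodMk_right 0).continuousOn
    fun _ hz => ⟨mem_univ _, hz⟩

theorem continuousOn_segmentIntegral {S : Set ℝ} {Φ : ℝ → X → ℂ}
    (hΦ : ∀ e ∈ atlas (Fin n → ℂ) X, SmoothFamilyIn e S Φ)
    (hp : ∀ t ∈ S, ∀ e ∈ atlas (Fin n → ℂ) X, ∀ z ∈ e.target,
      (addPotential g₀ (imPart (Φ t)) e z).PosDef) :
    ContinuousOn (fun p : ℝ × ℝ => (integralTop fun e z =>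
      Φ p.2 (e.symm z) * energyDensity γ c b₀ g₀ (fun x => (p.1 : ℂ) * Φ p.2 x) e z).im)
      (Icc 0 1 ×ˢ S) := by
  have h2 : ∀ e ∈ atlas (Fin n → ℂ) X,
      SmoothFamilyIn e (Icc (0 : ℝ) 1 ×ˢ S) fun p : ℝ × ℝ => Φ p.2 := fun e he =>
    (hΦ e he).comp contDiff_snd fun _ hp => hp.2
  refine Complex.continuous_im.comp_continuousOn (continuousOn_integralTop_mul_energyDensity
    (Φ := fun p : ℝ × ℝ => fun x => (p.1 : ℂ) * Φ p.2 x) (Ψ := fun p : ℝ × ℝ => Φ p.2)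
    (fun e he => contDiffOn_complexify hb hg he) hg.smooth
    (fun e he => (h2 e he).ofReal_mul contDiff_fst) h2 ?_)
  exact fun p hp' e he z hz => (posDef_addPotential_ofReal_mul hg
    (isScalar_of_smoothFamily hΦ hp'.2) (hp p.2 hp'.2) hp'.1 he hz).det_pos

/-- Continuity of the energy along a path over any set `S` of parameters, including the end
points of an interval. -/
theorem continuousOn_complexifiedKEnergy {S : Set ℝ} {Φ : ℝ → X → ℂ}
    (hΦ : ∀ e ∈ atlas (Fin n → ℂ) X, SmoothFamilyIn e S Φ)
    (hp : ∀ t ∈ S, ∀ e ∈ atlas (Fin n → ℂ) X, ∀ z ∈ e.target,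
      (addPotential g₀ (imPart (Φ t)) e z).PosDef) :
    ContinuousOn (fun t => complexifiedKEnergy γ b₀ g₀ (Φ t)) S :=
  (continuousOn_const.mul
    (continuousOn_integral_zero_one (continuousOn_segmentIntegral hb hg hΦ hp))).congr
    fun t ht => complexifiedKEnergy_eq hg (isScalar_of_smoothFamily hΦ ht) (hp t ht)

/-- The energy is a primitive of the 1-form `σ`: since `σ` is closed, the derivative of its integral
along the segments from `0` to `φₜ` is its value at `φₜ` on the velocity. -/
theorem hasDerivAt_complexifiedKEnergy {I : Set ℝ} (hI : IsOpen I) {Φ Φ' : ℝ → X → ℂ}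
    (hΦ : ∀ e ∈ atlas (Fin n → ℂ) X, SmoothFamilyIn e I Φ)
    (hΦ' : ∀ e ∈ atlas (Fin n → ℂ) X, SmoothFamilyIn e I Φ')
    (hd : ∀ t ∈ I, ∀ x, HasDerivAt (fun s => Φ s x) (Φ' t x) t)
    (hp : ∀ t ∈ I, ∀ e ∈ atlas (Fin n → ℂ) X, ∀ z ∈ e.target,
      (addPotential g₀ (imPart (Φ t)) e z).PosDef) {t : ℝ} (ht : t ∈ I) :
    HasDerivAt (fun t => complexifiedKEnergy γ b₀ g₀ (Φ t))
      (n.factorial * (integralTop fun e z =>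
        Φ' t (e.symm z) * energyDensity γ (constC γ b₀ g₀) b₀ g₀ (Φ t) e z).im) t := by
  set c := constC γ b₀ g₀
  have hh₀ : ∀ e ∈ atlas (Fin n → ℂ) X, ∀ a b,
      ContDiffOn ℝ ∞ (fun z => complexify b₀ g₀ e z a b) e.target :=
    fun e he => contDiffOn_complexify hb hg he
  have hsc : ∀ t ∈ I, IsScalar (onCharts (n := n) (Φ t)) := fun t ht =>
    isScalar_of_smoothFamily hΦ ht
  have hsc' : ∀ t ∈ I, IsScalar (onCharts (n := n) (Φ' t)) := fun t ht =>
    isScalar_of_smoothFamily hΦ' ht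
  have hps : ∀ s ∈ Icc (0 : ℝ) 1, ∀ t ∈ I, ∀ e ∈ atlas (Fin n → ℂ) X, ∀ z ∈ e.target,
      (addPotential g₀ (imPart fun x => (s : ℂ) * Φ t x) e z).PosDef :=
    fun s hs t ht e he z hz => posDef_addPotential_ofReal_mul hg (hsc t ht) (hp t ht) hs he hz
  have h2 : ∀ e ∈ atlas (Fin n → ℂ) X,
      SmoothFamilyIn e (Icc (0 : ℝ) 1 ×ˢ I) fun p : ℝ × ℝ => Φ p.2 := fun e he =>
    (hΦ e he).comp contDiff_snd fun _ hp => hp.2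
  have h2' : ∀ e ∈ atlas (Fin n → ℂ) X,
      SmoothFamilyIn e (Icc (0 : ℝ) 1 ×ˢ I) fun p : ℝ × ℝ => Φ' p.2 := fun e he =>
    (hΦ' e he).comp contDiff_snd fun _ hp => hp.2
  -- the `t`-derivative of the integrand
  set F' : ℝ → ℝ → ℝ := fun s t => (integralTop fun e z =>
    Φ' t (e.symm z) * energyDensity γ c b₀ g₀ (fun x => (s : ℂ) * Φ t x) e z +
      Φ t (e.symm z) * energyDensityVar γ c b₀ g₀ (fun x => (s : ℂ) * Φ t x)
        (fun x => (s : ℂ) * Φ' t x) e z).im with hF'_def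
  have hF' : ContinuousOn (fun p : ℝ × ℝ => F' p.1 p.2) (Icc 0 1 ×ˢ I) := by
    refine Complex.continuous_im.comp_continuousOn (continuousOn_integralTop_energyDensity_add_var
      (Φ := fun p : ℝ × ℝ => fun x => (p.1 : ℂ) * Φ p.2 x)
      (Φ' := fun p : ℝ × ℝ => fun x => (p.1 : ℂ) * Φ' p.2 x)
      (Ψ := fun p : ℝ × ℝ => Φ p.2) (Ψ' := fun p : ℝ × ℝ => Φ' p.2) hh₀ hg.smooth
      (fun e he => (h2 e he).ofReal_mul contDiff_fst)
      (fun e he => (h2' e he).ofReal_mul contDiff_fst) h2 h2' ?_)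
    exact fun p hp' e he z hz => (hps p.1 hp'.1 p.2 hp'.2 e he z hz).det_pos
  have hderiv : ∀ s ∈ Icc (0 : ℝ) 1, ∀ t ∈ I, HasDerivAt (fun t => (integralTop fun e z =>
      Φ t (e.symm z) * energyDensity γ c b₀ g₀ (fun x => (s : ℂ) * Φ t x) e z).im) (F' s t) t := by
    intro s hs t ht
    refine Complex.imCLM.hasFDerivAt.comp_hasDerivAt t
      (hasDerivAt_integralTop_mul_energyDensity (Φ := fun t x => (s : ℂ) * Φ t x)
        (Φ' := fun t x => (s : ℂ) * Φ' t x) hh₀ hg.smooth hI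
        (fun e he => (hΦ e he).ofReal_mul contDiff_const)
        (fun e he => (hΦ' e he).ofReal_mul contDiff_const) hΦ hΦ'
        (fun t ht e he z hz => (hps s hs t ht e he z hz).det_pos)
        (fun t ht x => (hd t ht x).const_mul _) hd ht)
  have hM : HasDerivAt (fun t => complexifiedKEnergy γ b₀ g₀ (Φ t))
      (n.factorial * ∫ s in (0 : ℝ)..1, F' s t) t := by
    refine ((hasDerivAt_integral_zero_one hI (continuousOn_segmentIntegral hb hg hΦ hp) hF' hderiv
      ht).const_mul _).congr_of_eventuallyEq ?_
    filter_upwards [hI.mem_nhds ht] with t' ht'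
    exact complexifiedKEnergy_eq hg (hsc t' ht') (hp t' ht')
  refine hM.congr_deriv ?_
  congr 1
  -- closedness makes the integrand a derivative in `s`
  set K : ℝ → ℝ := fun s => (integralTop fun e z => ((s : ℂ) * Φ' t (e.symm z)) *
    energyDensity γ c b₀ g₀ (fun x => (s : ℂ) * Φ t x) e z).im with hK_def
  have hconst : ∀ {Ψ : ℝ → X → ℂ} (S : Set ℝ),
      (∀ e ∈ atlas (Fin n → ℂ) X, SmoothFamilyIn e I Ψ) →
      ∀ e ∈ atlas (Fin n → ℂ) X, SmoothFamilyIn e S fun _ : ℝ => Ψ t := fun S hΨ e he =>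
    (hΨ e he).comp contDiff_const fun _ _ => ht
  have hKc : ContinuousOn K (Icc 0 1) := by
    refine Complex.continuous_im.comp_continuousOn (continuousOn_integralTop_mul_energyDensity
      (Φ := fun (s : ℝ) x => (s : ℂ) * Φ t x) (Ψ := fun (s : ℝ) x => (s : ℂ) * Φ' t x) hh₀ hg.smooth
      (fun e he => (hconst _ hΦ e he).ofReal_mul contDiff_id)
      (fun e he => (hconst _ hΦ' e he).ofReal_mul contDiff_id) ?_)
    exact fun s hs e he z hz => (hps s hs t ht e he z hz).det_pos
  have hKd : ∀ s ∈ Ioo (0 : ℝ) 1, HasDerivAt K (F' s t) s := by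
    intro s hs
    have hs' := Ioo_subset_Icc_self hs
    have hmul : ∀ (Ψ : ℝ → X → ℂ) (s : ℝ) (x : X),
        HasDerivAt (fun s : ℝ => (s : ℂ) * Ψ t x) (Ψ t x) s := fun Ψ s x => by
      simpa using (Complex.ofRealCLM.hasDerivAt (x := s)).mul_const (Ψ t x)
    have h3 := hasDerivAt_integralTop_mul_energyDensity (γ := γ) (c := c)
      (Φ := fun (s : ℝ) x => (s : ℂ) * Φ t x)
      (Φ' := fun _ => Φ t) (Ψ := fun (s : ℝ) x => (s : ℂ) * Φ' t x) (Ψ' := fun _ => Φ' t)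
      hh₀ hg.smooth isOpen_Ioo (fun e he => (hconst _ hΦ e he).ofReal_mul contDiff_id) (hconst _ hΦ)
      (fun e he => (hconst _ hΦ' e he).ofReal_mul contDiff_id) (hconst _ hΦ')
      (fun s hs e he z hz => (hps s (Ioo_subset_Icc_self hs) t ht e he z hz).det_pos)
      (fun s _ x => hmul Φ s x) (fun s _ x => hmul Φ' s x) hs
    refine (Complex.imCLM.hasFDerivAt.comp_hasDerivAt s h3).congr_deriv ?_
    have hsΦ : IsScalar (onCharts (n := n) fun x => (s : ℂ) * Φ t x) :=
      isScalar_onCharts fun e he => contDiffOn_const.mul ((hsc t ht).smooth e he)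
    have hsΦ' : IsScalar (onCharts (n := n) fun x => (s : ℂ) * Φ' t x) :=
      isScalar_onCharts fun e he => contDiffOn_const.mul ((hsc' t ht).smooth e he)
    have hcE : ∀ e ∈ atlas (Fin n → ℂ) X, ContinuousOn (fun z => Φ' t (e.symm z) *
        energyDensity γ c b₀ g₀ (fun x => (s : ℂ) * Φ t x) e z) e.target := fun e he =>
      ((hsc' t ht).smooth e he).continuousOn.mul
        (continuousOn_energyDensity hb hg hsΦ (hps s hs' t ht) he)
    have hcV : ∀ {χ ψ : X → ℂ}, IsScalar (onCharts (n := n) χ) → IsScalar (onCharts (n := n) ψ) →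
        ∀ e ∈ atlas (Fin n → ℂ) X, ContinuousOn (fun z => χ (e.symm z) *
          energyDensityVar γ c b₀ g₀ (fun x => (s : ℂ) * Φ t x) ψ e z) e.target := fun hχ hψ e he =>
      (hχ.smooth e he).continuousOn.mul
        (continuousOn_energyDensityVar hb hg hsΦ hψ (hps s hs' t ht) he)
    rw [Complex.imCLM_apply, hF'_def]
    simp only
    rw [integralTop_add hcE (hcV hsΦ' (hsc t ht)), integralTop_add hcE (hcV (hsc t ht) hsΦ'),
      Complex.add_im, Complex.add_im, im_integralTop_mul_energyDensityVar_comm hb hg hsΦ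
        (hps s hs' t ht) hsΦ' (hsc t ht)]
  have hint : IntervalIntegrable (fun s => F' s t) volume 0 1 := by
    refine ContinuousOn.intervalIntegrable ?_
    rw [uIcc_of_le zero_le_one]
    exact hF'.comp (f := fun s : ℝ => (s, t)) (Continuous.prodMk_left t).continuousOn
      fun s hs => ⟨hs, ht⟩
  rw [intervalIntegral.integral_eq_sub_of_hasDerivAt_of_le zero_le_one hKc hKd hint, hK_def]
  have hK0 : (integralTop fun e z => ((0 : ℝ) : ℂ) * Φ' t (e.symm z) *
      energyDensity γ c b₀ g₀ (fun x => ((0 : ℝ) : ℂ) * Φ t x) e z) = 0 := by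
    simp only [mul_assoc]
    rw [integralTop_const_mul, Complex.ofReal_zero, zero_mul]
  simp only [hK0, Complex.ofReal_one, one_mul, Complex.zero_im, sub_zero]

end Energy

/-! ### The second derivative along a geodesic -/

section SecondVariation

variable {n : ℕ} {X : Type*} [TopologicalSpace X]
  [ChartedSpace (Fin n → ℂ) X] [IsManifold 𝓘(ℂ, Fin n → ℂ) ω X] [CompactSpace X] [T2Space X]
  {b₀ g₀ g : Coeff n X} {γ : ℂ} {θ c : ℝ} {φ ψ a : X → ℂ}

/-- The density whose imaginary part is the phase part of the second variation: up to the factor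
`n!` it is `γ (φ̈ (ω^ℂ)ⁿ - n i∂φ̇ ∧ ∂̄φ̇ ∧ (ω^ℂ)ⁿ⁻¹)` for the velocity `ψ` and the acceleration
`a`. -/
def phaseDensity (γ : ℂ) (b₀ g₀ : Coeff n X) (φ ψ a : X → ℂ)
    (e : OpenPartialHomeomorph X (Fin n → ℂ)) (z : Fin n → ℂ) : ℂ :=
  γ * (a (e.symm z) * (addPotential (complexify b₀ g₀) φ e z).det -
    pairing (addPotential (complexify b₀ g₀) φ e z).adjugate
      (fun i => wd (-Complex.I) i (fun w => ψ (e.symm w)) z)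
      (fun j => wd Complex.I j (fun w => ψ (e.symm w)) z))

theorem wd_onCharts_eq (hψ : IsScalar (onCharts (n := n) ψ))
    {e : OpenPartialHomeomorph X (Fin n → ℂ)} (he : e ∈ atlas (Fin n → ℂ) X) {z : Fin n → ℂ}
    (hz : z ∈ e.target) (k : ℂ) (i : Fin n) :
    wd k i (fun w => ψ (e.symm w)) z = wd k i (fun w => rePart ψ (e.symm w)) z +
      Complex.I * wd k i (fun w => imPart ψ (e.symm w)) z := by
  have hr := diffAt_of_contDiffOn e.open_target (hψ.rePart.smooth e he) hz
  have hi := diffAt_of_contDiffOn e.open_target (hψ.imPart.smooth e he) hz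
  rw [← wd_const_mul _ hi, ← wd_add hr (hi.const_mul _)]
  congr 1
  funext w
  simp only [onCharts, rePart, imPart]
  rw [mul_comm Complex.I, Complex.re_add_im]

theorem wd_I_of_real {v : X → ℂ} (hv : IsScalar (onCharts (n := n) v))
    (hreal : ∀ x, star (v x) = v x)
    {e : OpenPartialHomeomorph X (Fin n → ℂ)} (he : e ∈ atlas (Fin n → ℂ) X) {z : Fin n → ℂ}
    (hz : z ∈ e.target) (i : Fin n) :
    wd Complex.I i (fun w => v (e.symm w)) z =
      star (wd (-Complex.I) i (fun w => v (e.symm w)) z) := by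
  have h1 := wd_star (c := Complex.I) (a := i)
    (diffAt_of_contDiffOn e.open_target (hv.smooth e he) hz)
  simp only [onCharts, hreal, Complex.star_def, Complex.conj_I] at h1
  exact h1

/-- Along a geodesic the phase density is the integrand of the second variation. -/
theorem im_phaseDensity (hb : IsClosedRealForm b₀)
    (hγ : γ = (‖γ‖ : ℂ) * Complex.exp (-(θ * Complex.I)))
    (hφ : IsScalar (onCharts (n := n) φ)) (hψ : IsScalar (onCharts (n := n) ψ))
    {e : OpenPartialHomeomorph X (Fin n → ℂ)} (he : e ∈ atlas (Fin n → ℂ) X) {z : Fin n → ℂ}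
    (hz : z ∈ e.target) (hpos : (addPotential g₀ (imPart φ) e z).PosDef)
    (hcal : 0 < (Complex.exp (-(θ * Complex.I)) *
      powTop (addPotential (complexify b₀ g₀) φ e z)).re)
    (him : ((a (e.symm z)).im : ℂ) - gradNormSq (addPotential g₀ (imPart φ) e z)
      (fun w => imPart ψ (e.symm w)) z = 0)
    (hre : (Complex.exp (-(θ * Complex.I)) *
      (a (e.symm z) * powTop (addPotential (complexify b₀ g₀) φ e z) -
        n * wedgePowTop (dfdbarf (fun w => ψ (e.symm w)) z)
          (addPotential (complexify b₀ g₀) φ e z))).re = 0) :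
    0 ≤ (phaseDensity γ b₀ g₀ φ ψ a e z).im ∧
    (((‖γ‖ * (lagrangianRadius (addPotential g₀ (imPart φ) e z) (addPotential b₀ (rePart φ) e z) /
        Real.cos (lagrangianPhase (addPotential g₀ (imPart φ) e z)
          (addPotential b₀ (rePart φ) e z) - θ)) *
        sumSquares (addPotential g₀ (imPart φ) e z) (addPotential b₀ (rePart φ) e z)
          (fun i => dz i (fun w => rePart ψ (e.symm w)) z)
          (fun i => dz i (fun w => imPart ψ (e.symm w)) z) : ℝ) : ℂ) *
        powTop (addPotential g₀ (imPart φ) e z)) =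
      (n.factorial : ℂ) * ((phaseDensity γ b₀ g₀ φ ψ a e z).im : ℂ) := by
  have hbφ : (addPotential b₀ (rePart φ) e z).IsHermitian :=
    isHermitian_addPotential hb.real hφ.rePart (star_rePart φ) he hz
  rw [phaseDensity]
  rw [addPotential_complexify hφ he hz] at hcal hre ⊢
  have hdz : dz (n := n) = wd (-Complex.I) := dz_eq_wd
  rw [hdz]
  rw [mul_wedgePowTop_dfdbarf, powTop_eq] at hre
  set G := addPotential g₀ (imPart φ) e z
  set B := addPotential b₀ (rePart φ) e z
  set u : Fin n → ℂ := fun i => wd (-Complex.I) i (fun w => rePart ψ (e.symm w)) z with hu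
  set v : Fin n → ℂ := fun i => wd (-Complex.I) i (fun w => imPart ψ (e.symm w)) z with hv
  have hcos := cos_phase_pos hpos hbφ hcal
  have h1 : (fun i => wd (-Complex.I) i (fun w => ψ (e.symm w)) z) = u + Complex.I • v := by
    funext i
    exact wd_onCharts_eq hψ he hz _ i
  have h2 : (fun j => wd Complex.I j (fun w => ψ (e.symm w)) z) =
      star u + Complex.I • star v := by
    funext j
    rw [wd_onCharts_eq hψ he hz, wd_I_of_real hψ.rePart (star_rePart ψ) he hz,
      wd_I_of_real hψ.imPart (star_imPart ψ) he hz]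
    rfl
  have h3 : ((a (e.symm z)).im : ℂ) = pairing G⁻¹ v (star v) := by
    rw [sub_eq_zero.1 him, gradNormSq_eq_pairing]
    congr 1
    funext j
    rw [wd_I_of_real hψ.imPart (star_imPart ψ) he hz]
    rfl
  rw [h1, h2] at hre ⊢
  have h4 : (Complex.exp (-(θ * Complex.I)) * (a (e.symm z) * (B + Complex.I • G).det -
      pairing (B + Complex.I • G).adjugate (u + Complex.I • v)
        (star u + Complex.I • star v))).re = 0 := by
    have h5 : Complex.exp (-(θ * Complex.I)) * (a (e.symm z) * ((n.factorial : ℂ) *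
        (B + Complex.I • G).det) - (n.factorial : ℂ) * pairing (B + Complex.I • G).adjugate
          (u + Complex.I • v) (star u + Complex.I • star v)) =
        ((n.factorial : ℝ) : ℂ) * (Complex.exp (-(θ * Complex.I)) * (a (e.symm z) *
          (B + Complex.I • G).det - pairing (B + Complex.I • G).adjugate (u + Complex.I • v)
            (star u + Complex.I • star v))) := by
      push_cast
      ring
    rw [h5, Complex.re_ofReal_mul] at hre
    exact (mul_eq_zero.1 hre).resolve_left (by exact_mod_cast n.factorial_ne_zero)
  have h6 := im_mul_sub_pairing hpos hbφ hcos h3 h4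
  have h7 : (γ * (a (e.symm z) * (B + Complex.I • G).det -
      pairing (B + Complex.I • G).adjugate (u + Complex.I • v)
        (star u + Complex.I • star v))).im =
      ‖γ‖ * (lagrangianRadius G B / Real.cos (lagrangianPhase G B - θ) * sumSquares G B u v *
        G.det.re) := by
    rw [← h6, ← Complex.im_ofReal_mul, ← mul_assoc, ← hγ]
  have hdet := Complex.pos_iff.1 hpos.det_pos
  refine ⟨?_, ?_⟩
  · rw [h7]
    have := lagrangianRadius_pos G B
    have := sumSquares_nonneg G B u v
    have := hdet.1
    positivity
  · rw [h7, powTop_eq]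
    have h8 : G.det = (G.det.re : ℂ) := by apply Complex.ext <;> simp [hdet.2]
    conv_lhs => rw [h8]
    push_cast
    ring

section Real

variable (hg : IsClosedForm g)
  (hpos : ∀ e ∈ atlas (Fin n → ℂ) X, ∀ z ∈ e.target, (g e z).PosDef)
include hg hpos

theorem continuousOn_lichNormSq {v : X → ℂ} (hv : IsScalar (onCharts (n := n) v))
    {e : OpenPartialHomeomorph X (Fin n → ℂ)} (he : e ∈ atlas (Fin n → ℂ) X) :
    ContinuousOn (lichNormSq (g e) fun w => v (e.symm w)) e.target := by
  have hp : ∀ z ∈ e.target, 0 < (g e z).det := fun z hz => (hpos e he z hz).det_pos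
  have hl : ∀ i j, ContinuousOn (fun z => lich (g e) (fun w => v (e.symm w)) z i j) e.target := by
    intro i j
    have h1 := contDiffOn_wd (c := Complex.I) (a := j) e.open_target
      (contDiffOn_gradUp e.open_target (hg.smooth e he) hp (hv.smooth e he) i)
    refine h1.continuousOn.congr fun z _ => ?_
    simp only [lich, Matrix.of_apply, dzbar_eq_wd]
    rfl
  refine continuousOn_finsetSum _ fun i _ => continuousOn_finsetSum _ fun j _ =>
    continuousOn_finsetSum _ fun k _ => continuousOn_finsetSum _ fun l _ => ?_
  exact (((hg.smooth e he i j).continuousOn.mul (contDiffOn_matrix_inv (hg.smooth e he)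
    (fun z hz => (hp z hz).ne') k l).continuousOn).mul (hl i k)).mul (hl j l).star

/-- The part of the second variation that depends on `ω` only, when the imaginary part `f` of the
acceleration is `‖∂v‖²`. -/
theorem integralTop_add_realVar_eq {v f : X → ℂ} (hv : IsScalar (onCharts (n := n) v))
    (hreal : ∀ x, star (v x) = v x) (hf : IsScalar (onCharts (n := n) f))
    (hgeo : ∀ e ∈ atlas (Fin n → ℂ) X, ∀ z ∈ e.target,
      f (e.symm z) = gradNormSq (g e z) (fun w => v (e.symm w)) z) :
    integralTop (fun e z => f (e.symm z) *
        (((g e z).adjugate * ddbar (logDet (g e)) z).trace + c * (g e z).det)) +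
      integralTop (fun e z => v (e.symm z) * realVar c g v e z) =
      integralTop (fun e z => lichNormSq (g e) (fun w => v (e.symm w)) z * (g e z).det) := by
  have hdet : ∀ e ∈ atlas (Fin n → ℂ) X, ∀ z ∈ e.target, 0 < (g e z).det :=
    fun e he z hz => (hpos e he z hz).det_pos
  have h0 : ∀ e ∈ atlas (Fin n → ℂ) X, ∀ z ∈ e.target, (g e z).det ≠ 0 :=
    fun e he z hz => (hdet e he z hz).ne'
  have hA := hg.isClosedCoform_adjugate h0
  have hR : ∀ e ∈ atlas (Fin n → ℂ) X, ContinuousOn (fun z => f (e.symm z) *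
      ((g e z).adjugate * ddbar (logDet (g e)) z).trace) e.target := fun e he =>
    (hf.smooth e he).continuousOn.mul (contDiffOn_trace (contDiffOn_matrix_mul (hA.smooth e he)
      ((hg.isClosedForm_logDet hdet).smooth e he))).continuousOn
  have hD : ∀ e ∈ atlas (Fin n → ℂ) X, ContinuousOn (fun z => (c : ℂ) * (f (e.symm z) *
      (g e z).det)) e.target := fun e he =>
    continuousOn_const.mul ((hf.smooth e he).continuousOn.mul
      (contDiffOn_det (hg.smooth e he)).continuousOn)
  have h1 : integralTop (fun e z => f (e.symm z) *
        (((g e z).adjugate * ddbar (logDet (g e)) z).trace + c * (g e z).det)) =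
      integralTop (fun e z => f (e.symm z) *
        ((g e z).adjugate * ddbar (logDet (g e)) z).trace) +
      c * integralTop (fun e z => f (e.symm z) * (g e z).det) := by
    rw [← integralTop_const_mul, ← integralTop_add hR hD]
    refine integralTop_congr fun e _ z _ => ?_
    ring
  have h2 : integralTop (fun e z => f (e.symm z) *
        ((g e z).adjugate * ddbar (logDet (g e)) z).trace) =
      integralTop (fun e z => gradNormSq (g e z) (fun w => v (e.symm w)) z *
        ((g e z).adjugate * ddbar (logDet (g e)) z).trace) :=
    integralTop_congr fun e he z hz => by rw [hgeo e he z hz]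
  have h3 : integralTop (fun e z => f (e.symm z) * (g e z).det) =
      -integralTop (fun e z => v (e.symm z) *
        ((g e z).adjugate * ddbar (fun x => v (e.symm x)) z).trace) := by
    rw [integralTop_mul_trace_ddbar hA hv hv, neg_neg]
    refine integralTop_congr fun e he z hz => ?_
    rw [hgeo e he z hz, gradNormSq_eq_pairing, adjugate_eq_det_smul_inv (h0 e he z hz),
      pairing_eq_dotProduct, pairing_eq_dotProduct, Matrix.smul_mulVec, dotProduct_smul,
      smul_eq_mul, mul_comm]
  rw [h1, h2, h3, integralTop_mul_realVar hg hpos hv hv,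
    integralTop_lichNormSq hg hdet (fun e he z hz => (hpos e he z hz).isHermitian) hv
      fun e he z hz => hreal _]
  ring

end Real

variable (hb : IsClosedRealForm b₀) (hg : IsKahlerForm g₀)
  (hγ : γ = (‖γ‖ : ℂ) * Complex.exp (-(θ * Complex.I)))
  (hφ : IsScalar (onCharts (n := n) φ)) (hψ : IsScalar (onCharts (n := n) ψ))
  (ha : IsScalar (onCharts (n := n) a))
  (hpos : ∀ e ∈ atlas (Fin n → ℂ) X, ∀ z ∈ e.target, (addPotential g₀ (imPart φ) e z).PosDef)
  (hcal : ∀ e ∈ atlas (Fin n → ℂ) X, ∀ z ∈ e.target, 0 < (Complex.exp (-(θ * Complex.I)) *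
    powTop (addPotential (complexify b₀ g₀) φ e z)).re)
  (him : ∀ e ∈ atlas (Fin n → ℂ) X, ∀ z ∈ e.target, ((a (e.symm z)).im : ℂ) -
    gradNormSq (addPotential g₀ (imPart φ) e z) (fun w => imPart ψ (e.symm w)) z = 0)
  (hre : ∀ e ∈ atlas (Fin n → ℂ) X, ∀ z ∈ e.target, (Complex.exp (-(θ * Complex.I)) *
    (a (e.symm z) * powTop (addPotential (complexify b₀ g₀) φ e z) -
      n * wedgePowTop (dfdbarf (fun w => ψ (e.symm w)) z)
        (addPotential (complexify b₀ g₀) φ e z))).re = 0)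

include hb hg hφ hψ ha hpos

theorem continuousOn_phaseDensity {e : OpenPartialHomeomorph X (Fin n → ℂ)}
    (he : e ∈ atlas (Fin n → ℂ) X) :
    ContinuousOn (phaseDensity γ b₀ g₀ φ ψ a e) e.target := by
  have hH := ((hb.isClosedForm.add (hg.toIsClosedRealForm.isClosedForm.smul
    Complex.I)).addPotential hφ).smooth e he
  have hA := isClosedCoform_adjugate_addPotential_complexify hb hg hφ hpos
  exact continuousOn_const.mul (((ha.smooth e he).continuousOn.mul
    (contDiffOn_det hH).continuousOn).sub (continuousOn_pairing
      (A := fun e z => (addPotential (complexify b₀ g₀) φ e z).adjugate)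
      (χ := onCharts ψ) (ψ := onCharts ψ) hA.smooth hψ hψ he))

include hγ hcal him hre

/-- The second variation along a geodesic. The left side is the derivative of `σ` on the velocity
`ψ` for the acceleration `a`. -/
theorem second_variation_eq :
    n.factorial * (integralTop fun e z => a (e.symm z) * energyDensity γ c b₀ g₀ φ e z +
      ψ (e.symm z) * energyDensityVar γ c b₀ g₀ φ ψ e z).im =
    secondVariation γ θ (addPotential b₀ (rePart φ)) (addPotential g₀ (imPart φ)) ψ := by
  have hG := hg.toIsClosedRealForm.isClosedForm.addPotential hφ.imPart
  have hH := ((hb.isClosedForm.add (hg.toIsClosedRealForm.isClosedForm.smul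
    Complex.I)).addPotential hφ).smooth
  have hA := isClosedCoform_adjugate_addPotential_complexify hb hg hφ hpos
  have hdet : ∀ e ∈ atlas (Fin n → ℂ) X, ∀ z ∈ e.target,
      0 < (addPotential g₀ (imPart φ) e z).det := fun e he z hz => (hpos e he z hz).det_pos
  set G := addPotential g₀ (imPart φ) with hG_def
  -- the real part of the energy density
  set ρ : OpenPartialHomeomorph X (Fin n → ℂ) → (Fin n → ℂ) → ℂ := fun e z =>
    ((G e z).adjugate * ddbar (logDet (G e)) z).trace + c * (G e z).det with hρ_def
  have hρc : ∀ e ∈ atlas (Fin n → ℂ) X, ContinuousOn (ρ e) e.target := fun e he =>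
    (contDiffOn_trace (contDiffOn_matrix_mul (contDiffOn_adjugate (hG.smooth e he))
      ((hG.isClosedForm_logDet hdet).smooth e he))).continuousOn.add
      (continuousOn_const.mul (contDiffOn_det (hG.smooth e he)).continuousOn)
  have hρreal : ∀ e ∈ atlas (Fin n → ℂ) X, ∀ z ∈ e.target, (ρ e z).im = 0 := by
    intro e he z hz
    refine Complex.conj_eq_iff_im.1 ?_
    have h1 := star_trace_mul (hpos e he z hz).isHermitian.adjugate
      (isHermitian_ddbar_logDet hG hpos he hz)
    have h2 : star (G e z).det = (G e z).det := by
      rw [← Matrix.det_conjTranspose, (hpos e he z hz).isHermitian.eq]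
    rw [← Complex.star_def, hρ_def]
    simp only
    rw [star_add, star_mul', h1, h2, Complex.star_def, Complex.conj_ofReal]
  have hac := fun e he => (ha.smooth e he).continuousOn
  have hψc := fun e he => (hψ.smooth e he).continuousOn
  have c1 : ∀ e ∈ atlas (Fin n → ℂ) X, ContinuousOn (fun z =>
      a (e.symm z) * energyDensity γ c b₀ g₀ φ e z) e.target := fun e he =>
    (hac e he).mul (continuousOn_energyDensity hb hg hφ hpos he)
  have c2 : ∀ e ∈ atlas (Fin n → ℂ) X, ContinuousOn (fun z =>
      ψ (e.symm z) * energyDensityVar γ c b₀ g₀ φ ψ e z) e.target := fun e he =>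
    (hψc e he).mul (continuousOn_energyDensityVar hb hg hφ hψ hpos he)
  have c3 : ∀ e ∈ atlas (Fin n → ℂ) X, ContinuousOn (fun z =>
      γ * (a (e.symm z) * (addPotential (complexify b₀ g₀) φ e z).det)) e.target := fun e he =>
    continuousOn_const.mul ((hac e he).mul (contDiffOn_det (hH e he)).continuousOn)
  have c4 : ∀ e ∈ atlas (Fin n → ℂ) X, ContinuousOn (fun z => a (e.symm z) * ρ e z) e.target :=
    fun e he => (hac e he).mul (hρc e he)
  have c5 : ∀ e ∈ atlas (Fin n → ℂ) X, ContinuousOn (fun z => γ *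
      pairing (addPotential (complexify b₀ g₀) φ e z).adjugate
        (fun i => wd (-Complex.I) i (fun w => ψ (e.symm w)) z)
        (fun j => wd Complex.I j (fun w => ψ (e.symm w)) z)) e.target := fun e he =>
    continuousOn_const.mul (continuousOn_pairing
      (A := fun e z => (addPotential (complexify b₀ g₀) φ e z).adjugate)
      (χ := onCharts ψ) (ψ := onCharts ψ) hA.smooth hψ hψ he)
  -- the phase part is split off; the term in `ψ` is integrated by parts in `h3`
  have h1 : integralTop (fun e z => a (e.symm z) * energyDensity γ c b₀ g₀ φ e z) =
      integralTop (fun e z => γ * (a (e.symm z) *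
        (addPotential (complexify b₀ g₀) φ e z).det)) +
      integralTop (fun e z => a (e.symm z) * ρ e z) := by
    rw [← integralTop_add c3 c4]
    refine integralTop_congr fun e _ z _ => ?_
    rw [energyDensity, hρ_def]
    ring
  have h2 : (integralTop (fun e z => a (e.symm z) * ρ e z)).im =
      (integralTop (fun e z => imPart a (e.symm z) * ρ e z)).re := by
    rw [integralTop_im (D := fun e z => a (e.symm z) * ρ e z) c4]
    congr 1
    refine integralTop_congr fun e he z hz => ?_
    have h := hρreal e he z hz
    apply Complex.ext <;> simp [imPart, h]
  have h3 : integralTop (phaseDensity γ b₀ g₀ φ ψ a) =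
      integralTop (fun e z => γ * (a (e.symm z) *
        (addPotential (complexify b₀ g₀) φ e z).det)) +
      γ * integralTop (fun e z => ψ (e.symm z) *
        ((addPotential (complexify b₀ g₀) φ e z).adjugate *
          ddbar (fun w => ψ (e.symm w)) z).trace) := by
    rw [integralTop_mul_trace_ddbar hA hψ hψ, mul_neg, ← sub_eq_add_neg, ← integralTop_const_mul,
      ← integralTop_sub c3 c5]
    refine integralTop_congr fun e _ z _ => ?_
    rw [phaseDensity]
    ring
  have h4 := integralTop_add_realVar_eq (c := c) hG hpos hψ.imPart (star_imPart ψ) ha.imPart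
    fun e he z hz => sub_eq_zero.1 (him e he z hz)
  have h5 : (integralTop (fun e z =>
      lichNormSq (G e) (fun w => imPart ψ (e.symm w)) z * powTop (G e z))).re =
      n.factorial * (integralTop (fun e z =>
        lichNormSq (G e) (fun w => imPart ψ (e.symm w)) z * (G e z).det)).re := by
    rw [← Complex.re_ofReal_mul, Complex.ofReal_natCast, ← integralTop_const_mul]
    congr 2
    funext e z
    rw [powTop_eq]
    ring
  rw [integralTop_add c1 c2, Complex.add_im,
    im_integralTop_mul_energyDensityVar hb hg hφ hpos hψ hψ, h1, Complex.add_im, h2,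
    secondVariation, h5, ← h4, Complex.add_re]
  have h6 : (integralTop (fun e z =>
      ((‖γ‖ * (lagrangianRadius (G e z) (addPotential b₀ (rePart φ) e z) /
        Real.cos (lagrangianPhase (G e z) (addPotential b₀ (rePart φ) e z) - θ)) *
        sumSquares (G e z) (addPotential b₀ (rePart φ) e z)
          (fun a => dz a (fun w => rePart ψ (e.symm w)) z)
          (fun a => dz a (fun w => imPart ψ (e.symm w)) z) : ℝ) : ℂ) * powTop (G e z))).re =
      n.factorial * (integralTop (phaseDensity γ b₀ g₀ φ ψ a)).im := by
    rw [integralTop_im (D := phaseDensity γ b₀ g₀ φ ψ a)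
      fun e he => continuousOn_phaseDensity hb hg hφ hψ ha hpos he, ← Complex.re_ofReal_mul,
      Complex.ofReal_natCast, ← integralTop_const_mul]
    congr 1
    exact integralTop_congr fun e he z hz => (im_phaseDensity hb hγ hφ hψ he hz (hpos e he z hz)
      (hcal e he z hz) (him e he z hz) (hre e he z hz)).2
  rw [h6, h3, Complex.add_im]
  ring

/-- The integrands of both parts of the second variation are nonnegative, the second one because
`cos η > 0`. -/
theorem secondVariation_nonneg :
    0 ≤ secondVariation γ θ (addPotential b₀ (rePart φ)) (addPotential g₀ (imPart φ)) ψ := by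
  have hG := hg.toIsClosedRealForm.isClosedForm.addPotential hφ.imPart
  refine add_nonneg (integralTop_re_nonneg (fun e he => ?_) fun e he z hz => ?_)
    (integralTop_re_nonneg (fun e he => ?_) fun e he z hz => ?_)
  · simp only [powTop_eq]
    exact (continuousOn_lichNormSq hG hpos hψ.imPart he).mul
      (continuousOn_const.mul (contDiffOn_det (hG.smooth e he)).continuousOn)
  · rw [powTop_eq]
    exact (Complex.nonneg_iff.1 (mul_nonneg (lichNormSq_nonneg _ (hpos e he z hz))
      (mul_nonneg (Nat.cast_nonneg _) (hpos e he z hz).det_pos.le))).1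
  · refine ContinuousOn.congr (f := fun z =>
      (n.factorial : ℂ) * ((phaseDensity γ b₀ g₀ φ ψ a e z).im : ℂ)) ?_ fun z hz =>
      (im_phaseDensity hb hγ hφ hψ he hz (hpos e he z hz)
        (hcal e he z hz) (him e he z hz) (hre e he z hz)).2
    exact continuousOn_const.mul (Complex.continuous_ofReal.comp_continuousOn
      (Complex.continuous_im.comp_continuousOn
        (continuousOn_phaseDensity hb hg hφ hψ ha hpos he)))
  · have h := im_phaseDensity hb hγ hφ hψ he hz (hpos e he z hz)
      (hcal e he z hz) (him e he z hz) (hre e he z hz)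
    rw [h.2, ← Complex.ofReal_natCast, Complex.re_ofReal_mul, Complex.ofReal_re]
    exact mul_nonneg (Nat.cast_nonneg _) h.1

end SecondVariation

section Velocity

variable {n : ℕ} {X : Type*} [TopologicalSpace X] {T : Set ℝ} {Φ : ℝ → X → ℂ}

theorem velocity_eq_deriv {t : ℝ} (ht : t ∈ interior T) (x : X) :
    velocity T Φ t x = deriv (fun s => Φ s x) t :=
  derivWithin_of_mem_nhds (mem_interior_iff_mem_nhds.1 ht)

theorem SmoothFamilyIn.hasDerivAt {e : OpenPartialHomeomorph X (Fin n → ℂ)}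
    (h : SmoothFamilyIn e (interior T) Φ) {t : ℝ} (ht : t ∈ interior T) {z : Fin n → ℂ}
    (hz : z ∈ e.target) :
    HasDerivAt (fun s => Φ s (e.symm z))
      (fderiv ℝ (fun q : ℝ × (Fin n → ℂ) => Φ q.1 (e.symm q.2)) (t, z) (1, 0)) t := by
  have h1 : DifferentiableAt ℝ (fun q : ℝ × (Fin n → ℂ) => Φ q.1 (e.symm q.2)) (t, z) :=
    (h.differentiableOn (by simp)).differentiableAt
      ((isOpen_interior.prod e.open_target).mem_nhds ⟨ht, hz⟩)
  have h2 : HasDerivAt (fun s : ℝ => (s, z)) ((1 : ℝ), (0 : Fin n → ℂ)) t :=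
    (hasDerivAt_id t).prodMk (hasDerivAt_const t z)
  exact h1.hasFDerivAt.comp_hasDerivAt t h2

theorem SmoothFamilyIn.velocity {e : OpenPartialHomeomorph X (Fin n → ℂ)}
    (h : SmoothFamilyIn e (interior T) Φ) : SmoothFamilyIn e (interior T) (velocity T Φ) := by
  have h1 := (ContDiffOn.fderiv_of_isOpen h (isOpen_interior.prod e.open_target)
    (m := ∞) (by simp)).clm_apply (contDiffOn_const (c := ((1 : ℝ), (0 : Fin n → ℂ))))
  refine h1.congr fun q hq => ?_
  rw [velocity_eq_deriv hq.1, (h.hasDerivAt hq.1 hq.2).deriv]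

theorem hasDerivAt_velocity [ChartedSpace (Fin n → ℂ) X]
    (h : ∀ e ∈ atlas (Fin n → ℂ) X, SmoothFamilyIn e (interior T) Φ) {t : ℝ}
    (ht : t ∈ interior T) (x : X) : HasDerivAt (fun s => Φ s x) (velocity T Φ t x) t := by
  have h1 := (h (chartAt (Fin n → ℂ) x) (chart_mem_atlas _ x)).hasDerivAt ht
    (mem_chart_target (Fin n → ℂ) x)
  rw [(chartAt (Fin n → ℂ) x).left_inv (mem_chart_source (Fin n → ℂ) x)] at h1
  rw [velocity_eq_deriv ht]
  exact h1.differentiableAt.hasDerivAt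

end Velocity

end ComplexifiedKahler

end

theorem mainTheorem4 {n : ℕ} {X : Type*} [TopologicalSpace X] [ChartedSpace (Fin n → ℂ) X]
    [IsManifold 𝓘(ℂ, Fin n → ℂ) ω X] [CompactSpace X] [T2Space X]
    (b₀ g₀ : ComplexifiedKahler.Coeff n X)
    (hb : ComplexifiedKahler.IsClosedRealForm b₀) (hg : ComplexifiedKahler.IsKahlerForm g₀)
    (γ : ℂ) (θ : ℝ)
    (hγ : γ = (‖γ‖ : ℂ) * Complex.exp (-(θ * Complex.I)))
    (hγreal : (γ * ComplexifiedKahler.integralTop (fun e z =>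
      ComplexifiedKahler.powTop (ComplexifiedKahler.complexify b₀ g₀ e z))).im = 0)
    (T : Set ℝ) (hT : Convex ℝ T) (φ : ℝ → X → ℂ)
    (hsmooth : ContMDiffOn (𝓘(ℝ, ℝ).prod 𝓘(ℝ, Fin n → ℂ)) 𝓘(ℝ, ℂ) ∞
      (fun p : ℝ × X => φ p.1 p.2) (T ×ˢ Set.univ))
    (hcal : ∀ t ∈ T, φ t ∈ ComplexifiedKahler.almostCalibrated θ b₀ g₀)
    (hgeo : ComplexifiedKahler.IsGeodesic θ b₀ g₀ T φ) :
    ConvexOn ℝ T (fun t => ComplexifiedKahler.complexifiedKEnergy γ b₀ g₀ (φ t)) ∧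
    ∀ t ∈ interior T,
      DifferentiableAt ℝ (fun t => ComplexifiedKahler.complexifiedKEnergy γ b₀ g₀ (φ t)) t ∧
      HasDerivAt (deriv fun t => ComplexifiedKahler.complexifiedKEnergy γ b₀ g₀ (φ t))
        (ComplexifiedKahler.secondVariation γ θ
          (ComplexifiedKahler.addPotential b₀ (ComplexifiedKahler.rePart (φ t)))
          (ComplexifiedKahler.addPotential g₀ (ComplexifiedKahler.imPart (φ t)))
          (ComplexifiedKahler.velocity T φ t)) t := by
  have hΦ : ∀ e ∈ atlas (Fin n → ℂ) X, ComplexifiedKahler.SmoothFamilyIn e T φ :=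
    fun e he => ComplexifiedKahler.contDiffOn_comp_symm_param hsmooth he
  have hΦi : ∀ e ∈ atlas (Fin n → ℂ) X, ComplexifiedKahler.SmoothFamilyIn e (interior T) φ :=
    fun e he => (hΦ e he).mono (Set.prod_mono interior_subset le_rfl)
  have hΦ' := fun e he => (hΦi e he).velocity
  have hΦ'' := fun e he => (hΦ' e he).velocity
  have hpos : ∀ t ∈ T, ∀ e ∈ atlas (Fin n → ℂ) X, ∀ z ∈ e.target,
      (ComplexifiedKahler.addPotential g₀ (ComplexifiedKahler.imPart (φ t)) e z).PosDef :=
    fun t ht e he z hz => ((hcal t ht).2 e he z hz).1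
  have hposi := fun t (ht : t ∈ interior T) => hpos t (interior_subset ht)
  have hd1 := fun t (ht : t ∈ interior T) =>
    ComplexifiedKahler.hasDerivAt_complexifiedKEnergy (γ := γ) hb hg isOpen_interior hΦi hΦ'
      (fun _ ht x => ComplexifiedKahler.hasDerivAt_velocity hΦi ht x) hposi ht
  have hsc := fun t (ht : t ∈ interior T) =>
    ComplexifiedKahler.isScalar_of_smoothFamily hΦi ht
  have hsc' := fun t (ht : t ∈ interior T) =>
    ComplexifiedKahler.isScalar_of_smoothFamily hΦ' ht
  have hsc'' := fun t (ht : t ∈ interior T) =>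
    ComplexifiedKahler.isScalar_of_smoothFamily hΦ'' ht
  have hcal' := fun t (ht : t ∈ interior T) e he z hz =>
    ((hcal t (interior_subset ht)).2 e he z hz).2
  have him := fun t (ht : t ∈ interior T) e he z hz =>
    (hgeo t (interior_subset ht) e he z hz).1
  have hre := fun t (ht : t ∈ interior T) e he z hz =>
    (hgeo t (interior_subset ht) e he z hz).2
  -- near an interior point the first derivative is `σ` on the velocity, by `hd1`
  have hd2 : ∀ t ∈ interior T,
      HasDerivAt (deriv fun t => ComplexifiedKahler.complexifiedKEnergy γ b₀ g₀ (φ t))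
        (ComplexifiedKahler.secondVariation γ θ
          (ComplexifiedKahler.addPotential b₀ (ComplexifiedKahler.rePart (φ t)))
          (ComplexifiedKahler.addPotential g₀ (ComplexifiedKahler.imPart (φ t)))
          (ComplexifiedKahler.velocity T φ t)) t := by
    intro t ht
    have h1 := ComplexifiedKahler.hasDerivAt_integralTop_mul_energyDensity (γ := γ)
      (c := ComplexifiedKahler.constC γ b₀ g₀)
      (fun e he => ComplexifiedKahler.contDiffOn_complexify hb hg he) hg.smooth isOpen_interior
      hΦi hΦ' hΦ' hΦ'' (fun t ht e he z hz => (hposi t ht e he z hz).det_pos)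
      (fun _ ht x => ComplexifiedKahler.hasDerivAt_velocity hΦi ht x)
      (fun _ ht x => ComplexifiedKahler.hasDerivAt_velocity hΦ' ht x) ht
    have h2 := (Complex.imCLM.hasFDerivAt.comp_hasDerivAt t h1).const_mul (n.factorial : ℝ)
    refine (h2.congr_of_eventuallyEq ?_).congr_deriv
      (ComplexifiedKahler.second_variation_eq hb hg hγ (hsc t ht) (hsc' t ht) (hsc'' t ht)
        (hposi t ht) (hcal' t ht) (him t ht) (hre t ht))
    filter_upwards [isOpen_interior.mem_nhds ht] with s hs
    exact (hd1 s hs).deriv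
  refine ⟨convexOn_of_deriv2_nonneg hT
    (ComplexifiedKahler.continuousOn_complexifiedKEnergy hb hg hΦ hpos)
    (fun t ht => (hd1 t ht).differentiableAt.differentiableWithinAt)
    (fun t ht => (hd2 t ht).differentiableAt.differentiableWithinAt) fun t ht => ?_,
    fun t ht => ⟨(hd1 t ht).differentiableAt, hd2 t ht⟩⟩
  rw [Function.iterate_succ_apply, Function.iterate_one, (hd2 t ht).deriv]
  exact ComplexifiedKahler.secondVariation_nonneg hb hg hγ (hsc t ht) (hsc' t ht) (hsc'' t ht)
    (hposi t ht) (hcal' t ht) (him t ht) (hre t ht)
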